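/- For $\alpha\in\mathbb{C}$ let $L_\alpha=-\partial_x^2+\left(-\tfrac14+\alpha\right)\frac1{x^2}$. On the Hilbert space $L^2[0,\infty[$ let $L_\alpha^{\min}$ be the closure of $L_\alpha$ restricted to $C_{\mathrm c}^\infty]0,\infty[$, and let $L_\alpha^{\max}$ be the operator $f\mapsto L_\alpha f$ (in the sense of distributions on $]0,\infty[$) with domain $\{f\in L^2[0,\infty[\;:\;L_\alpha f\in L^2[0,\infty[\}$. Let $\xi$ be a smooth compactly supported cutoff on $\mathbb{R}$ equal to $1$ in a neighbourhood of $0$. For $\operatorname{Re} m>-1$ let $H_m$ be the restriction of $L_{m^2}^{\max}$ to $$\operatorname{Dom} L_{m^2}^{\min}+\mathbb{C}\,x^{\frac12+m}\xi .$$ Let $(U_\tau f)(x)=e^{\tau/2}f(e^\tau x)$, $\tau\in\mathbb{R}$, and call an operator $B$ homogeneous of degree $\nu$ if $U_\tau BU_\tau^{-1}=e^{\nu\tau}B$ for all $\tau\in\mathbb{R}$. For an open $\Theta\subset\mathbb{C}$, a map $\Theta\ni z\mapsto T(z)$ with values in closed operators on a Banach space $\mathcal H$ is a holomorphic family of closed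 operators if each $z_0\in\Theta$ has an open neighbourhood $\Theta_0\subset\Theta$, a Banach space $\mathcal K$ and a holomorphic family of injective bounded operators $\Theta_0\ni z\mapsto B(z)\in B(\mathcal K,\mathcal H)$ such that $\operatorname{Ran}B(z)=\operatorname{Dom}T(z)$ for all $z\in\Theta_0$ and $\Theta_0\ni z\mapsto T(z)B(z)\in B(\mathcal K,\mathcal H)$ is a holomorphic family of bounded operators. Then: 1. For $\operatorname{Re} m\ge 1$, $L_{m^2}^{\min}=H_m=L_{m^2}^{\max}$. 2. For $-1<\operatorname{Re} m<1$, $L_{m^2}^{\min}\subsetneq H_m\subsetneq L_{m^2}^{\max}$, and $\operatorname{Dom}L_{m^2}^{\min}$ has codimension $1$ in $\operatorname{Dom}H_m$, which has codimension $1$ in $\operatorname{Dom}L_{m^2}^{\max}$. 3. For $\operatorname{Re} m>-1$, $H_m$ is densely defined and $H_m^*=H_{\overline m}$. Hence, for real $m>-1$, $H_m$ is self-adjoint. 4. For $\operatorname{Re} m>-1$, $H_m$ is homogeneous of degree $-2$. 5. For $\operatorname{Re} m>-1$, the spectrum of $H_m$ is $[0,\infty[$. 6. $\{m\in\mathbb{C}:\operatorname{Re}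 m>-1\}\ni m\mapsto H_m$ is a holomorphic family of closed operators. -/

import Mathlib

open MeasureTheory TopologicalSpace
open scoped Distributions ContDiff ENNReal

namespace HomSchr

noncomputable section

/-- Lebesgue measure on the half-line. -/
abbrev halfLineMeasure : Measure ℝ := volume.restrict (Set.Ioi (0 : ℝ))

/-- The Hilbert space `L²[0,∞[` of complex-valued functions. -/
abbrev HalfLineL2 : Type := Lp ℂ 2 halfLineMeasure

/-- The open half-line `]0,∞[`. -/
def halfLine : Opens ℝ := ⟨Set.Ioi 0, isOpen_Ioi⟩

/-- The differential expression `L_α φ = -φ'' + (-1/4 + α) x⁻² φ`. -/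
def expr (α : ℂ) (φ : ℝ → ℂ) (x : ℝ) : ℂ :=
  -deriv (deriv φ) x + (-(1 / 4) + α) * (1 / (x : ℂ) ^ 2) * φ x

/-! ### Elementary facts on test functions -/

theorem contDiff_deriv (φ : 𝓓(halfLine, ℂ)) : ContDiff ℝ ∞ (deriv φ) :=
  ((contDiff_infty_iff_deriv (𝕜 := ℝ)).1 φ.contDiff).2

theorem contDiff_deriv2 (φ : 𝓓(halfLine, ℂ)) : ContDiff ℝ ∞ (deriv (deriv φ)) :=
  ((contDiff_infty_iff_deriv (𝕜 := ℝ)).1 (contDiff_deriv φ)).2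

theorem expr_add (α : ℂ) (φ ψ : 𝓓(halfLine, ℂ)) :
    expr α (φ + ψ : 𝓓(halfLine, ℂ)) = expr α φ + expr α ψ := by
  have h1 : deriv (⇑(φ + ψ)) = deriv φ + deriv ψ := by
    ext x
    exact deriv_add (φ.contDiff.differentiable (by simp) x) (ψ.contDiff.differentiable (by simp) x)
  have h2 : deriv (deriv φ + deriv ψ) = deriv (deriv φ) + deriv (deriv ψ) := by
    ext x
    exact deriv_add ((contDiff_deriv φ).differentiable (by simp) x)
      ((contDiff_deriv ψ).differentiable (by simp) x)
  ext x
  have h3 : (φ + ψ : 𝓓(halfLine, ℂ)) x = φ x + ψ x := rfl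
  simp only [expr, h1, h2, h3, Pi.add_apply]
  ring

theorem expr_smul (α c : ℂ) (φ : 𝓓(halfLine, ℂ)) :
    expr α (c • φ : 𝓓(halfLine, ℂ)) = c • expr α φ := by
  have h1 : deriv (⇑(c • φ)) = c • deriv φ := by
    ext x
    exact deriv_const_smul c (φ.contDiff.differentiable (by simp) x)
  have h2 : deriv (c • deriv φ) = c • deriv (deriv φ) := by
    ext x
    exact deriv_const_smul c ((contDiff_deriv φ).differentiable (by simp) x)
  ext x
  have h3 : (c • φ : 𝓓(halfLine, ℂ)) x = c * φ x := rfl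
  simp only [expr, h1, h2, h3, Pi.smul_apply, smul_eq_mul]
  ring

theorem hasCompactSupport_expr (α : ℂ) (φ : 𝓓(halfLine, ℂ)) :
    HasCompactSupport (expr α φ) :=
  (φ.hasCompactSupport.deriv.deriv.neg).add (φ.hasCompactSupport.mul_left)

theorem continuous_expr (α : ℂ) (φ : 𝓓(halfLine, ℂ)) : Continuous (expr α φ) := by
  refine (contDiff_deriv2 φ).continuous.neg.add ?_
  rw [continuous_iff_continuousAt]
  intro x
  by_cases hx : x = 0
  · have h0 : x ∉ tsupport φ := fun h => by
      have : (0 : ℝ) < x := φ.tsupport_subset h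
      exact this.ne' hx
    have h1 : (φ : ℝ → ℂ) =ᶠ[nhds x] 0 := notMem_tsupport_iff_eventuallyEq.1 h0
    refine (continuousAt_const (y := (0 : ℂ))).congr ?_
    filter_upwards [h1] with y hy
    simp [hy]
  · have hx' : (x : ℂ) ^ 2 ≠ 0 := by simpa using hx
    have hφ : ContinuousAt φ x := φ.continuous.continuousAt
    have hc : ContinuousAt (fun y : ℝ => (y : ℂ) ^ 2) x := by fun_prop
    exact (continuousAt_const.mul (continuousAt_const.div hc hx')).mul hφ

theorem memLp_expr (α : ℂ) (φ : 𝓓(halfLine, ℂ)) : MemLp (expr α φ) 2 halfLineMeasure :=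
  (continuous_expr α φ).memLp_of_hasCompactSupport (hasCompactSupport_expr α φ)

theorem memLp_test (φ : 𝓓(halfLine, ℂ)) : MemLp φ 2 halfLineMeasure :=
  φ.continuous.memLp_of_hasCompactSupport φ.hasCompactSupport

/-! ### The maximal operator -/

/-- The distribution `L_α f` on `]0,∞[` is the function `g`. -/
def IsWeakExpr (α : ℂ) (f g : HalfLineL2) : Prop :=
  ∀ φ : 𝓓(halfLine, ℂ), ∫ x, f x * expr α φ x ∂halfLineMeasure = ∫ x, g x * φ x ∂halfLineMeasure

theorem pairing_add (f g : HalfLineL2) {ψ : ℝ → ℂ} (hψ : MemLp ψ 2 halfLineMeasure) :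
    ∫ x, (f + g : HalfLineL2) x * ψ x ∂halfLineMeasure = ∫ x, f x * ψ x ∂halfLineMeasure + ∫ x, g x * ψ x ∂halfLineMeasure := by
  refine Eq.trans (integral_congr_ae ?_)
    (integral_add ((Lp.memLp f).integrable_mul hψ) ((Lp.memLp g).integrable_mul hψ))
  filter_upwards [Lp.coeFn_add f g] with x hx
  rw [hx, Pi.add_apply, add_mul]

theorem pairing_smul (c : ℂ) (f : HalfLineL2) (ψ : ℝ → ℂ) :
    ∫ x, (c • f : HalfLineL2) x * ψ x ∂halfLineMeasure = c * ∫ x, f x * ψ x ∂halfLineMeasure := by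
  rw [← integral_const_mul]
  refine integral_congr_ae ?_
  filter_upwards [Lp.coeFn_smul c f] with x hx
  simp [hx, mul_assoc]

/-- The graph of the maximal operator: all `(f, g)` in `L² × L²` with `L_α f = g`. -/
def maxGraph (α : ℂ) : Submodule ℂ (HalfLineL2 × HalfLineL2) where
  carrier := {p | IsWeakExpr α p.1 p.2}
  zero_mem' φ := by
    have h (ψ : ℝ → ℂ) : ∫ x, (0 : HalfLineL2) x * ψ x ∂halfLineMeasure = 0 := by
      simpa using pairing_smul 0 0 ψ
    change ∫ x, (0 : HalfLineL2) x * _ ∂halfLineMeasure = ∫ x, (0 : HalfLineL2) x * _ ∂halfLineMeasure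
    rw [h, h]
  add_mem' {p q} hp hq φ := by
    change ∫ x, (p.1 + q.1 : HalfLineL2) x * _ ∂halfLineMeasure = ∫ x, (p.2 + q.2 : HalfLineL2) x * _ ∂halfLineMeasure
    rw [pairing_add _ _ (memLp_expr α φ), pairing_add _ _ (memLp_test φ), hp φ, hq φ]
  smul_mem' c p hp φ := by
    change ∫ x, (c • p.1 : HalfLineL2) x * _ ∂halfLineMeasure = ∫ x, (c • p.2 : HalfLineL2) x * _ ∂halfLineMeasure
    rw [pairing_smul, pairing_smul, hp φ]

/-- The maximal operator `L_α^max`: its domain consists of all `f ∈ L²` with `L_α f ∈ L²`, where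
`L_α f` is taken in the sense of distributions on `]0,∞[`. -/
def Lmax (α : ℂ) : HalfLineL2 →ₗ.[ℂ] HalfLineL2 := (maxGraph α).toLinearPMap

theorem maxGraph_single_valued (α : ℂ) (p : HalfLineL2 × HalfLineL2) (hp : p ∈ maxGraph α)
    (h0 : p.1 = 0) : p.2 = 0 := by
  have key : ∀ φ : 𝓓(halfLine, ℂ), ∫ x, p.2 x * φ x ∂halfLineMeasure = 0 := by
    intro φ
    rw [← hp φ, h0]
    simpa using pairing_smul 0 0 (expr α φ)
  have hloc : LocallyIntegrableOn (p.2 : ℝ → ℂ) (Set.Ioi 0) volume :=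
    locallyIntegrableOn_of_locallyIntegrable_restrict
      ((Lp.memLp p.2).locallyIntegrable (by norm_num))
  have hz := isOpen_Ioi.ae_eq_zero_of_integral_contDiff_smul_eq_zero hloc (fun g hg hgc hgs => by
    let φ : 𝓓(halfLine, ℂ) := ⟨fun x => (g x : ℂ), Complex.ofRealCLM.contDiff.comp hg,
      hgc.comp_left (g := fun r : ℝ => (r : ℂ)) (by simp), by
        refine (closure_mono ?_).trans hgs
        intro x hx
        simpa using hx⟩
    have h1 := key φ
    rw [← h1]
    symm
    have h2 : ∀ x ∉ Set.Ioi (0 : ℝ), p.2 x * φ x = 0 := by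
      intro x hx
      have : φ x = 0 := image_eq_zero_of_notMem_tsupport fun h => hx (φ.tsupport_subset h)
      rw [this, mul_zero]
    rw [setIntegral_eq_integral_of_forall_compl_eq_zero h2]
    refine integral_congr_ae (Filter.Eventually.of_forall fun x => ?_)
    change p.2 x * (g x : ℂ) = g x • p.2 x
    rw [Complex.real_smul, mul_comm])
  refine Lp.ext ?_
  filter_upwards [(ae_restrict_iff' measurableSet_Ioi).2 hz,
    Lp.coeFn_zero ℂ 2 halfLineMeasure] with x h1 h2
  rw [h1, h2, Pi.zero_apply]

theorem graph_Lmax (α : ℂ) : (Lmax α).graph = maxGraph α :=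
  Submodule.toLinearPMap_graph_eq _ (fun p hp h0 => maxGraph_single_valued α p hp h0)

/-! ### The minimal operator -/

/-- The graph of `L_α` on `C_c^∞ ]0,∞[`. -/
def testGraph (α : ℂ) : Submodule ℂ (HalfLineL2 × HalfLineL2) where
  carrier := {p | ∃ φ : 𝓓(halfLine, ℂ), p.1 =ᵐ[halfLineMeasure] φ ∧ p.2 =ᵐ[halfLineMeasure] expr α φ}
  zero_mem' := by
    refine ⟨0, Lp.coeFn_zero _ _ _, ?_⟩
    have h : expr α (0 : 𝓓(halfLine, ℂ)) = 0 := by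
      simpa using expr_smul α 0 0
    rw [h]
    exact Lp.coeFn_zero _ _ _
  add_mem' := by
    rintro p q ⟨φ, hφ, hφ'⟩ ⟨ψ, hψ, hψ'⟩
    refine ⟨φ + ψ, (Lp.coeFn_add _ _).trans (hφ.add hψ), ?_⟩
    rw [expr_add]
    exact (Lp.coeFn_add _ _).trans (hφ'.add hψ')
  smul_mem' := by
    rintro c p ⟨φ, hφ, hφ'⟩
    refine ⟨c • φ, (Lp.coeFn_smul _ _).trans (hφ.const_smul c), ?_⟩
    rw [expr_smul]
    exact (Lp.coeFn_smul _ _).trans (hφ'.const_smul c)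

/-- The operator `L_α` with domain `C_c^∞ ]0,∞[`. -/
def Ltest (α : ℂ) : HalfLineL2 →ₗ.[ℂ] HalfLineL2 := (testGraph α).toLinearPMap

/-- The minimal operator `L_α^min`: the closure of `L_α` on `C_c^∞ ]0,∞[`. -/
def Lmin (α : ℂ) : HalfLineL2 →ₗ.[ℂ] HalfLineL2 := (Ltest α).closure

/-! Consistency of the definition: `L_α` on test functions is contained in the closed operator
`L_α^max`, hence closable. -/

theorem integral_test_mul_deriv2 (φ ψ : 𝓓(halfLine, ℂ)) :
    ∫ x, φ x * deriv (deriv ψ) x = ∫ x, deriv (deriv φ) x * ψ x := by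
  have int (u v : ℝ → ℂ) (hu : Continuous u) (hv : Continuous v) (hc : HasCompactSupport v) :
      Integrable (u * v) volume :=
    (hu.mul hv).integrable_of_hasCompactSupport hc.mul_left
  have cφ := φ.continuous
  have cψ := ψ.continuous
  have cφ' := (contDiff_deriv φ).continuous
  have cψ' := (contDiff_deriv ψ).continuous
  have cφ'' := (contDiff_deriv2 φ).continuous
  have cψ'' := (contDiff_deriv2 ψ).continuous
  have sψ := ψ.hasCompactSupport
  have d (f : ℝ → ℂ) (hf : ContDiff ℝ ∞ f) (x : ℝ) : HasDerivAt f (deriv f x) x :=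
    (hf.differentiable (by simp) x).hasDerivAt
  rw [integral_mul_deriv_eq_deriv_mul_of_integrable
      (fun x _ => d φ φ.contDiff x) (fun x _ => d _ (contDiff_deriv ψ) x)
      (int _ _ cφ cψ'' sψ.deriv.deriv) (int _ _ cφ' cψ' sψ.deriv) (int _ _ cφ cψ' sψ.deriv),
    integral_mul_deriv_eq_deriv_mul_of_integrable
      (fun x _ => d _ (contDiff_deriv φ) x) (fun x _ => d ψ ψ.contDiff x)
      (int _ _ cφ' cψ' sψ.deriv) (int _ _ cφ'' cψ sψ) (int _ _ cφ' cψ sψ), neg_neg]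

theorem testGraph_le_maxGraph (α : ℂ) : testGraph α ≤ maxGraph α := by
  rintro p ⟨φ, h1, h2⟩ ψ
  have e1 : ∫ x, p.1 x * expr α ψ x ∂halfLineMeasure = ∫ x, φ x * expr α ψ x := by
    refine Eq.trans (integral_congr_ae ?_)
      (setIntegral_eq_integral_of_forall_compl_eq_zero (s := Set.Ioi (0 : ℝ)) ?_)
    · change ∀ᵐ x ∂halfLineMeasure, _
      filter_upwards [h1] with x hx
      rw [hx]
    · intro x hx
      have : φ x = 0 := image_eq_zero_of_notMem_tsupport fun h => hx (φ.tsupport_subset h)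
      rw [this, zero_mul]
  have e2 : ∫ x, p.2 x * ψ x ∂halfLineMeasure = ∫ x, expr α φ x * ψ x := by
    refine Eq.trans (integral_congr_ae ?_)
      (setIntegral_eq_integral_of_forall_compl_eq_zero (s := Set.Ioi (0 : ℝ)) ?_)
    · change ∀ᵐ x ∂halfLineMeasure, _
      filter_upwards [h2] with x hx
      rw [hx]
    · intro x hx
      have : ψ x = 0 := image_eq_zero_of_notMem_tsupport fun h => hx (ψ.tsupport_subset h)
      rw [this, mul_zero]
  rw [e1, e2, ← sub_eq_zero]
  refine (integral_sub
    ((φ.continuous.mul (continuous_expr α ψ)).integrable_of_hasCompactSupport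
      (hasCompactSupport_expr α ψ).mul_left)
    (((continuous_expr α φ).mul ψ.continuous).integrable_of_hasCompactSupport
      ψ.hasCompactSupport.mul_left)).symm.trans ?_
  have e3 : ∀ x, φ x * expr α ψ x - expr α φ x * ψ x
      = deriv (deriv φ) x * ψ x - φ x * deriv (deriv ψ) x := fun x => by
    simp only [expr]
    ring
  refine (integral_congr_ae (Filter.Eventually.of_forall e3)).trans ?_
  refine (integral_sub
    (((contDiff_deriv2 φ).continuous.mul ψ.continuous).integrable_of_hasCompactSupport
      ψ.hasCompactSupport.mul_left)
    ((φ.continuous.mul (contDiff_deriv2 ψ).continuous).integrable_of_hasCompactSupport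
      ψ.hasCompactSupport.deriv.deriv.mul_left)).trans ?_
  exact sub_eq_zero.2 (integral_test_mul_deriv2 φ ψ).symm

theorem graph_Ltest (α : ℂ) : (Ltest α).graph = testGraph α :=
  Submodule.toLinearPMap_graph_eq _ (fun p hp h0 =>
    maxGraph_single_valued α p (testGraph_le_maxGraph α hp) h0)

theorem continuous_pairing {ψ : ℝ → ℂ} (hψ : MemLp ψ 2 halfLineMeasure) :
    Continuous fun f : HalfLineL2 => ∫ x, f x * ψ x ∂halfLineMeasure := by
  have h : (fun f : HalfLineL2 => ∫ x, f x * ψ x ∂halfLineMeasure)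
      = fun f : HalfLineL2 => inner ℂ hψ.star.toLp f := by
    ext f
    rw [L2.inner_def]
    refine integral_congr_ae ?_
    filter_upwards [hψ.star.coeFn_toLp] with x hx
    rw [hx]
    simp
  rw [h]
  fun_prop

theorem isClosed_Lmax (α : ℂ) : (Lmax α).IsClosed := by
  rw [LinearPMap.IsClosed, graph_Lmax]
  have h : (maxGraph α : Set (HalfLineL2 × HalfLineL2)) = ⋂ φ : 𝓓(halfLine, ℂ),
      {p | ∫ x, p.1 x * expr α φ x ∂halfLineMeasure = ∫ x, p.2 x * φ x ∂halfLineMeasure} := by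
    ext p
    rw [Set.mem_iInter]
    exact Iff.rfl
  rw [h]
  exact isClosed_iInter fun φ => isClosed_eq
    ((continuous_pairing (memLp_expr α φ)).comp continuous_fst)
    ((continuous_pairing (memLp_test φ)).comp continuous_snd)

theorem isClosable_Ltest (α : ℂ) : (Ltest α).IsClosable := by
  refine (isClosed_Lmax α).isClosable.leIsClosable (LinearPMap.le_of_le_graph ?_)
  rw [graph_Ltest, graph_Lmax]
  exact testGraph_le_maxGraph α

/-! ### The operators `H_m` -/

/-- A smooth compactly supported cutoff that equals `1` around `0`. -/
structure IsCutoff (ξ : ℝ → ℝ) : Prop where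
  smooth : ContDiff ℝ ∞ ξ
  compact : HasCompactSupport ξ
  eq_one : ∀ᶠ x in nhds 0, ξ x = 1

/-- The restriction of `L_{m²}^max` to `Dom L_{m²}^min + ℂ x^{1/2+m} ξ`. (For `Re m > -1` the set
whose span is taken consists of exactly one element, the class of `x^{1/2+m} ξ` in `L²`.) -/
def H (ξ : ℝ → ℝ) (m : ℂ) : HalfLineL2 →ₗ.[ℂ] HalfLineL2 :=
  (Lmax (m ^ 2)).domRestrict ((Lmin (m ^ 2)).domain ⊔
    Submodule.span ℂ {u : HalfLineL2 | u =ᵐ[halfLineMeasure] fun x : ℝ => (x : ℂ) ^ (1 / 2 + m) * (ξ x : ℂ)})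

/-! ### Dilations and homogeneity -/

theorem map_dilation (τ : ℝ) :
    halfLineMeasure.map (fun x => Real.exp τ * x) = ENNReal.ofReal (Real.exp (-τ)) • halfLineMeasure := by
  have h := Real.map_volume_mul_left (Real.exp_pos τ).ne'
  have hs : (fun x => Real.exp τ * x) ⁻¹' Set.Ioi 0 = Set.Ioi (0 : ℝ) := by
    ext x
    simp [mul_pos_iff_of_pos_left (Real.exp_pos τ)]
  have h2 := Measure.restrict_map (μ := (volume : Measure ℝ)) (f := fun x => Real.exp τ * x)
    (by fun_prop) (measurableSet_Ioi (a := (0 : ℝ)))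
  rw [hs] at h2
  rw [← h2]
  change (Measure.map (Real.exp τ * ·) volume).restrict _ = _
  rw [h, Measure.restrict_smul, ← Real.exp_neg, abs_of_pos (Real.exp_pos _)]

theorem quasiMeasurePreserving_dilation (τ : ℝ) :
    Measure.QuasiMeasurePreserving (fun x => Real.exp τ * x) halfLineMeasure halfLineMeasure :=
  ⟨by fun_prop, by rw [map_dilation]; exact Measure.smul_absolutelyContinuous⟩

theorem memLp_dilation (τ : ℝ) (f : HalfLineL2) :
    MemLp (fun x => (Real.exp (τ / 2) : ℂ) * f (Real.exp τ * x)) 2 halfLineMeasure := by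
  refine MemLp.const_mul ?_ _
  have h : MemLp f 2 (halfLineMeasure.map (fun x => Real.exp τ * x)) := by
    rw [map_dilation]
    exact (Lp.memLp f).smul_measure ENNReal.ofReal_ne_top
  exact h.comp_of_map (by fun_prop)

/-- The class in `L²` of `(U_τ f)(x) = e^{τ/2} f(e^τ x)`. -/
def dilationFun (τ : ℝ) (f : HalfLineL2) : HalfLineL2 := (memLp_dilation τ f).toLp

theorem coeFn_dilationFun (τ : ℝ) (f : HalfLineL2) :
    dilationFun τ f =ᵐ[halfLineMeasure] fun x => (Real.exp (τ / 2) : ℂ) * f (Real.exp τ * x) :=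
  MemLp.coeFn_toLp _

theorem dilationFun_dilationFun (σ τ : ℝ) (h : σ + τ = 0) (f : HalfLineL2) :
    dilationFun σ (dilationFun τ f) = f := by
  refine Lp.ext ?_
  filter_upwards [coeFn_dilationFun σ (dilationFun τ f),
    (quasiMeasurePreserving_dilation σ).ae (coeFn_dilationFun τ f)] with x h1 h2
  have h3 : Real.exp τ * (Real.exp σ * x) = x := by
    rw [← mul_assoc, ← Real.exp_add, add_comm, h, Real.exp_zero, one_mul]
  have h4 : (Real.exp (σ / 2) : ℂ) * (Real.exp (τ / 2) : ℂ) = 1 := by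
    rw [← Complex.ofReal_mul, ← Real.exp_add, ← add_div, h]
    simp
  rw [h1, h2, h3, ← mul_assoc, h4, one_mul]

/-- The dilation `U_τ` on `L²[0,∞[`, `(U_τ f)(x) = e^{τ/2} f(e^τ x)`, with inverse `U_{-τ}`. -/
def dilation (τ : ℝ) : HalfLineL2 ≃ₗ[ℂ] HalfLineL2 where
  toFun := dilationFun τ
  invFun := dilationFun (-τ)
  map_add' f g := by
    refine Lp.ext ?_
    filter_upwards [coeFn_dilationFun τ (f + g), coeFn_dilationFun τ f, coeFn_dilationFun τ g,
      Lp.coeFn_add (dilationFun τ f) (dilationFun τ g),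
      (quasiMeasurePreserving_dilation τ).ae (Lp.coeFn_add f g)] with x h1 h2 h3 h4 h5
    rw [h1, h4, Pi.add_apply, h2, h3, h5, Pi.add_apply, mul_add]
  map_smul' c f := by
    refine Lp.ext ?_
    filter_upwards [coeFn_dilationFun τ (c • f), coeFn_dilationFun τ f,
      Lp.coeFn_smul c (dilationFun τ f),
      (quasiMeasurePreserving_dilation τ).ae (Lp.coeFn_smul c f)] with x h1 h2 h3 h4
    rw [h1, RingHom.id_apply, h3, Pi.smul_apply, h2, h4, Pi.smul_apply, smul_eq_mul, smul_eq_mul]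
    ring
  left_inv f := dilationFun_dilationFun (-τ) τ (by simp) f
  right_inv f := dilationFun_dilationFun τ (-τ) (by simp) f

/-- The conjugated operator `U B U⁻¹`, with domain `U (Dom B)`. -/
def conjugate {E : Type*} [AddCommGroup E] [Module ℂ E] (U : E ≃ₗ[ℂ] E) (B : E →ₗ.[ℂ] E) :
    E →ₗ.[ℂ] E where
  domain := B.domain.comap U.symm.toLinearMap
  toFun :=
    { toFun := fun x => U (B ⟨U.symm x, x.2⟩)
      map_add' := fun x y => by
        rw [← map_add, ← B.map_add]
        congr 2
        exact Subtype.ext (by simp)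
      map_smul' := fun c x => by
        rw [RingHom.id_apply, ← map_smul, ← B.map_smul]
        congr 2
        exact Subtype.ext (by simp) }

/-- `B` is homogeneous of degree `ν`: `U_τ B U_τ⁻¹ = e^{ντ} B` for all real `τ`. -/
def IsHomogeneous (B : HalfLineL2 →ₗ.[ℂ] HalfLineL2) (ν : ℝ) : Prop :=
  ∀ τ : ℝ, conjugate (dilation τ) B = (Real.exp (ν * τ) : ℂ) • B

/-! ### Spectrum and holomorphic families of unbounded operators -/

section Banach

variable {E : Type*} [NormedAddCommGroup E] [NormedSpace ℂ E]

/-- The resolvent set: all `z` such that `z - T : Dom T → E` has a bounded everywhere defined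
inverse `R`. -/
def resolventSet (T : E →ₗ.[ℂ] E) : Set ℂ :=
  {z | ∃ R : E →L[ℂ] E,
    (∀ x : E, ∃ h : R x ∈ T.domain, z • R x - T ⟨R x, h⟩ = x) ∧
    ∀ x : T.domain, R (z • (x : E) - T x) = x}

/-- The spectrum of an unbounded operator. -/
def spectrum (T : E →ₗ.[ℂ] E) : Set ℂ := (resolventSet T)ᶜ

end Banach

/-- `z ↦ T z` is a holomorphic family of closed operators on the open set `Θ`: every `T z` is
closed, and near every point of `Θ` there are a Banach space `K` and a holomorphic family of
injective bounded operators `B z : K → E` with `Ran (B z) = Dom (T z)` such that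
`C z = T z ∘ B z` is a holomorphic family of bounded operators. -/
def IsHolomorphicFamily {E : Type} [NormedAddCommGroup E] [NormedSpace ℂ E]
    (Θ : Set ℂ) (T : ℂ → E →ₗ.[ℂ] E) : Prop :=
  IsOpen Θ ∧ (∀ z ∈ Θ, (T z).IsClosed) ∧
  ∀ z₀ ∈ Θ, ∃ Θ₀ : Set ℂ, IsOpen Θ₀ ∧ z₀ ∈ Θ₀ ∧ Θ₀ ⊆ Θ ∧
    ∃ (K : Type) (_ : NormedAddCommGroup K) (_ : NormedSpace ℂ K) (_ : CompleteSpace K)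
      (B C : ℂ → K →L[ℂ] E),
      DifferentiableOn ℂ B Θ₀ ∧ DifferentiableOn ℂ C Θ₀ ∧
      ∀ z ∈ Θ₀, Function.Injective (B z) ∧ Set.range (B z) = (T z).domain ∧
        ∀ k : K, ∃ h : B z k ∈ (T z).domain, T z ⟨B z k, h⟩ = C z k

/-- The codimension of `p ⊓ q` in `q`; used for `p ≤ q`. -/
def codim {E : Type*} [AddCommGroup E] [Module ℂ E] (p q : Submodule ℂ E) : Cardinal :=
  Module.rank ℂ (q ⧸ p.submoduleOf q)

end

end HomSchr

namespace HomSchr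

noncomputable section

open Set Filter Topology

/-! ### Test functions on the half-line -/

/-! Everything rests on an explicit resolvent. For Re k > 0 the equation L u = -k² u with α = m² has
the solutions `phi k m`, equal to x^{1/2+m} times a power series in x² with constant term 1, and
`psi k m`, which is √x times twice the Macdonald function K_m(kx) and decays exponentially. Their
Wronskian is independent of x, and letting x → 0 gives -k · `logGamma (k/2) (m+1)`. This integral is
a power of k/2 times Γ(m+1), hence nonzero for Re m > -1. So the kernel -W⁻¹ φ(min) ψ(max) is
defined on the whole half-plane Re m > -1. A weighted Schur test makes it a bounded operator
`greenOp k m`, with bounds locally uniform in m.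

Applied to a test function g, this operator gives near 0 a multiple of φ, and φ - x^{1/2+m} is
smaller than φ by a factor x². Logarithmic cutoffs (`mem_closure_testGraph`) then put the result in
Dom L^min + ℂ x^{1/2+m} ξ, where the coefficient of x^{1/2+m} ξ is a multiple of ∫ ψ g
(`greenOp_test_sub_mem`). Since H_m is closed, `greenOp k m` is a right inverse of H_m + k² on all
of L².

For complex m the operator is symmetric not for the inner product but for the bilinear pairing ∫ f
g. A symmetric operator with an everywhere defined right inverse is injective and equal to its own
transpose. This yields the two-sided resolvent, and conjugating the transpose yields H_m* = H_{m̄}.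

Functions in the kernel of L^max + k² annihilate the range of L^min + k², which contains every test
function g with ∫ ψ g = 0; hence they are multiples of ψ. Now ψ is square integrable for |Re m| < 1
and not for Re m ≥ 1. In the second case the three operators coincide. In the first, x^{1/2+m} ξ
spans H_m modulo L^min, and ψ spans L^max modulo H_m.

For fixed x, y the kernel is holomorphic in m. Kernel bounds control operator norms, so a second
order Taylor estimate of the kernel makes `greenOp k` holomorphic, and it parametrizes the domains
of H_m. Homogeneity follows by dilating the two pieces of the domain. Off [0,∞[ every z is -k² with
Re k > 0. On [0,∞[ homogeneity would turn a resolvent bound at r into one at n² r with a gain n²,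
which is refuted by test functions modulated with plane waves. -/

/-- A function that is smooth on `]0,∞[` and vanishes off a compact subinterval is a test function. -/
def testOf (f : ℝ → ℂ) (hf : ContDiffOn ℝ ∞ f (Ioi 0)) {a b : ℝ} (ha : 0 < a)
    (h : ∀ x ∉ Icc a b, f x = 0) : 𝓓(halfLine, ℂ) :=
  have hs : tsupport f ⊆ Icc a b :=
    closure_minimal (fun x hx => by_contra fun hn => hx (h x hn)) isClosed_Icc
  ⟨f, by
    refine contDiff_iff_contDiffAt.2 fun x => ?_
    rcases lt_or_ge 0 x with hx | hx
    · exact hf.contDiffAt (Ioi_mem_nhds hx)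
    · refine (contDiffAt_const (c := (0 : ℂ))).congr_of_eventuallyEq ?_
      filter_upwards [Iio_mem_nhds (lt_of_le_of_lt hx ha)] with y hy
      exact h y fun hy' => absurd hy'.1 (not_le.2 hy),
    isCompact_Icc.of_isClosed_subset (isClosed_tsupport f) hs,
    hs.trans fun x hx => lt_of_lt_of_le ha hx.1⟩

theorem exists_Icc_of_test (φ : 𝓓(halfLine, ℂ)) :
    ∃ a b : ℝ, 0 < a ∧ a ≤ b ∧ tsupport φ ⊆ Icc a b := by
  rcases (tsupport φ).eq_empty_or_nonempty with h | h
  · exact ⟨1, 1, one_pos, le_rfl, by simp [h]⟩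
  · obtain ⟨a, ha, ha'⟩ := φ.hasCompactSupport.exists_isLeast h
    obtain ⟨b, hb, hb'⟩ := φ.hasCompactSupport.exists_isGreatest h
    exact ⟨a, b, φ.tsupport_subset ha, ha' hb, fun x hx => ⟨ha' hx, hb' hx⟩⟩

theorem contDiffOn_deriv {u : ℝ → ℂ} (hu : ContDiffOn ℝ ∞ u (Ioi 0)) :
    ContDiffOn ℝ ∞ (deriv u) (Ioi 0) :=
  ((contDiffOn_infty_iff_deriv_of_isOpen isOpen_Ioi).1 hu).2

theorem hasDerivAt_of_contDiffOn {u : ℝ → ℂ} (hu : ContDiffOn ℝ ∞ u (Ioi 0)) {x : ℝ} (hx : 0 < x) :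
    HasDerivAt u (deriv u x) x :=
  ((hu.contDiffAt (Ioi_mem_nhds hx)).differentiableAt (by simp)).hasDerivAt

theorem expr_congr (α : ℂ) {f g : ℝ → ℂ} {x : ℝ} (h : f =ᶠ[𝓝 x] g) : expr α f x = expr α g x := by
  simp only [expr, h.deriv.deriv_eq, h.eq_of_nhds]

theorem expr_eq_of_hasDerivAt (α : ℂ) {f f' : ℝ → ℂ} {f'' : ℂ} {x : ℝ}
    (h : ∀ᶠ y in 𝓝 x, HasDerivAt f (f' y) y) (h' : HasDerivAt f' f'' x) :
    expr α f x = -f'' + (-(1 / 4) + α) * (1 / (x : ℂ) ^ 2) * f x := by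
  have : deriv f =ᶠ[𝓝 x] f' := h.mono fun y hy => hy.deriv
  rw [expr, this.deriv_eq, h'.deriv]

theorem expr_sub_smul (α c : ℂ) {u v : ℝ → ℂ} (hu : ContDiffOn ℝ ∞ u (Ioi 0))
    (hv : ContDiffOn ℝ ∞ v (Ioi 0)) {x : ℝ} (hx : 0 < x) :
    expr α (fun y => u y - c * v y) x = expr α u x - c * expr α v x := by
  have h1 : ∀ᶠ y in 𝓝 x, HasDerivAt (fun y => u y - c * v y) (deriv u y - c * deriv v y) y := by
    filter_upwards [Ioi_mem_nhds hx] with y hy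
    exact (hasDerivAt_of_contDiffOn hu hy).sub ((hasDerivAt_of_contDiffOn hv hy).const_mul c)
  rw [expr_eq_of_hasDerivAt α h1 ((hasDerivAt_of_contDiffOn (contDiffOn_deriv hu) hx).sub
    ((hasDerivAt_of_contDiffOn (contDiffOn_deriv hv) hx).const_mul c))]
  simp only [expr]
  ring

theorem expr_mul (α : ℂ) {θ u : ℝ → ℂ} (hθ : ContDiffOn ℝ ∞ θ (Ioi 0))
    (hu : ContDiffOn ℝ ∞ u (Ioi 0)) {x : ℝ} (hx : 0 < x) :
    expr α (fun y => θ y * u y) x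
      = θ x * expr α u x - 2 * deriv θ x * deriv u x - deriv (deriv θ) x * u x := by
  have h1 : ∀ᶠ y in 𝓝 x, HasDerivAt (fun y => θ y * u y) (deriv θ y * u y + θ y * deriv u y) y := by
    filter_upwards [Ioi_mem_nhds hx] with y hy
    exact (hasDerivAt_of_contDiffOn hθ hy).mul (hasDerivAt_of_contDiffOn hu hy)
  rw [expr_eq_of_hasDerivAt α h1
    (((hasDerivAt_of_contDiffOn (contDiffOn_deriv hθ) hx).mul (hasDerivAt_of_contDiffOn hu hx)).add
    ((hasDerivAt_of_contDiffOn hθ hx).mul (hasDerivAt_of_contDiffOn (contDiffOn_deriv hu) hx)))]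
  simp only [expr]
  ring

theorem continuousOn_expr (α : ℂ) {u : ℝ → ℂ} (hu : ContDiffOn ℝ ∞ u (Ioi 0)) :
    ContinuousOn (expr α u) (Ioi 0) := by
  refine (contDiffOn_deriv (contDiffOn_deriv hu)).continuousOn.neg.add
    ((continuousOn_const.mul (continuousOn_const.div (by fun_prop) fun x hx => ?_)).mul
      hu.continuousOn)
  exact pow_ne_zero 2 (Complex.ofReal_ne_zero.2 (ne_of_gt hx))

/-! ### Smooth functions in the domain of the maximal operator -/

theorem integral_deriv_test (φ : 𝓓(halfLine, ℂ)) : ∫ x, deriv φ x ∂halfLineMeasure = 0 := by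
  rw [setIntegral_eq_integral_of_forall_compl_eq_zero]
  · exact integral_eq_zero_of_hasDerivAt_of_integrable
      (fun x => (φ.contDiff.differentiable (by simp) x).hasDerivAt)
      ((contDiff_deriv φ).continuous.integrable_of_hasCompactSupport φ.hasCompactSupport.deriv)
      (φ.continuous.integrable_of_hasCompactSupport φ.hasCompactSupport)
  · intro x hx
    have h0 : x ∉ tsupport φ := fun h => hx (φ.tsupport_subset h)
    exact image_eq_zero_of_notMem_tsupport fun h => h0 (closure_minimal
      (support_deriv_subset (f := (φ : ℝ → ℂ))) (isClosed_tsupport _) h)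

theorem test_eq_zero {φ : 𝓓(halfLine, ℂ)} {a b : ℝ} (h : tsupport φ ⊆ Icc a b) {x : ℝ}
    (hx : x ∉ Icc a b) : φ x = 0 :=
  image_eq_zero_of_notMem_tsupport fun hx' => hx (h hx')

theorem deriv_test_eq_zero {φ : 𝓓(halfLine, ℂ)} {a b : ℝ} (h : tsupport φ ⊆ Icc a b) {x : ℝ}
    (hx : x ∉ Icc a b) : deriv φ x = 0 :=
  image_eq_zero_of_notMem_tsupport fun hx' => hx (h (closure_minimal
      (support_deriv_subset (f := (φ : ℝ → ℂ))) (isClosed_tsupport _) hx'))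

/-- Lagrange's identity: u·Lφ - φ·Lu is minus the derivative of uφ' - u'φ. The bracket inherits
compact support in ]0,∞[ from φ, so it is itself a test function and its derivative integrates to
zero. No behaviour of u at the endpoints enters. -/
theorem mem_maxGraph_of_contDiffOn (α : ℂ) {u : ℝ → ℂ} (hu : ContDiffOn ℝ ∞ u (Ioi 0))
    {p : HalfLineL2 × HalfLineL2} (h1 : p.1 =ᵐ[halfLineMeasure] u)
    (h2 : p.2 =ᵐ[halfLineMeasure] expr α u) : p ∈ maxGraph α := by
  intro φ
  obtain ⟨a, b, ha, hab, hs⟩ := exists_Icc_of_test φ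
  have hφ : ContDiffOn ℝ ∞ φ (Ioi 0) := φ.contDiff.contDiffOn
  let F : 𝓓(halfLine, ℂ) := testOf (fun x => u x * deriv φ x - deriv u x * φ x)
    ((hu.mul (contDiffOn_deriv hφ)).sub ((contDiffOn_deriv hu).mul hφ)) ha (b := b) (by
      intro x hx
      simp [test_eq_zero hs hx, deriv_test_eq_zero hs hx])
  rw [← sub_eq_zero]
  refine (integral_sub ((Lp.memLp p.1).integrable_mul (memLp_expr α φ))
    ((Lp.memLp p.2).integrable_mul (memLp_test φ))).symm.trans ?_
  have := integral_deriv_test F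
  rw [← neg_eq_zero, ← integral_neg] at this
  rw [← this]
  refine integral_congr_ae ?_
  filter_upwards [h1, h2, ae_restrict_mem measurableSet_Ioi] with x e1 e2 hx
  simp only [Pi.mul_apply]
  have hF : HasDerivAt F _ x := ((hasDerivAt_of_contDiffOn hu hx).mul
    (hasDerivAt_of_contDiffOn (contDiffOn_deriv hφ) hx)).sub
    ((hasDerivAt_of_contDiffOn (contDiffOn_deriv hu) hx).mul (hasDerivAt_of_contDiffOn hφ hx))
  rw [e1, e2, hF.deriv]
  simp only [expr]
  ring

/-! ### Logarithmic cutoffs and the domain of the minimal operator -/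

theorem tendsto_eLpNorm_two_of_dominated {X : Type*} [MeasurableSpace X] {μ : Measure X}
    {F : ℕ → X → ℂ} {f : X → ℂ} {g : X → ℝ}
    (hF : ∀ n, AEStronglyMeasurable (F n) μ) (hf : AEStronglyMeasurable f μ) (hg : MemLp g 2 μ)
    (hb : ∀ n, ∀ᵐ x ∂μ, ‖F n x - f x‖ ≤ g x)
    (hlim : ∀ᵐ x ∂μ, Tendsto (fun n => F n x) atTop (𝓝 (f x))) :
    Tendsto (fun n => eLpNorm (F n - f) 2 μ) atTop (𝓝 0) := by
  have h2 : (2 : ℝ≥0∞) ≠ 0 := by norm_num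
  have h2' : (2 : ℝ≥0∞) ≠ ⊤ := by norm_num
  simp_rw [eLpNorm_eq_lintegral_rpow_enorm_toReal h2 h2']
  have key : Tendsto (fun n => ∫⁻ x, ‖(F n - f) x‖ₑ ^ (2 : ℝ≥0∞).toReal ∂μ) atTop
      (𝓝 (∫⁻ _, 0 ∂μ)) := by
    refine tendsto_lintegral_of_dominated_convergence' (fun x => ‖g x‖ₑ ^ (2 : ℝ≥0∞).toReal)
      (fun n => ((hF n).sub hf).enorm.pow_const _) ?_ ?_ ?_
    · intro n
      filter_upwards [hb n] with x hx
      refine ENNReal.rpow_le_rpow ?_ (by norm_num)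
      rw [Pi.sub_apply, enorm_le_iff_norm_le]
      exact hx.trans (le_abs_self _)
    · exact ((eLpNorm_lt_top_iff_lintegral_rpow_enorm_lt_top h2 h2').1 hg.eLpNorm_lt_top).ne
    · filter_upwards [hlim] with x hx
      have h := ((hx.sub_const (f x)).enorm).ennrpow_const (2 : ℝ≥0∞).toReal
      simpa using h
  have := key.ennrpow_const (1 / (2 : ℝ≥0∞).toReal)
  simpa using this

/-- A fixed bump function on the line. -/
def bump : ContDiffBump (0 : ℝ) := ⟨1, 2, one_pos, one_lt_two⟩

theorem bump_contDiff : ContDiff ℝ ∞ bump := bump.contDiff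

/-- Logarithmic cutoff on the half-line. -/
def logCutoff (n : ℕ) (x : ℝ) : ℂ := (bump (Real.log x / (n + 1)) : ℝ)

theorem exists_bound_bump_deriv :
    ∃ C : ℝ, 0 ≤ C ∧ ∀ x, |deriv bump x| ≤ C ∧ |deriv (deriv bump) x| ≤ C := by
  have c1 : ContDiff ℝ ∞ (deriv bump) := ((contDiff_infty_iff_deriv (𝕜 := ℝ)).1 bump_contDiff).2
  have c2 : ContDiff ℝ ∞ (deriv (deriv bump)) := ((contDiff_infty_iff_deriv (𝕜 := ℝ)).1 c1).2
  obtain ⟨C, hC⟩ := bump.hasCompactSupport.deriv.exists_bound_of_continuous c1.continuous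
  obtain ⟨D, hD⟩ := bump.hasCompactSupport.deriv.deriv.exists_bound_of_continuous c2.continuous
  exact ⟨max C D, (norm_nonneg _).trans ((hC 0).trans (le_max_left _ _)),
    fun x => ⟨(hC x).trans (le_max_left _ _), (hD x).trans (le_max_right _ _)⟩⟩

theorem hasDerivAt_logCutoff (n : ℕ) {x : ℝ} (hx : 0 < x) :
    HasDerivAt (logCutoff n) ((deriv bump (Real.log x / (n + 1)) * (x⁻¹ / (n + 1)) : ℝ)) x := by
  have h1 : HasDerivAt bump (deriv bump (Real.log x / (n + 1))) (Real.log x / (n + 1)) :=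
    (bump_contDiff.differentiable (by simp) _).hasDerivAt
  exact (h1.comp x ((Real.hasDerivAt_log hx.ne').div_const _)).ofReal_comp

theorem hasDerivAt_deriv_logCutoff (n : ℕ) {x : ℝ} (hx : 0 < x) :
    HasDerivAt (deriv (logCutoff n))
      ((deriv (deriv bump) (Real.log x / (n + 1)) * (x⁻¹ / (n + 1)) * (x⁻¹ / (n + 1))
        + deriv bump (Real.log x / (n + 1)) * (-(x ^ 2)⁻¹ / (n + 1)) : ℝ)) x := by
  have c1 : ContDiff ℝ ∞ (deriv bump) := ((contDiff_infty_iff_deriv (𝕜 := ℝ)).1 bump_contDiff).2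
  have h1 : HasDerivAt (deriv bump) (deriv (deriv bump) (Real.log x / (n + 1)))
      (Real.log x / (n + 1)) := (c1.differentiable (by simp) _).hasDerivAt
  have h3 : HasDerivAt (fun y => deriv bump (Real.log y / (n + 1)))
      (deriv (deriv bump) (Real.log x / (n + 1)) * (x⁻¹ / (n + 1))) x :=
    HasDerivAt.comp (h := fun y => Real.log y / (n + 1)) x h1
      ((Real.hasDerivAt_log hx.ne').div_const _)
  have h2 : HasDerivAt (fun y => deriv bump (Real.log y / (n + 1)) * (y⁻¹ / (n + 1)))
      (deriv (deriv bump) (Real.log x / (n + 1)) * (x⁻¹ / (n + 1)) * (x⁻¹ / (n + 1))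
        + deriv bump (Real.log x / (n + 1)) * (-(x ^ 2)⁻¹ / (n + 1))) x :=
    h3.mul ((hasDerivAt_inv hx.ne').div_const _)
  refine h2.ofReal_comp.congr_of_eventuallyEq ?_
  filter_upwards [Ioi_mem_nhds hx] with y hy
  exact (hasDerivAt_logCutoff n hy).deriv

theorem contDiffOn_logCutoff (n : ℕ) : ContDiffOn ℝ ∞ (logCutoff n) (Ioi 0) := by
  refine Complex.ofRealCLM.contDiff.comp_contDiffOn (bump_contDiff.comp_contDiffOn ?_)
  exact (Real.contDiffOn_log.mono fun x hx => ne_of_gt hx).div_const _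

theorem norm_logCutoff_le (n : ℕ) (x : ℝ) : ‖logCutoff n x‖ ≤ 1 := by
  rw [logCutoff, Complex.norm_real, Real.norm_of_nonneg bump.nonneg]
  exact bump.le_one

theorem logCutoff_eq_one {n : ℕ} {x : ℝ} (h : |Real.log x| ≤ n + 1) : logCutoff n x = 1 := by
  have hn : (0 : ℝ) < n + 1 := by positivity
  rw [logCutoff, bump.one_of_mem_closedBall, Complex.ofReal_one]
  rw [mem_closedBall_zero_iff, Real.norm_eq_abs, abs_div, abs_of_pos hn]
  exact (div_le_one hn).2 h

theorem logCutoff_eq_zero {n : ℕ} {x : ℝ} (hx : 0 < x)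
    (h : x ∉ Icc (Real.exp (-(2 * (n + 1)))) (Real.exp (2 * (n + 1)))) : logCutoff n x = 0 := by
  have hn : (0 : ℝ) < n + 1 := by positivity
  rw [logCutoff, bump.zero_of_le_dist, Complex.ofReal_zero]
  change (2 : ℝ) ≤ _
  rw [Real.dist_eq, sub_zero, abs_div, abs_of_pos hn, le_div_iff₀ hn]
  by_contra hlt
  rw [not_le, abs_lt] at hlt
  refine h ⟨?_, ?_⟩
  · rw [← Real.exp_log hx]; exact Real.exp_le_exp.2 hlt.1.le
  · rw [← Real.exp_log hx]; exact Real.exp_le_exp.2 hlt.2.le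

theorem tendsto_logCutoff (x : ℝ) : Tendsto (fun n => logCutoff n x) atTop (𝓝 1) := by
  refine tendsto_const_nhds.congr' ?_
  obtain ⟨N, hN⟩ := exists_nat_ge |Real.log x|
  filter_upwards [eventually_ge_atTop N] with n hn
  have : (N : ℝ) ≤ n := by exact_mod_cast hn
  exact (logCutoff_eq_one (by linarith)).symm

/-- The cut off function as a test function. -/
def cutTest (n : ℕ) (u : ℝ → ℂ) (hu : ContDiffOn ℝ ∞ u (Ioi 0)) : 𝓓(halfLine, ℂ) :=
  -- `Real.log` is even, so the logarithmic cutoff alone does not vanish on the negative axis; the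
  -- indicator removes that part.
  testOf (indicator (Ioi 0) fun x => logCutoff n x * u x)
    (((contDiffOn_logCutoff n).mul hu).congr fun x hx => indicator_of_mem hx _)
    (Real.exp_pos (-(2 * (n + 1)))) (b := Real.exp (2 * (n + 1))) (by
      intro x hx
      by_cases h0 : x ∈ Ioi (0 : ℝ)
      · rw [indicator_of_mem h0, logCutoff_eq_zero h0 hx, zero_mul]
      · rw [indicator_of_notMem h0])

theorem cutTest_apply (n : ℕ) {u : ℝ → ℂ} (hu : ContDiffOn ℝ ∞ u (Ioi 0)) {x : ℝ} (hx : 0 < x) :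
    cutTest n u hu x = logCutoff n x * u x :=
  indicator_of_mem (s := Ioi (0 : ℝ)) hx fun x => logCutoff n x * u x

theorem expr_cutTest (α : ℂ) (n : ℕ) {u : ℝ → ℂ} (hu : ContDiffOn ℝ ∞ u (Ioi 0)) {x : ℝ}
    (hx : 0 < x) : expr α (cutTest n u hu) x = logCutoff n x * expr α u x
      - 2 * deriv (logCutoff n) x * deriv u x - deriv (deriv (logCutoff n)) x * u x := by
  rw [← expr_mul α (contDiffOn_logCutoff n) hu hx]
  refine expr_congr α ?_
  filter_upwards [Ioi_mem_nhds hx] with y hy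
  exact cutTest_apply n hu hy

/-- The reason for cutting off in log x: at both ends each derivative costs one power of x⁻¹ and
gains a prefactor 1/(n+1). The commutator terms in `expr_cutTest` are thereby dominated by multiples
of |u'|/x and |u|/x², and they vanish as n → ∞. -/
theorem norm_deriv_logCutoff_le {C : ℝ} (hC : ∀ x, |deriv bump x| ≤ C ∧ |deriv (deriv bump) x| ≤ C)
    (n : ℕ) {x : ℝ} (hx : 0 < x) :
    ‖deriv (logCutoff n) x‖ ≤ C / (n + 1) * (1 / x) ∧
      ‖deriv (deriv (logCutoff n)) x‖ ≤ 2 * C / (n + 1) * (1 / x ^ 2) := by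
  have hn : (1 : ℝ) ≤ n + 1 := by linarith [n.cast_nonneg (α := ℝ)]
  have hn0 : (0 : ℝ) < n + 1 := by linarith
  have hi : (1 : ℝ) / (n + 1) ≤ 1 := (div_le_one hn0).2 hn
  have hC0 : 0 ≤ C := (abs_nonneg _).trans (hC 0).1
  obtain ⟨b1, b2⟩ := hC (Real.log x / (n + 1))
  rw [(hasDerivAt_logCutoff n hx).deriv, (hasDerivAt_deriv_logCutoff n hx).deriv,
    Complex.norm_real, Complex.norm_real, Real.norm_eq_abs, Real.norm_eq_abs]
  constructor
  · rw [abs_mul, abs_of_pos (show 0 < x⁻¹ / (n + 1 : ℝ) by positivity)]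
    calc _ ≤ C * (x⁻¹ / (n + 1)) := by gcongr
      _ = _ := by ring
  · refine (abs_add_le _ _).trans ?_
    rw [abs_mul, abs_mul, abs_mul, abs_of_pos (show 0 < x⁻¹ / (n + 1 : ℝ) by positivity), abs_div,
      abs_neg, abs_of_pos hn0, abs_of_pos (show 0 < (x ^ 2)⁻¹ by positivity)]
    calc _ ≤ C * (x⁻¹ / (n + 1)) * (x⁻¹ / (n + 1)) + C * ((x ^ 2)⁻¹ / (n + 1)) := by gcongr
      _ = C / (n + 1) * (1 / x ^ 2) * (1 / (n + 1)) + C / (n + 1) * (1 / x ^ 2) := by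
        field_simp
      _ ≤ C / (n + 1) * (1 / x ^ 2) * 1 + C / (n + 1) * (1 / x ^ 2) := by gcongr
      _ = _ := by ring

/-- Smooth functions that decay sufficiently fast at `0` belong to the domain of `L_α^min`. -/
theorem mem_closure_testGraph (α : ℂ) {u : ℝ → ℂ} (hu : ContDiffOn ℝ ∞ u (Ioi 0))
    (h0 : MemLp u 2 halfLineMeasure) (h1 : MemLp (fun x => deriv u x / x) 2 halfLineMeasure)
    (h2 : MemLp (fun x => u x / (x : ℂ) ^ 2) 2 halfLineMeasure)
    (h3 : MemLp (expr α u) 2 halfLineMeasure)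
    {p : HalfLineL2 × HalfLineL2} (hp1 : p.1 =ᵐ[halfLineMeasure] u)
    (hp2 : p.2 =ᵐ[halfLineMeasure] expr α u) : p ∈ (testGraph α).topologicalClosure := by
  obtain ⟨C, hC0, hC⟩ := exists_bound_bump_deriv
  have e1 : p.1 = h0.toLp := Lp.ext (hp1.trans h0.coeFn_toLp.symm)
  have e2 : p.2 = h3.toLp := Lp.ext (hp2.trans h3.coeFn_toLp.symm)
  -- Truncations converge in graph norm by dominated convergence in L². The hypotheses on u'/x and
  -- u/x² provide the majorants of the commutator terms.
  have key : Tendsto (fun n => ((memLp_test (cutTest n u hu)).toLp,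
      (memLp_expr α (cutTest n u hu)).toLp)) atTop (𝓝 p) := by
    rw [show p = (h0.toLp, h3.toLp) from Prod.ext e1 e2]
    refine Tendsto.prodMk_nhds ?_ ?_
    · rw [Lp.tendsto_Lp_iff_tendsto_eLpNorm'']
      refine tendsto_eLpNorm_two_of_dominated (g := fun x => 2 * ‖u x‖)
        (fun n => (memLp_test (cutTest n u hu)).1) h0.1 (h0.norm.const_mul 2) ?_ ?_
      · intro n
        filter_upwards [ae_restrict_mem measurableSet_Ioi] with x hx
        rw [cutTest_apply n hu hx, show logCutoff n x * u x - u x = (logCutoff n x - 1) * u x by ring,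
          norm_mul]
        gcongr
        refine (norm_sub_le _ _).trans ?_
        rw [norm_one]
        linarith [norm_logCutoff_le n x]
      · filter_upwards [ae_restrict_mem measurableSet_Ioi] with x hx
        simp_rw [cutTest_apply _ hu hx]
        simpa using (tendsto_logCutoff x).mul_const (u x)
    · rw [Lp.tendsto_Lp_iff_tendsto_eLpNorm'']
      refine tendsto_eLpNorm_two_of_dominated
        (g := fun x => 2 * ‖expr α u x‖ + 2 * C * ‖deriv u x / x‖ + 2 * C * ‖u x / (x : ℂ) ^ 2‖)
        (fun n => (memLp_expr α (cutTest n u hu)).1) h3.1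
        (((h3.norm.const_mul 2).add (h1.norm.const_mul (2 * C))).add (h2.norm.const_mul (2 * C))) ?_ ?_
      · intro n
        filter_upwards [ae_restrict_mem measurableSet_Ioi] with x hx
        obtain ⟨b1, b2⟩ := norm_deriv_logCutoff_le hC n hx
        have hx' : (0 : ℝ) < x := hx
        have hn : (1 : ℝ) ≤ n + 1 := by linarith [n.cast_nonneg (α := ℝ)]
        rw [expr_cutTest α n hu hx]
        have : logCutoff n x * expr α u x - 2 * deriv (logCutoff n) x * deriv u x
            - deriv (deriv (logCutoff n)) x * u x - expr α u x
            = (logCutoff n x - 1) * expr α u x + -(2 * deriv (logCutoff n) x * deriv u x)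
              + -(deriv (deriv (logCutoff n)) x * u x) := by ring
        rw [this]
        refine (norm_add₃_le).trans ?_
        rw [norm_neg, norm_neg, norm_mul, norm_mul, norm_mul, norm_mul, norm_div, norm_div, norm_pow,
          Complex.norm_real, Real.norm_of_nonneg hx'.le, RCLike.norm_ofNat]
        gcongr ?_ + ?_ + ?_
        · gcongr
          refine (norm_sub_le _ _).trans ?_
          rw [norm_one]
          linarith [norm_logCutoff_le n x]
        · calc _ ≤ 2 * (C / (n + 1) * (1 / x)) * ‖deriv u x‖ := by gcongr
            _ ≤ 2 * (C / 1 * (1 / x)) * ‖deriv u x‖ := by gcongr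
            _ = _ := by ring
        · calc _ ≤ (2 * C / (n + 1) * (1 / x ^ 2)) * ‖u x‖ := by gcongr
            _ ≤ (2 * C / 1 * (1 / x ^ 2)) * ‖u x‖ := by gcongr
            _ = _ := by ring
      · filter_upwards [ae_restrict_mem measurableSet_Ioi] with x hx
        simp_rw [expr_cutTest α _ hu hx]
        have hz (D : ℝ) : Tendsto (fun n : ℕ => D / ((n : ℝ) + 1)) atTop (𝓝 0) :=
          tendsto_const_nhds.div_atTop
            (tendsto_atTop_add_const_right _ _ tendsto_natCast_atTop_atTop)
        have t1 : Tendsto (fun n => deriv (logCutoff n) x) atTop (𝓝 0) :=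
          squeeze_zero_norm (fun n => (norm_deriv_logCutoff_le hC n hx).1)
            (by simpa using (hz C).mul_const (1 / x))
        have t2 : Tendsto (fun n => deriv (deriv (logCutoff n)) x) atTop (𝓝 0) :=
          squeeze_zero_norm (fun n => (norm_deriv_logCutoff_le hC n hx).2)
            (by simpa only [zero_mul] using (hz (2 * C)).mul_const (1 / x ^ 2))
        have := (((tendsto_logCutoff x).mul_const (expr α u x)).sub
          ((t1.const_mul 2).mul_const (deriv u x))).sub (t2.mul_const (u x))
        simpa using this
  refine mem_closure_of_tendsto key (Eventually.of_forall fun n => ?_)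
  change _ ∈ testGraph α
  exact ⟨cutTest n u hu, (memLp_test _).coeFn_toLp, (memLp_expr α _).coeFn_toLp⟩

/-! ### The bilinear pairing -/

/-- The bilinear pairing `∫ f g`. -/
def pair (f g : HalfLineL2) : ℂ := ∫ x, f x * g x ∂halfLineMeasure

theorem pair_comm (f g : HalfLineL2) : pair f g = pair g f := by
  simp only [pair, mul_comm]

theorem pair_add_left (f g h : HalfLineL2) : pair (f + g) h = pair f h + pair g h :=
  pairing_add f g (Lp.memLp h)

theorem pair_smul_left (c : ℂ) (f h : HalfLineL2) : pair (c • f) h = c * pair f h :=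
  pairing_smul c f h

theorem pair_add_right (f g h : HalfLineL2) : pair f (g + h) = pair f g + pair f h := by
  rw [pair_comm, pair_add_left, pair_comm g, pair_comm h]

theorem pair_smul_right (c : ℂ) (f h : HalfLineL2) : pair f (c • h) = c * pair f h := by
  rw [pair_comm, pair_smul_left, pair_comm h]

theorem pair_sub_left (f g h : HalfLineL2) : pair (f - g) h = pair f h - pair g h := by
  rw [sub_eq_add_neg, ← neg_one_smul ℂ, pair_add_left, pair_smul_left]
  ring

theorem pair_sub_right (f g h : HalfLineL2) : pair f (g - h) = pair f g - pair f h := by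
  rw [pair_comm, pair_sub_left, pair_comm g, pair_comm h]

theorem continuous_pair_left (g : HalfLineL2) : Continuous fun f => pair f g :=
  continuous_pairing (Lp.memLp g)

theorem continuous_pair_right (f : HalfLineL2) : Continuous fun g => pair f g := by
  simpa only [pair_comm f] using continuous_pair_left f

theorem inner_eq_pair (f g : HalfLineL2) : inner ℂ f g = pair (star f) g := by
  rw [L2.inner_def]
  refine integral_congr_ae ?_
  filter_upwards [Lp.coeFn_star f] with x hx
  rw [hx]
  simp [mul_comm]

theorem eq_zero_of_pair (f : HalfLineL2) (h : ∀ g, pair f g = 0) : f = 0 := by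
  have h1 := h (star f)
  rwa [pair_comm, ← inner_eq_pair, inner_self_eq_zero] at h1

/-- The class of a test function. -/
def testLp (φ : 𝓓(halfLine, ℂ)) : HalfLineL2 := (memLp_test φ).toLp

theorem coeFn_testLp (φ : 𝓓(halfLine, ℂ)) : testLp φ =ᵐ[halfLineMeasure] φ :=
  (memLp_test φ).coeFn_toLp

theorem pair_testLp (f : HalfLineL2) (φ : 𝓓(halfLine, ℂ)) :
    pair f (testLp φ) = ∫ x, f x * φ x ∂halfLineMeasure := by
  refine integral_congr_ae ?_
  filter_upwards [coeFn_testLp φ] with x hx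
  rw [hx]

/-- A locally integrable function on the half-line that annihilates all test functions vanishes. -/
theorem ae_eq_zero_of_integral_test {f : ℝ → ℂ} (hf : LocallyIntegrableOn f (Ioi 0) volume)
    (h : ∀ φ : 𝓓(halfLine, ℂ), ∫ x, f x * φ x ∂halfLineMeasure = 0) :
    f =ᵐ[halfLineMeasure] 0 := by
  have hz := isOpen_Ioi.ae_eq_zero_of_integral_contDiff_smul_eq_zero hf (fun g hg hgc hgs => by
    let φ : 𝓓(halfLine, ℂ) := ⟨fun x => (g x : ℂ), Complex.ofRealCLM.contDiff.comp hg,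
      hgc.comp_left (g := fun r : ℝ => (r : ℂ)) (by simp), by
        refine (closure_mono ?_).trans hgs
        intro x hx
        simpa using hx⟩
    rw [← h φ]
    symm
    have h2 : ∀ x ∉ Ioi (0 : ℝ), f x * φ x = 0 := by
      intro x hx
      have : φ x = 0 := image_eq_zero_of_notMem_tsupport fun h => hx (φ.tsupport_subset h)
      rw [this, mul_zero]
    rw [setIntegral_eq_integral_of_forall_compl_eq_zero h2]
    refine integral_congr_ae (Eventually.of_forall fun x => ?_)
    change f x * (g x : ℂ) = g x • f x
    rw [Complex.real_smul, mul_comm])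
  exact (ae_restrict_iff' measurableSet_Ioi).2 hz

theorem locallyIntegrableOn_L2 (f : HalfLineL2) :
    LocallyIntegrableOn (f : ℝ → ℂ) (Ioi 0) volume :=
  locallyIntegrableOn_of_locallyIntegrable_restrict ((Lp.memLp f).locallyIntegrable (by norm_num))

/-- The conjugate of a vector orthogonal to all test functions integrates to zero against each of
them, so it vanishes almost everywhere. The span only supplies the submodule structure: test
functions already form a linear space. -/
theorem dense_testLp : Dense (range testLp) := by
  let S : Submodule ℂ HalfLineL2 := Submodule.span ℂ (range testLp)
  have hS : (S : Set HalfLineL2) = range testLp := by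
    refine Subset.antisymm (fun x hx => ?_) Submodule.subset_span
    induction hx using Submodule.span_induction with
    | mem x hx => exact hx
    | zero => exact ⟨0, Lp.ext ((coeFn_testLp 0).trans (Lp.coeFn_zero _ _ _).symm)⟩
    | add x y _ _ hx hy =>
      obtain ⟨φ, rfl⟩ := hx
      obtain ⟨ψ, rfl⟩ := hy
      exact ⟨φ + ψ, Lp.ext ((coeFn_testLp _).trans
        (((coeFn_testLp φ).add (coeFn_testLp ψ)).symm.trans (Lp.coeFn_add _ _).symm))⟩
    | smul c x _ hx =>
      obtain ⟨φ, rfl⟩ := hx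
      exact ⟨c • φ, Lp.ext ((coeFn_testLp _).trans
        (((coeFn_testLp φ).const_smul c).symm.trans (Lp.coeFn_smul _ _).symm))⟩
  rw [← hS]
  refine (Submodule.dense_iff_topologicalClosure_eq_top).2 ?_
  rw [Submodule.topologicalClosure_eq_top_iff, Submodule.eq_bot_iff]
  intro f hf
  have h0 : (star f : HalfLineL2) = 0 := by
    refine Lp.ext ((ae_eq_zero_of_integral_test (locallyIntegrableOn_L2 _) fun φ => ?_).trans
      (Lp.coeFn_zero _ _ _).symm)
    rw [← pair_testLp, ← inner_eq_pair]
    exact (Submodule.mem_orthogonal' S f).1 hf _ (Submodule.subset_span ⟨φ, rfl⟩)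
  have := h0 ▸ inner_eq_pair f f
  rw [← inner_self_eq_zero (𝕜 := ℂ), this, pair_comm, pair, ← pair]
  simpa using pair_smul_right 0 f 0

/-! ### Complex conjugation -/

theorem isometry_star_L2 : Isometry (star : HalfLineL2 → HalfLineL2) := by
  refine Isometry.of_dist_eq fun f g => ?_
  rw [Lp.dist_def, Lp.dist_def]
  congr 1
  refine eLpNorm_congr_norm_ae ?_
  filter_upwards [Lp.coeFn_star f, Lp.coeFn_star g] with x hf hg
  rw [Pi.sub_apply, Pi.sub_apply, hf, hg, Pi.star_apply, Pi.star_apply, ← star_sub, norm_star]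

theorem star_add_L2 (f g : HalfLineL2) : star (f + g) = star f + star g := by
  refine Lp.ext ?_
  filter_upwards [Lp.coeFn_star f, Lp.coeFn_star g, Lp.coeFn_star (f + g), Lp.coeFn_add f g,
    Lp.coeFn_add (star f) (star g)] with x h1 h2 h3 h4 h5
  rw [h3, h5, Pi.star_apply, h4, Pi.add_apply, Pi.add_apply, h1, h2, star_add, Pi.star_apply,
    Pi.star_apply]

theorem star_smul_L2 (c : ℂ) (f : HalfLineL2) : star (c • f) = star c • star f := by
  refine Lp.ext ?_
  filter_upwards [Lp.coeFn_star f, Lp.coeFn_star (c • f), Lp.coeFn_smul c f,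
    Lp.coeFn_smul (star c) (star f)] with x h1 h2 h3 h4
  rw [h2, h4, Pi.star_apply, h3, Pi.smul_apply, Pi.smul_apply, h1, star_smul, Pi.star_apply]

theorem deriv_star_comp (u : ℝ → ℂ) : deriv (fun x => star (u x)) = fun x => star (deriv u x) := by
  ext x
  exact deriv.star

theorem expr_star (α : ℂ) (u : ℝ → ℂ) (x : ℝ) :
    expr (star α) (fun x => star (u x)) x = star (expr α u x) := by
  simp only [expr, deriv_star_comp]
  simp

/-- The conjugate of a test function. -/
def conjTest (φ : 𝓓(halfLine, ℂ)) : 𝓓(halfLine, ℂ) :=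
  ⟨fun x => star (φ x), Complex.conjCLE.contDiff.comp φ.contDiff,
    φ.hasCompactSupport.comp_left (g := star) (star_zero _), by
      refine (closure_mono ?_).trans φ.tsupport_subset
      intro x hx
      simpa using hx⟩

theorem star_mem_testGraph {α : ℂ} {p : HalfLineL2 × HalfLineL2} (hp : p ∈ testGraph α) :
    (star p.1, star p.2) ∈ testGraph (star α) := by
  obtain ⟨φ, h1, h2⟩ := hp
  refine ⟨conjTest φ, ?_, ?_⟩
  · filter_upwards [h1, Lp.coeFn_star p.1] with x h h'
    rw [h', Pi.star_apply, h]
    rfl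
  · filter_upwards [h2, Lp.coeFn_star p.2] with x h h'
    rw [h', Pi.star_apply, h]
    exact (expr_star α φ x).symm

theorem star_mem_closure_testGraph {α : ℂ} {p : HalfLineL2 × HalfLineL2}
    (hp : p ∈ (testGraph α).topologicalClosure) :
    (star p.1, star p.2) ∈ (testGraph (star α)).topologicalClosure := by
  have hc : Continuous fun p : HalfLineL2 × HalfLineL2 => ((star p.1, star p.2) : _ × _) :=
    (isometry_star_L2.continuous.comp continuous_fst).prodMk
      (isometry_star_L2.continuous.comp continuous_snd)
  exact map_mem_closure (f := fun p : HalfLineL2 × HalfLineL2 => ((star p.1, star p.2) : _ × _)) hc hp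
    fun q hq => star_mem_testGraph hq

/-! ### The minimal operator -/

theorem graph_Lmin (α : ℂ) : (Lmin α).graph = (testGraph α).topologicalClosure := by
  rw [Lmin, ← (isClosable_Ltest α).graph_closure_eq_closure_graph, graph_Ltest]

theorem isClosed_maxGraph (α : ℂ) : IsClosed (maxGraph α : Set (HalfLineL2 × HalfLineL2)) := by
  rw [← graph_Lmax]
  exact isClosed_Lmax α

theorem closure_testGraph_le_maxGraph (α : ℂ) : (testGraph α).topologicalClosure ≤ maxGraph α :=
  Submodule.topologicalClosure_minimal _ (testGraph_le_maxGraph α) (isClosed_maxGraph α)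

/-- For q coming from a test function this is the definition of the distributional operator; both
sides are continuous in q for the graph topology, so it passes to the closure. L^max and L^min are
thus in duality for the bilinear pairing. -/
theorem pair_max_min {α : ℂ} {p q : HalfLineL2 × HalfLineL2} (hp : p ∈ maxGraph α)
    (hq : q ∈ (testGraph α).topologicalClosure) : pair p.1 q.2 = pair p.2 q.1 := by
  have hc : IsClosed {q : HalfLineL2 × HalfLineL2 | pair p.1 q.2 = pair p.2 q.1} :=
    isClosed_eq ((continuous_pair_right _).comp continuous_snd)
      ((continuous_pair_right _).comp continuous_fst)
  refine closure_minimal ?_ hc hq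
  rintro q ⟨φ, h1, h2⟩
  have e1 : pair p.1 q.2 = ∫ x, p.1 x * expr α φ x ∂halfLineMeasure :=
    integral_congr_ae (by filter_upwards [h2] with x hx; rw [hx])
  have e2 : pair p.2 q.1 = ∫ x, p.2 x * φ x ∂halfLineMeasure :=
    integral_congr_ae (by filter_upwards [h1] with x hx; rw [hx])
  exact e1.trans ((hp φ).trans e2.symm)

/-! ### Square integrability from asymptotic bounds -/

/-- The square is dominated by x^{2β} near 0, integrable because 2β > -1, and by an exponential at
infinity; on the compact interval in between continuity suffices. This criterion serves for the
explicit functions below. -/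
theorem memLp_of_isBigO {f : ℝ → ℂ} (hf : ContinuousOn f (Ioi 0)) {β κ : ℝ} (hβ : -(1 / 2) < β)
    (hκ : 0 < κ) (h0 : f =O[𝓝[>] 0] fun x => x ^ β)
    (h1 : f =O[atTop] fun x => Real.exp (-κ * x)) : MemLp f 2 halfLineMeasure := by
  have hm : AEStronglyMeasurable f halfLineMeasure := hf.aestronglyMeasurable measurableSet_Ioi
  rw [memLp_two_iff_integrable_sq_norm hm]
  have hc : ContinuousOn (fun x => ‖f x‖ ^ 2) (Ioi 0) := hf.norm.pow 2
  obtain ⟨C, hC⟩ := h0.bound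
  obtain ⟨D, hD⟩ := h1.bound
  obtain ⟨M, hM⟩ := eventually_atTop.1 hD
  obtain ⟨δ, hδ, hδC⟩ := mem_nhdsGT_iff_exists_Ioc_subset.1 hC
  have hδ' : (0 : ℝ) < δ := hδ
  have hu : Ioi (0 : ℝ) ⊆ Ioc 0 δ ∪ (Icc δ (max δ M) ∪ Ioi (max δ M)) := by
    intro x hx
    rcases le_or_gt x δ with h | h
    · exact Or.inl ⟨hx, h⟩
    · rcases le_or_gt x (max δ M) with h' | h'
      · exact Or.inr (Or.inl ⟨h.le, h'⟩)
      · exact Or.inr (Or.inr h')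
  refine IntegrableOn.mono_set (t := Ioc 0 δ ∪ (Icc δ (max δ M) ∪ Ioi (max δ M))) ?_ hu
  refine IntegrableOn.union ?_ (IntegrableOn.union ?_ ?_)
  · have hi : IntegrableOn (fun x : ℝ => C ^ 2 * x ^ (2 * β)) (Ioc 0 δ) volume := by
      refine Integrable.const_mul ?_ _
      have := (intervalIntegral.intervalIntegrable_rpow' (a := 0) (b := δ) (r := 2 * β)
        (by linarith))
      exact (intervalIntegrable_iff_integrableOn_Ioc_of_le hδ'.le).1 this
    refine hi.mono' ((hc.mono Ioc_subset_Ioi_self).aestronglyMeasurable measurableSet_Ioc) ?_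
    filter_upwards [ae_restrict_mem measurableSet_Ioc] with x hx
    have h := hδC hx
    simp only [mem_ofPred_eq] at h
    rw [Real.norm_of_nonneg (by positivity), mul_comm 2 β, Real.rpow_mul hx.1.le]
    calc ‖f x‖ ^ 2 ≤ (C * ‖x ^ β‖) ^ 2 := by gcongr
      _ = _ := by
        rw [Real.norm_of_nonneg (Real.rpow_nonneg hx.1.le _)]
        norm_num
        ring
  · exact (hc.mono fun x hx => lt_of_lt_of_le hδ' hx.1).integrableOn_Icc
  · have hi : IntegrableOn (fun x : ℝ => D ^ 2 * Real.exp (-(2 * κ) * x)) (Ioi (max δ M)) volume :=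
      (integrableOn_exp_mul_Ioi (by linarith) _).const_mul _
    refine hi.mono' ((hc.mono fun x hx => lt_of_lt_of_le hδ'
      ((le_max_left _ _).trans (le_of_lt hx))).aestronglyMeasurable measurableSet_Ioi) ?_
    filter_upwards [ae_restrict_mem measurableSet_Ioi] with x hx
    have h := hM x ((le_max_right _ _).trans (le_of_lt hx))
    rw [Real.norm_of_nonneg (by positivity)]
    calc ‖f x‖ ^ 2 ≤ (D * ‖Real.exp (-κ * x)‖) ^ 2 := by gcongr
      _ = _ := by
        rw [Real.norm_of_nonneg (Real.exp_pos _).le, mul_pow, ← Real.exp_nat_mul]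
        congr 2
        push_cast
        ring

/-! ### Powers -/

theorem hasDerivAt_ofReal_cpow (c : ℂ) {x : ℝ} (hx : 0 < x) :
    HasDerivAt (fun y : ℝ => (y : ℂ) ^ c) (c / x * (x : ℂ) ^ c) x := by
  have h0 : (x : ℂ) ≠ 0 := Complex.ofReal_ne_zero.2 hx.ne'
  have h := ((hasDerivAt_id (x : ℂ)).cpow_const (c := c)
    (Complex.ofReal_mem_slitPlane.2 hx)).comp_ofReal
  refine h.congr_deriv ?_
  rw [id, Complex.cpow_sub _ _ h0, Complex.cpow_one]
  ring

theorem contDiffOn_ofReal_cpow (c : ℂ) : ContDiffOn ℝ ∞ (fun y : ℝ => (y : ℂ) ^ c) (Ioi 0) := by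
  have h : ContDiffOn ℝ ∞ (fun y : ℝ => Complex.exp ((Real.log y : ℝ) * c)) (Ioi 0) :=
    ((Complex.ofRealCLM.contDiff.comp_contDiffOn
      (Real.contDiffOn_log.mono fun x hx => ne_of_gt hx)).mul contDiffOn_const).cexp
  refine h.congr fun x hx => ?_
  have hx' : (0 : ℝ) < x := hx
  rw [Complex.cpow_def_of_ne_zero (Complex.ofReal_ne_zero.2 hx'.ne'), Complex.ofReal_log hx'.le]

theorem norm_ofReal_cpow (c : ℂ) {x : ℝ} (hx : 0 < x) : ‖(x : ℂ) ^ c‖ = x ^ c.re :=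
  Complex.norm_cpow_eq_rpow_re_of_pos hx c

/-- The indicial equation: (1/2+m)(m-1/2) = m² - 1/4. -/
theorem expr_ofReal_cpow (m : ℂ) {x : ℝ} (hx : 0 < x) :
    expr (m ^ 2) (fun y : ℝ => (y : ℂ) ^ (1 / 2 + m)) x = 0 := by
  have h0 : (x : ℂ) ≠ 0 := Complex.ofReal_ne_zero.2 hx.ne'
  have h1 : ∀ᶠ y : ℝ in 𝓝 x, HasDerivAt (fun y : ℝ => (y : ℂ) ^ (1 / 2 + m))
      ((1 / 2 + m) / y * (y : ℂ) ^ (1 / 2 + m)) y := by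
    filter_upwards [Ioi_mem_nhds hx] with y hy using hasDerivAt_ofReal_cpow _ hy
  have h2 : HasDerivAt (fun y : ℝ => (1 / 2 + m) / (y : ℂ)) (-(1 / 2 + m) / (x : ℂ) ^ 2) x := by
    have := (((hasDerivAt_id (x : ℂ)).inv h0).const_mul (1 / 2 + m)).comp_ofReal
    refine (this.congr_deriv ?_).congr_of_eventuallyEq (Eventually.of_forall fun y => ?_)
    · simp only [id]; ring
    · simp [div_eq_mul_inv]
  rw [expr_eq_of_hasDerivAt _ h1 (h2.mul (hasDerivAt_ofReal_cpow _ hx))]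
  field_simp
  ring

/-! ### The function `x^{1/2+m} ξ` -/

/-- The function `x^{1/2+m} ξ`. -/
def wFun (ξ : ℝ → ℝ) (m : ℂ) (x : ℝ) : ℂ := (x : ℂ) ^ (1 / 2 + m) * (ξ x : ℂ)

theorem maxGraph_unique {α : ℂ} {x y y' : HalfLineL2} (h : (x, y) ∈ maxGraph α)
    (h' : (x, y') ∈ maxGraph α) : y = y' := by
  have := maxGraph_single_valued α _ (sub_mem h h') (by simp)
  simpa [sub_eq_zero] using this

theorem graph_H_le_maxGraph (ξ : ℝ → ℝ) (m : ℂ) : (H ξ m).graph ≤ maxGraph (m ^ 2) := by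
  rw [← graph_Lmax]
  exact LinearPMap.le_graph_of_le LinearPMap.domRestrict_le

theorem contDiff_ofReal_cutoff {ξ : ℝ → ℝ} (hξ : IsCutoff ξ) : ContDiff ℝ ∞ (fun x => (ξ x : ℂ)) :=
  Complex.ofRealCLM.contDiff.comp hξ.smooth

theorem contDiffOn_wFun {ξ : ℝ → ℝ} (hξ : IsCutoff ξ) (m : ℂ) : ContDiffOn ℝ ∞ (wFun ξ m) (Ioi 0) :=
  (contDiffOn_ofReal_cpow _).mul (contDiff_ofReal_cutoff hξ).contDiffOn

theorem wFun_eventuallyEq_zero {ξ : ℝ → ℝ} (hξ : IsCutoff ξ) (m : ℂ) :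
    ∀ᶠ x in 𝓝[>] (0 : ℝ), wFun ξ m =ᶠ[𝓝 x] fun y : ℝ => (y : ℂ) ^ (1 / 2 + m) := by
  filter_upwards [hξ.eq_one.eventually_nhds.filter_mono nhdsWithin_le_nhds] with x hx
  filter_upwards [hx] with y hy
  rw [wFun, hy, Complex.ofReal_one, mul_one]

theorem wFun_eventuallyEq_atTop {ξ : ℝ → ℝ} (hξ : IsCutoff ξ)
    (m : ℂ) : ∀ᶠ x in atTop, wFun ξ m =ᶠ[𝓝 x] 0 := by
  obtain ⟨M, hM⟩ := hξ.compact.isBounded.subset_closedBall 0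
  filter_upwards [eventually_gt_atTop M] with x hx
  filter_upwards [Ioi_mem_nhds hx] with y hy
  have : ξ y = 0 := image_eq_zero_of_notMem_tsupport fun h => by
    have := hM h
    rw [mem_closedBall_zero_iff, Real.norm_eq_abs] at this
    exact absurd ((le_abs_self y).trans this) (not_le.2 hy)
  simp [wFun, this]

theorem memLp_wFun {ξ : ℝ → ℝ} (hξ : IsCutoff ξ)
    {m : ℂ} (hm : -1 < m.re) : MemLp (wFun ξ m) 2 halfLineMeasure := by
  -- Re m > -1 is exactly what makes the exponent 1/2 + Re m exceed -1/2. The rate κ = 1 is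
  -- arbitrary, the function being zero far out.
  refine memLp_of_isBigO (contDiffOn_wFun hξ m).continuousOn (β := 1 / 2 + m.re) (κ := 1)
    (by linarith) one_pos ?_ ?_
  · refine Asymptotics.IsBigO.of_bound 1 ?_
    filter_upwards [wFun_eventuallyEq_zero hξ m, self_mem_nhdsWithin] with x hx h0
    have h0' : (0 : ℝ) < x := h0
    rw [hx.eq_of_nhds, norm_ofReal_cpow _ h0', one_mul, Real.norm_of_nonneg (by positivity)]
    simp
  · refine (Asymptotics.isBigO_zero _ _).congr' ?_ EventuallyEq.rfl
    filter_upwards [wFun_eventuallyEq_atTop hξ m] with x hx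
    exact hx.eq_of_nhds.symm

/-- Where ξ = 1 the power is a solution, so the image vanishes near 0 as well as near infinity.
Hence no condition on m. -/
theorem memLp_expr_wFun {ξ : ℝ → ℝ} (hξ : IsCutoff ξ)
    (m : ℂ) : MemLp (expr (m ^ 2) (wFun ξ m)) 2 halfLineMeasure := by
  refine memLp_of_isBigO (continuousOn_expr _ (contDiffOn_wFun hξ m)) (β := 0) (κ := 1)
    (by norm_num) one_pos ?_ ?_
  · refine (Asymptotics.isBigO_zero _ _).congr' ?_ EventuallyEq.rfl
    filter_upwards [wFun_eventuallyEq_zero hξ m, self_mem_nhdsWithin] with x hx h0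
    rw [expr_congr _ hx, expr_ofReal_cpow m h0]
  · refine (Asymptotics.isBigO_zero _ _).congr' ?_ EventuallyEq.rfl
    filter_upwards [wFun_eventuallyEq_atTop hξ m] with x hx
    rw [expr_congr _ hx]
    simp [expr, show (0 : ℝ → ℂ) = fun _ => 0 from rfl]

/-- The element of the graph of `L_{m²}^max` given by `x^{1/2+m} ξ`. -/
def wPair {ξ : ℝ → ℝ} (hξ : IsCutoff ξ) {m : ℂ} (hm : -1 < m.re) : HalfLineL2 × HalfLineL2 :=
  ((memLp_wFun hξ hm).toLp, (memLp_expr_wFun hξ m).toLp)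

theorem wPair_mem_maxGraph {ξ : ℝ → ℝ} (hξ : IsCutoff ξ)
    {m : ℂ} (hm : -1 < m.re) : wPair hξ hm ∈ maxGraph (m ^ 2) :=
  mem_maxGraph_of_contDiffOn _ (contDiffOn_wFun hξ m) (memLp_wFun hξ hm).coeFn_toLp
    (memLp_expr_wFun hξ m).coeFn_toLp

/-- H_m is defined through a sum of domains. As `maxGraph` is single valued, the sum can be taken on
graphs, where closedness and symmetry are easier to handle. -/
theorem graph_H {ξ : ℝ → ℝ} (hξ : IsCutoff ξ) {m : ℂ} (hm : -1 < m.re) :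
    (H ξ m).graph = (testGraph (m ^ 2)).topologicalClosure ⊔ Submodule.span ℂ {wPair hξ hm} := by
  have hset : {u : HalfLineL2 | u =ᵐ[halfLineMeasure]
      fun x : ℝ => (x : ℂ) ^ (1 / 2 + m) * (ξ x : ℂ)} = {(wPair hξ hm).1} := by
    ext u
    rw [mem_singleton_iff]
    constructor
    · intro h
      exact Lp.ext (EventuallyEq.trans h (memLp_wFun hξ hm).coeFn_toLp.symm)
    · rintro rfl
      exact (memLp_wFun hξ hm).coeFn_toLp
  have hdom (x : HalfLineL2) : x ∈ (Lmin (m ^ 2)).domain ↔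
      ∃ y, (x, y) ∈ (testGraph (m ^ 2)).topologicalClosure := by
    rw [LinearPMap.mem_domain_iff, graph_Lmin]
  ext ⟨x, y⟩
  have hmem : (x, y) ∈ (H ξ m).graph ↔ (x, y) ∈ maxGraph (m ^ 2) ∧
      x ∈ (Lmin (m ^ 2)).domain ⊔ Submodule.span ℂ {(wPair hξ hm).1} := by
    rw [← hset, ← graph_Lmax]
    constructor
    · intro h
      refine ⟨LinearPMap.le_graph_of_le LinearPMap.domRestrict_le h, ?_⟩
      exact (LinearPMap.mem_domain_of_mem_graph h).1
    · rintro ⟨h1, h2⟩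
      have hd : x ∈ (H ξ m).domain := ⟨h2, LinearPMap.mem_domain_of_mem_graph h1⟩
      obtain ⟨y', hy'⟩ := LinearPMap.mem_domain_iff.1 hd
      have := LinearPMap.mem_graph_snd_inj _ h1 (LinearPMap.le_graph_of_le
        LinearPMap.domRestrict_le hy') rfl
      rwa [this]
  rw [hmem]
  constructor
  · rintro ⟨h1, h2⟩
    obtain ⟨a, ha, b, hb, rfl⟩ := Submodule.mem_sup.1 h2
    obtain ⟨c, rfl⟩ := Submodule.mem_span_singleton.1 hb
    obtain ⟨a', ha'⟩ := (hdom a).1 ha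
    have h3 : (a, a') + c • wPair hξ hm ∈ maxGraph (m ^ 2) :=
      add_mem (closure_testGraph_le_maxGraph _ ha') (Submodule.smul_mem _ _ (wPair_mem_maxGraph hξ hm))
    have : y = a' + c • (wPair hξ hm).2 := maxGraph_unique h1 h3
    subst this
    exact Submodule.mem_sup.2 ⟨_, ha', _, Submodule.smul_mem _ c (Submodule.mem_span_singleton_self _),
      rfl⟩
  · intro h
    obtain ⟨a, ha, b, hb, hab⟩ := Submodule.mem_sup.1 h
    obtain ⟨c, rfl⟩ := Submodule.mem_span_singleton.1 hb
    rw [← hab]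
    refine ⟨add_mem (closure_testGraph_le_maxGraph _ ha)
      (Submodule.smul_mem _ _ (wPair_mem_maxGraph hξ hm)), ?_⟩
    rw [show x = a.1 + c • (wPair hξ hm).1 from (congrArg Prod.fst hab).symm]
    exact Submodule.add_mem_sup ((hdom _).2 ⟨a.2, ha⟩)
      (Submodule.smul_mem _ c (Submodule.mem_span_singleton_self _))

theorem closure_testGraph_le_graph_H {ξ : ℝ → ℝ} (hξ : IsCutoff ξ) {m : ℂ} (hm : -1 < m.re) :
    (testGraph (m ^ 2)).topologicalClosure ≤ (H ξ m).graph := by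
  rw [graph_H hξ hm]
  exact le_sup_left

theorem isClosed_H {ξ : ℝ → ℝ} (hξ : IsCutoff ξ) {m : ℂ} (hm : -1 < m.re) : (H ξ m).IsClosed := by
  rw [LinearPMap.IsClosed, graph_H hξ hm]
  exact Submodule.isClosed_sup_finiteDimensional _ _ (Submodule.isClosed_topologicalClosure _)

theorem dense_domain_H {ξ : ℝ → ℝ} (hξ : IsCutoff ξ)
    {m : ℂ} (hm : -1 < m.re) : Dense ((H ξ m).domain : Set HalfLineL2) := by
  refine dense_testLp.mono ?_
  rintro _ ⟨φ, rfl⟩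
  refine LinearPMap.mem_domain_of_mem_graph (y := (memLp_expr (m ^ 2) φ).toLp)
    (closure_testGraph_le_graph_H hξ hm (Submodule.le_topologicalClosure _ ?_))
  exact ⟨φ, coeFn_testLp φ, (memLp_expr _ φ).coeFn_toLp⟩

/-- `H_m` is symmetric with respect to the bilinear pairing. -/
theorem pair_H {ξ : ℝ → ℝ} (hξ : IsCutoff ξ)
    {m : ℂ} (hm : -1 < m.re) {p q : HalfLineL2 × HalfLineL2} (hp : p ∈ (H ξ m).graph)
    (hq : q ∈ (H ξ m).graph) : pair p.1 q.2 = pair p.2 q.1 := by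
  have hp' := graph_H_le_maxGraph ξ m hp
  rw [graph_H hξ hm] at hp hq
  obtain ⟨a, ha, b, hb, rfl⟩ := Submodule.mem_sup.1 hp
  obtain ⟨c, rfl⟩ := Submodule.mem_span_singleton.1 hb
  obtain ⟨a', ha', b', hb', rfl⟩ := Submodule.mem_sup.1 hq
  obtain ⟨c', rfl⟩ := Submodule.mem_span_singleton.1 hb'
  -- Three of the four cross terms involve the minimal domain and are covered by the duality with
  -- L^max. The remaining one pairs x^{1/2+m} ξ with itself and is symmetric by commutativity of the
  -- pairing.
  have h1 := pair_max_min hp' ha'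
  have h2 := pair_max_min (wPair_mem_maxGraph hξ hm) ha
  simp only [Prod.fst_add, Prod.snd_add, Prod.smul_fst, Prod.smul_snd, pair_add_left,
    pair_add_right, pair_smul_left, pair_smul_right] at h1 ⊢
  rw [pair_comm _ a.2, pair_comm _ a.1] at h2
  rw [pair_comm (wPair hξ hm).1 (wPair hξ hm).2]
  linear_combination h1 - c' * h2

/-- For x > 0 and real ξ the conjugate of x^{1/2+m} ξ is x^{1/2+m̄} ξ, and conjugation carries the
minimal operator for m² to the one for m̄². -/
theorem star_mem_graph_H {ξ : ℝ → ℝ} (hξ : IsCutoff ξ)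
    {m : ℂ} (hm : -1 < m.re) {p : HalfLineL2 × HalfLineL2}
    (hp : p ∈ (H ξ m).graph) : (star p.1, star p.2) ∈ (H ξ (star m)).graph := by
  have hm' : -1 < (star m).re := by simpa using hm
  have hexp (x : ℝ) (hx : 0 < x) :
      (fun y => star (wFun ξ m y)) =ᶠ[𝓝 x] wFun ξ (star m) := by
    filter_upwards [Ioi_mem_nhds hx] with y hy
    have hy' : (0 : ℝ) < y := hy
    have harg : (y : ℂ).arg ≠ Real.pi := by
      rw [Complex.arg_ofReal_of_nonneg hy'.le]
      exact Real.pi_ne_zero.symm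
    have := Complex.cpow_conj (y : ℂ) (1 / 2 + m) harg
    simp only [map_add, map_div₀, map_one, Complex.conj_ofReal, map_ofNat] at this
    simp only [wFun, star_mul', Complex.star_def, Complex.conj_ofReal]
    rw [this]
  have hw : (star (wPair hξ hm).1, star (wPair hξ hm).2) = wPair hξ hm' := by
    refine Prod.ext (Lp.ext ?_) (Lp.ext ?_)
    · filter_upwards [Lp.coeFn_star (wPair hξ hm).1, (memLp_wFun hξ hm).coeFn_toLp,
        (memLp_wFun hξ hm').coeFn_toLp, ae_restrict_mem measurableSet_Ioi] with x h1 h2 h3 hx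
      refine h1.trans (Eq.trans ?_ h3.symm)
      rw [Pi.star_apply, wPair, h2]
      exact (hexp x hx).eq_of_nhds
    · filter_upwards [Lp.coeFn_star (wPair hξ hm).2, (memLp_expr_wFun hξ m).coeFn_toLp,
        (memLp_expr_wFun hξ (star m)).coeFn_toLp, ae_restrict_mem measurableSet_Ioi] with x h1 h2 h3 hx
      refine h1.trans (Eq.trans ?_ h3.symm)
      rw [Pi.star_apply, wPair, h2, ← expr_congr _ (hexp x hx), ← star_pow, expr_star]
  rw [graph_H hξ hm] at hp
  rw [graph_H hξ hm']
  obtain ⟨a, ha, b, hb, rfl⟩ := Submodule.mem_sup.1 hp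
  obtain ⟨c, rfl⟩ := Submodule.mem_span_singleton.1 hb
  have ha' := star_mem_closure_testGraph ha
  rw [star_pow] at ha'
  refine Submodule.mem_sup.2 ⟨_, ha', star c • wPair hξ hm',
    Submodule.smul_mem _ _ (Submodule.mem_span_singleton_self _), ?_⟩
  rw [← hw]
  simp [star_add_L2, star_smul_L2]

/-! ### Consequences of the existence of a right inverse of `H_m + k²` -/

/-- For f in the kernel of H_m + z, symmetry gives ∫ f g = ∫ f (H_m+z)Rg = ∫ ((H_m+z)f) Rg = 0 for
every g. -/
theorem H_injective {ξ : ℝ → ℝ} (hξ : IsCutoff ξ) {m : ℂ} (hm : -1 < m.re) {z : ℂ}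
    {R : HalfLineL2 → HalfLineL2} (hR : ∀ g, (R g, g - z • R g) ∈ (H ξ m).graph)
    {f : HalfLineL2} (hf : (f, -(z • f)) ∈ (H ξ m).graph) : f = 0 := by
  refine eq_zero_of_pair f fun g => ?_
  have := pair_H hξ hm hf (hR g)
  simp only [← neg_smul, pair_sub_right, pair_smul_left, pair_smul_right] at this
  linear_combination this

/-- The error R(H_m+z)f - f lies in the kernel of H_m + z, so a right inverse is automatically a
left inverse. -/
theorem resolvent_left {ξ : ℝ → ℝ} (hξ : IsCutoff ξ) {m : ℂ} (hm : -1 < m.re) {z : ℂ}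
    {R : HalfLineL2 → HalfLineL2} (hR : ∀ g, (R g, g - z • R g) ∈ (H ξ m).graph)
    {p : HalfLineL2 × HalfLineL2} (hp : p ∈ (H ξ m).graph) :
    R (p.2 + z • p.1) = p.1 := by
  have h := sub_mem hp (hR (p.2 + z • p.1))
  have h2 : p.1 - R (p.2 + z • p.1) = 0 := by
    refine H_injective hξ hm hR ?_
    convert h using 1
    refine Prod.ext rfl ?_
    simp only [Prod.snd_sub]
    module
  exact (sub_eq_zero.1 h2).symm

/-- The transpose of H_m for the bilinear pairing is no larger than H_m. For y in the transpose, y.1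
minus R(y.2 + z y.1) annihilates the range of H_m + z, which is all of L². -/
theorem mem_graph_H_of_pair {ξ : ℝ → ℝ} (hξ : IsCutoff ξ) {m : ℂ} (hm : -1 < m.re) {z : ℂ}
    {R : HalfLineL2 → HalfLineL2} (hR : ∀ g, (R g, g - z • R g) ∈ (H ξ m).graph) {y : HalfLineL2 × HalfLineL2}
    (hy : ∀ q ∈ (H ξ m).graph, pair y.1 q.2 = pair y.2 q.1) : y ∈ (H ξ m).graph := by
  have hZ := hR (y.2 + z • y.1)
  have h0 : y.1 - R (y.2 + z • y.1) = 0 := by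
    refine eq_zero_of_pair _ fun g => ?_
    have h1 := hy _ (hR g)
    have h2 := pair_H hξ hm hZ (hR g)
    simp only [pair_sub_left, pair_add_left, pair_sub_right, pair_smul_left,
      pair_smul_right] at h1 h2 ⊢
    linear_combination h1 - h2
  have h1 := sub_eq_zero.1 h0
  rw [← h1] at hZ
  convert hZ using 1
  exact Prod.ext rfl (by simp)

/-- Since ⟨f, g⟩ = ∫ f̄ g, the Hilbert space adjoint is the bilinear transpose conjugated by f ↦ f̄.
The transpose is H_m itself, and conjugation replaces m by m̄. -/
theorem adjoint_H {ξ : ℝ → ℝ} (hξ : IsCutoff ξ) {m : ℂ} (hm : -1 < m.re) {z : ℂ}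
    {R : HalfLineL2 → HalfLineL2} (hR : ∀ g, (R g, g - z • R g) ∈ (H ξ m).graph) : (H ξ m).adjoint = H ξ (star m) := by
  have hm' : -1 < (star m).re := by simpa using hm
  have hstar (f g : HalfLineL2) : pair (star f) g = star (pair f (star g)) := by
    rw [← inner_eq_pair, ← inner_conj_symm, inner_eq_pair, pair_comm]
    rfl
  refine LinearPMap.eq_of_eq_graph ?_
  rw [LinearPMap.adjoint_graph_eq_graph_adjoint (dense_domain_H hξ hm)]
  ext y
  rw [Submodule.mem_adjoint_iff]
  constructor
  · intro h
    have h1 : (star y.1, star y.2) ∈ (H ξ m).graph := by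
      refine mem_graph_H_of_pair hξ hm hR fun q hq => ?_
      have h2 := h q.1 q.2 hq
      rw [inner_eq_pair, inner_eq_pair, hstar, hstar, ← star_sub, star_eq_zero, sub_eq_zero] at h2
      rwa [pair_comm, pair_comm (star y.2)]
    simpa using star_mem_graph_H hξ hm h1
  · intro h a b hab
    have h1 := star_mem_graph_H hξ hm' h
    rw [star_star] at h1
    have h2 := pair_H hξ hm h1 hab
    rw [inner_eq_pair, inner_eq_pair, hstar, hstar, ← star_sub, star_eq_zero, sub_eq_zero,
      pair_comm, h2, pair_comm]

theorem mem_resolventSet_of_graph {T : HalfLineL2 →ₗ.[ℂ] HalfLineL2} {z : ℂ}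
    {R : HalfLineL2 →L[ℂ] HalfLineL2} (h1 : ∀ g, (R g, g - z • R g) ∈ T.graph)
    (h2 : ∀ p ∈ T.graph, R (p.2 + z • p.1) = p.1) : -z ∈ resolventSet T := by
  -- The resolvent set is defined through z - T, so at -z the inverse is minus that of T + z.
  refine ⟨-R, fun x => ?_, fun x => ?_⟩
  · have hx := h1 (-x)
    have hd := LinearPMap.mem_domain_of_mem_graph hx
    have e : (-R) x = R (-x) := by simp
    refine ⟨e ▸ hd, ?_⟩
    have h3 : T ⟨(-R) x, e ▸ hd⟩ = -x - z • R (-x) := by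
      have h4 := T.mem_graph ⟨(-R) x, e ▸ hd⟩
      exact T.mem_graph_snd_inj h4 hx e
    rw [h3, e]
    module
  · have h3 := h2 _ (T.mem_graph x)
    simp only [neg_apply]
    rw [← map_neg]
    convert h3 using 2
    simp only
    module

/-! ### Integral operators on the half-line: a weighted Schur test -/

/-- The weight `min(x,1)^{1/2-s}`. -/
def weight (s x : ℝ) : ℝ := min x 1 ^ (1 / 2 - s)

/-- The majorant of the integral kernels considered here. -/
def envelope (s κ x y : ℝ) : ℝ := weight s x * weight s y * Real.exp (-κ * |x - y|)

theorem weight_nonneg (s : ℝ) {x : ℝ} (hx : 0 < x) : 0 ≤ weight s x :=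
  Real.rpow_nonneg (le_min hx.le zero_le_one) _

@[fun_prop]
theorem measurable_weight (s : ℝ) : Measurable (weight s) := by
  unfold weight
  fun_prop

theorem sq_lintegral_mul_le {X : Type*} [MeasurableSpace X] (μ : Measure X) {f g : X → ℝ≥0∞}
    (hf : AEMeasurable f μ) (hg : AEMeasurable g μ) :
    (∫⁻ x, f x * g x ∂μ) ^ 2 ≤ (∫⁻ x, f x ^ 2 ∂μ) * ∫⁻ x, g x ^ 2 ∂μ := by
  have h := ENNReal.lintegral_mul_le_Lp_mul_Lq μ Real.HolderConjugate.two_two hf hg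
  simp only [Pi.mul_apply, ENNReal.rpow_two] at h
  calc _ ≤ ((∫⁻ x, f x ^ 2 ∂μ) ^ (1 / 2 : ℝ) * (∫⁻ x, g x ^ 2 ∂μ) ^ (1 / 2 : ℝ)) ^ 2 := by gcongr
    _ = _ := by
      rw [mul_pow, ← ENNReal.rpow_natCast, ← ENNReal.rpow_natCast, ← ENNReal.rpow_mul,
        ← ENNReal.rpow_mul]
      norm_num

theorem integrable_exp_neg_mul_abs {κ : ℝ} (hκ : 0 < κ) :
    Integrable (fun y : ℝ => Real.exp (-κ * |y|)) volume := by
  rw [← integrableOn_univ, ← Iic_union_Ioi (a := (0 : ℝ))]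
  refine IntegrableOn.union ?_ ?_
  · refine (integrableOn_exp_mul_Iic hκ 0).congr_fun (fun y hy => ?_) measurableSet_Iic
    simp only [abs_of_nonpos (show y ≤ 0 from hy), neg_mul_neg]
  · refine (integrableOn_exp_mul_Ioi (neg_neg_iff_pos.2 hκ) 0).congr_fun (fun y hy => ?_)
      measurableSet_Ioi
    simp only [abs_of_pos (show 0 < y from hy)]

/-- On ]0,1] the squared weight is y^{1-2s}, integrable exactly because s < 1, and the exponential
is at most 1. Beyond 1 the weight is 1 and translation invariance bounds the integral of the
exponential independently of x. -/
theorem exists_bound_lintegral_weight {s κ : ℝ} (hs : s < 1) (hκ : 0 < κ) :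
    ∃ A : ℝ≥0∞, A ≠ ⊤ ∧ ∀ x, ∫⁻ y, ENNReal.ofReal (weight s y) ^ 2 *
      ENNReal.ofReal (Real.exp (-κ * |x - y|)) ∂halfLineMeasure ≤ A := by
  refine ⟨(∫⁻ y in Ioc 0 1, ENNReal.ofReal (y ^ (1 - 2 * s))) +
    ∫⁻ y, ENNReal.ofReal (Real.exp (-κ * |y|)), ?_, fun x => ?_⟩
  · refine ENNReal.add_ne_top.2 ⟨?_, ?_⟩
    · have h : IntegrableOn (fun y : ℝ => y ^ (1 - 2 * s)) (Ioc 0 1) volume :=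
        (intervalIntegrable_iff_integrableOn_Ioc_of_le zero_le_one).1
          (intervalIntegral.intervalIntegrable_rpow' (by linarith))
      exact h.lintegral_lt_top.ne
    · have h : Integrable (fun y : ℝ => Real.exp (-κ * |y|)) volume :=
        integrable_exp_neg_mul_abs hκ
      exact h.lintegral_lt_top.ne
  · have hpt : ∀ y ∈ Ioi (0 : ℝ), ENNReal.ofReal (weight s y) ^ 2 *
        ENNReal.ofReal (Real.exp (-κ * |x - y|)) ≤
        (Ioc (0 : ℝ) 1).indicator (fun y => ENNReal.ofReal (y ^ (1 - 2 * s))) y +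
          ENNReal.ofReal (Real.exp (-κ * |x - y|)) := by
      intro y hy
      have hy' : (0 : ℝ) < y := hy
      rcases le_or_gt y 1 with h | h
      · refine le_add_right ?_
        rw [indicator_of_mem (show y ∈ Ioc (0 : ℝ) 1 from ⟨hy', h⟩), weight, min_eq_left h,
          ← ENNReal.ofReal_pow (by positivity), ← Real.rpow_natCast, ← Real.rpow_mul hy'.le,
          show (1 / 2 - s) * ((2 : ℕ) : ℝ) = 1 - 2 * s by push_cast; ring]
        refine mul_le_of_le_one_right' ?_
        rw [ENNReal.ofReal_le_one, Real.exp_le_one_iff]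
        nlinarith [abs_nonneg (x - y)]
      · rw [weight, min_eq_right h.le, Real.one_rpow, ENNReal.ofReal_one, one_pow, one_mul]
        exact le_add_self
    refine (setLIntegral_mono' measurableSet_Ioi hpt).trans ?_
    refine (setLIntegral_le_lintegral _ _).trans ?_
    rw [lintegral_add_left (Measurable.indicator (by fun_prop) measurableSet_Ioc),
      lintegral_indicator measurableSet_Ioc]
    refine add_le_add le_rfl ?_
    exact (lintegral_sub_left_eq_self (μ := volume)
      (fun y : ℝ => ENNReal.ofReal (Real.exp (-κ * |y|))) x).le

/-- The factors are distributed crosswise: w(y)e^{-κ|x-y|/2} against w(x)e^{-κ|x-y|/2}g(y).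
Cauchy–Schwarz produces one factor A from the y-integral, and after Tonelli the x-integral is again
bounded by the same A. -/
theorem schur_lintegral {s κ : ℝ} {A : ℝ≥0∞} (hA : ∀ x, ∫⁻ y, ENNReal.ofReal (weight s y) ^ 2 *
      ENNReal.ofReal (Real.exp (-κ * |x - y|)) ∂halfLineMeasure ≤ A)
    {g : ℝ → ℝ≥0∞} (hg : Measurable g) :
    ∫⁻ x, (∫⁻ y, ENNReal.ofReal (weight s x) * ENNReal.ofReal (weight s y) *
      ENNReal.ofReal (Real.exp (-κ * |x - y|)) * g y ∂halfLineMeasure) ^ 2 ∂halfLineMeasure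
      ≤ A ^ 2 * ∫⁻ y, g y ^ 2 ∂halfLineMeasure := by
  have hw : Measurable fun y => ENNReal.ofReal (weight s y) := (measurable_weight s).ennreal_ofReal
  have hexp (x y : ℝ) : ENNReal.ofReal (Real.exp (-κ * |x - y|)) =
      ENNReal.ofReal (Real.exp (-(κ / 2) * |x - y|)) ^ 2 := by
    rw [← ENNReal.ofReal_pow (Real.exp_pos _).le, ← Real.exp_nat_mul]
    congr 2
    push_cast
    ring
  have h1 (x : ℝ) : (∫⁻ y, ENNReal.ofReal (weight s x) * ENNReal.ofReal (weight s y) *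
      ENNReal.ofReal (Real.exp (-κ * |x - y|)) * g y ∂halfLineMeasure) ^ 2 ≤
      A * ∫⁻ y, ENNReal.ofReal (weight s x) ^ 2 * ENNReal.ofReal (Real.exp (-κ * |y - x|))
        * g y ^ 2 ∂halfLineMeasure := by
    have e : ∀ y, ENNReal.ofReal (weight s x) * ENNReal.ofReal (weight s y) *
        ENNReal.ofReal (Real.exp (-κ * |x - y|)) * g y =
        (ENNReal.ofReal (weight s y) * ENNReal.ofReal (Real.exp (-(κ / 2) * |x - y|))) *
        (ENNReal.ofReal (weight s x) * ENNReal.ofReal (Real.exp (-(κ / 2) * |x - y|)) * g y) := by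
      intro y
      rw [hexp]
      ring
    simp_rw [e]
    refine (sq_lintegral_mul_le _ (by fun_prop) (by fun_prop)).trans ?_
    simp_rw [mul_pow, ← hexp]
    gcongr ?_ * ?_
    · exact hA x
    · simp_rw [abs_sub_comm x]
      exact le_rfl
  refine (lintegral_mono h1).trans ?_
  rw [lintegral_const_mul _ (Measurable.lintegral_prod_right' (f := fun p : ℝ × ℝ =>
    ENNReal.ofReal (weight s p.1) ^ 2 * ENNReal.ofReal (Real.exp (-κ * |p.2 - p.1|)) * g p.2 ^ 2)
    (by fun_prop)), lintegral_lintegral_swap (Measurable.aemeasurable (by fun_prop)),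
    sq, mul_assoc]
  gcongr
  rw [← lintegral_const_mul _ (by fun_prop)]
  refine lintegral_mono fun y => ?_
  dsimp only
  rw [lintegral_mul_const _ (by fun_prop)]
  gcongr
  exact hA y

/-- `G` is measurable and bounded by `C` times the envelope. -/
structure KernelBound (s κ C : ℝ) (G : ℝ → ℝ → ℂ) : Prop where
  measurable : Measurable (Function.uncurry G)
  bound : ∀ x y, 0 < x → 0 < y → ‖G x y‖ ≤ C * envelope s κ x y

theorem KernelBound.enorm_le {s κ C : ℝ} {G : ℝ → ℝ → ℂ} (h : KernelBound s κ C G) (hC : 0 ≤ C)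
    {x y : ℝ} (hx : 0 < x) (hy : 0 < y) :
    ‖G x y‖ₑ ≤ ENNReal.ofReal C * (ENNReal.ofReal (weight s x) * ENNReal.ofReal (weight s y) *
      ENNReal.ofReal (Real.exp (-κ * |x - y|))) := by
  rw [← ENNReal.ofReal_mul (weight_nonneg s hx), ← ENNReal.ofReal_mul (mul_nonneg
    (weight_nonneg s hx) (weight_nonneg s hy)), ← ENNReal.ofReal_mul hC, ← ofReal_norm]
  exact ENNReal.ofReal_le_ofReal (h.bound x y hx hy)

/-- Square integrable rows make the kernel integral converge for every L² function at each x > 0, as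
needed for additivity of the integral operator. -/
theorem KernelBound.memLp {s κ C : ℝ} {G : ℝ → ℝ → ℂ} (h : KernelBound s κ C G) (hC : 0 ≤ C)
    (hs : s < 1) (hκ : 0 < κ) {x : ℝ} (hx : 0 < x) : MemLp (G x) 2 halfLineMeasure := by
  obtain ⟨A, hA, hA'⟩ := exists_bound_lintegral_weight hs hκ
  have hm : Measurable (G x) := h.measurable.comp measurable_prodMk_left
  refine ⟨hm.aestronglyMeasurable, ?_⟩
  rw [eLpNorm_lt_top_iff_lintegral_rpow_enorm_lt_top (by norm_num) (by norm_num)]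
  have hb : ∫⁻ y, ‖G x y‖ₑ ^ (2 : ℝ≥0∞).toReal ∂halfLineMeasure ≤
      (ENNReal.ofReal C * ENNReal.ofReal (weight s x)) ^ 2 * A := by
    refine le_trans ?_ (mul_le_mul_right (hA' x) _)
    rw [← lintegral_const_mul' _ _ (by finiteness)]
    refine setLIntegral_mono' measurableSet_Ioi fun y hy => ?_
    rw [ENNReal.toReal_ofNat, ENNReal.rpow_two]
    calc _ ≤ (ENNReal.ofReal C * (ENNReal.ofReal (weight s x) * ENNReal.ofReal (weight s y) *
          ENNReal.ofReal (Real.exp (-κ * |x - y|)))) ^ 2 := by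
          gcongr
          exact h.enorm_le hC hx hy
      _ = (ENNReal.ofReal C * ENNReal.ofReal (weight s x)) ^ 2 * (ENNReal.ofReal (weight s y) ^ 2 *
          (ENNReal.ofReal (Real.exp (-κ * |x - y|)) * ENNReal.ofReal (Real.exp (-κ * |x - y|)))) := by
        ring
      _ ≤ _ := by
        gcongr
        refine mul_le_of_le_one_right' ?_
        rw [ENNReal.ofReal_le_one, Real.exp_le_one_iff]
        nlinarith [abs_nonneg (x - y)]
  exact hb.trans_lt (ENNReal.mul_lt_top (by finiteness) hA.lt_top)

/-- `T` is the integral operator with kernel `G`. -/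
def HasKernel (T : HalfLineL2 →L[ℂ] HalfLineL2) (G : ℝ → ℝ → ℂ) : Prop :=
  ∀ g : HalfLineL2, T g =ᵐ[halfLineMeasure] fun x => ∫ y, G x y * g y ∂halfLineMeasure

theorem HasKernel.unique {T T' : HalfLineL2 →L[ℂ] HalfLineL2} {G : ℝ → ℝ → ℂ}
    (h : HasKernel T G) (h' : HasKernel T' G) : T = T' :=
  ContinuousLinearMap.ext fun g => Lp.ext ((h g).trans (h' g).symm)

/-- The constant A depends on s and κ only, not on the kernel. Pointwise estimates of differences of
kernels therefore become operator norm estimates, which is what holomorphy in the index needs. -/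
theorem exists_hasKernel {s κ : ℝ} (hs : s < 1) (hκ : 0 < κ) :
    ∃ A : ℝ, 0 ≤ A ∧ ∀ (G : ℝ → ℝ → ℂ) (C : ℝ), 0 ≤ C → KernelBound s κ C G →
      ∃ T : HalfLineL2 →L[ℂ] HalfLineL2, HasKernel T G ∧ ‖T‖ ≤ A * C := by
  obtain ⟨A, hA, hA'⟩ := exists_bound_lintegral_weight hs hκ
  refine ⟨A.toReal, ENNReal.toReal_nonneg, fun G C hC hG => ?_⟩
  have hmeas (g : HalfLineL2) : AEStronglyMeasurable
      (fun x => ∫ y, G x y * g y ∂halfLineMeasure) halfLineMeasure := by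
    refine StronglyMeasurable.aestronglyMeasurable ?_
    refine StronglyMeasurable.integral_prod_right (f := fun x y => G x y * g y) ?_
    exact hG.measurable.stronglyMeasurable.mul
      ((Lp.stronglyMeasurable g).comp_measurable measurable_snd)
  have hbound (g : HalfLineL2) :
      eLpNorm (fun x => ∫ y, G x y * g y ∂halfLineMeasure) 2 halfLineMeasure ≤
        ENNReal.ofReal C * A * eLpNorm g 2 halfLineMeasure := by
    have hgm : Measurable fun y => ‖g y‖ₑ := (Lp.stronglyMeasurable g).enorm
    have h := schur_lintegral hA' hgm
    have h2 : ∫⁻ x, ‖∫ y, G x y * g y ∂halfLineMeasure‖ₑ ^ 2 ∂halfLineMeasure ≤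
        ENNReal.ofReal C ^ 2 * (A ^ 2 * ∫⁻ y, ‖g y‖ₑ ^ 2 ∂halfLineMeasure) := by
      refine le_trans ?_ (mul_le_mul_right h _)
      rw [← lintegral_const_mul' _ _ (by finiteness)]
      refine setLIntegral_mono' measurableSet_Ioi fun x hx => ?_
      rw [← mul_pow]
      gcongr
      refine (enorm_integral_le_lintegral_enorm _).trans ?_
      rw [← lintegral_const_mul' _ _ (by finiteness)]
      refine setLIntegral_mono' measurableSet_Ioi fun y hy => ?_
      rw [enorm_mul, ← mul_assoc]
      gcongr
      exact hG.enorm_le hC hx hy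
    rw [eLpNorm_eq_lintegral_rpow_enorm_toReal (by norm_num) (by norm_num),
      eLpNorm_eq_lintegral_rpow_enorm_toReal (by norm_num) (by norm_num)]
    simp only [ENNReal.toReal_ofNat, ENNReal.rpow_two]
    calc _ ≤ (ENNReal.ofReal C ^ 2 * (A ^ 2 * ∫⁻ y, ‖g y‖ₑ ^ 2 ∂halfLineMeasure)) ^ (1 / 2 : ℝ) := by
          gcongr
      _ = _ := by
        rw [← mul_assoc, ← mul_pow, ENNReal.mul_rpow_of_nonneg _ _ (by norm_num),
          ← ENNReal.rpow_natCast, ← ENNReal.rpow_mul]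
        norm_num
  have hmem (g : HalfLineL2) :
      MemLp (fun x => ∫ y, G x y * g y ∂halfLineMeasure) 2 halfLineMeasure := by
    refine ⟨hmeas g, (hbound g).trans_lt ?_⟩
    exact ENNReal.mul_lt_top (ENNReal.mul_lt_top ENNReal.ofReal_lt_top hA.lt_top)
      (Lp.eLpNorm_lt_top g)
  let T₀ : HalfLineL2 →ₗ[ℂ] HalfLineL2 :=
    { toFun := fun g => (hmem g).toLp
      map_add' := fun g h => by
        refine Lp.ext ?_
        filter_upwards [(hmem (g + h)).coeFn_toLp, (hmem g).coeFn_toLp, (hmem h).coeFn_toLp,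
          Lp.coeFn_add (hmem g).toLp (hmem h).toLp, ae_restrict_mem measurableSet_Ioi]
          with x h1 h2 h3 h4 hx
        rw [h1, h4, Pi.add_apply, h2, h3]
        have := pairing_add g h (hG.memLp hC hs hκ hx)
        simpa only [mul_comm] using this
      map_smul' := fun c g => by
        refine Lp.ext ?_
        filter_upwards [(hmem (c • g)).coeFn_toLp, (hmem g).coeFn_toLp,
          Lp.coeFn_smul c (hmem g).toLp] with x h1 h2 h4
        rw [h1, RingHom.id_apply, h4, Pi.smul_apply, h2]
        have := pairing_smul c g (G x)
        simpa only [mul_comm _ (G x _), smul_eq_mul] using this }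
  refine ⟨T₀.mkContinuous (A.toReal * C) fun g => ?_, fun g => (hmem g).coeFn_toLp,
    LinearMap.mkContinuous_norm_le _ (by positivity) _⟩
  change ‖(hmem g).toLp‖ ≤ _
  rw [Lp.norm_toLp, Lp.norm_def]
  have := ENNReal.toReal_mono (by finiteness) (hbound g)
  rw [ENNReal.toReal_mul, ENNReal.toReal_mul, ENNReal.toReal_ofReal hC, mul_comm C] at this
  exact this

/-! ### The Macdonald function -/

theorem one_add_half_sq_le_cosh (t : ℝ) : 1 + t ^ 2 / 2 ≤ Real.cosh t := by
  have h1 : Real.cosh t = 1 + 2 * Real.sinh (t / 2) ^ 2 := by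
    have := Real.cosh_two_mul (t / 2)
    rw [Real.cosh_sq, show 2 * (t / 2) = t by ring] at this
    linarith
  have h2 : (t / 2) ^ 2 ≤ Real.sinh (t / 2) ^ 2 := by
    refine sq_le_sq.2 ?_
    rw [Real.abs_sinh]
    exact Real.self_le_sinh_iff.2 (abs_nonneg _)
  rw [h1]
  nlinarith

/-- A Gaussian majorant, from cosh t ≥ 1 + t²/2 and st ≤ ct²/4 + s²/c. -/
theorem exp_cosh_le {c : ℝ} (hc : 0 < c) (s t : ℝ) :
    Real.exp (-c * Real.cosh t + s * t) ≤ Real.exp (-c + s ^ 2 / c) * Real.exp (-(c / 4) * t ^ 2) := by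
  rw [← Real.exp_add, Real.exp_le_exp]
  have h1 : c * (1 + t ^ 2 / 2) ≤ c * Real.cosh t :=
    mul_le_mul_of_nonneg_left (one_add_half_sq_le_cosh t) hc.le
  have h2 : 0 ≤ (c * t / 2 - s) ^ 2 / c := by positivity
  have h3 : (c * t / 2 - s) ^ 2 / c = c * t ^ 2 / 4 - s * t + s ^ 2 / c := by
    field_simp
    ring
  nlinarith

theorem integrable_exp_cosh {c : ℝ} (hc : 0 < c) (s : ℝ) :
    Integrable fun t : ℝ => Real.exp (-c * Real.cosh t + s * t) := by
  refine ((integrable_exp_neg_mul_sq (show 0 < c / 4 by positivity)).const_mul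
    (Real.exp (-c + s ^ 2 / c))).mono' (by fun_prop) (Eventually.of_forall fun t => ?_)
  rw [Real.norm_of_nonneg (Real.exp_pos _).le]
  exact exp_cosh_le hc s t

/-- The integrand of the Macdonald function. -/
def bKker (k m : ℂ) (x t : ℝ) : ℂ := Complex.exp (-(k * x * Real.cosh t) + m * t)

/-- Twice the Macdonald function `K_m(kx)`. -/
def bK (k m : ℂ) (x : ℝ) : ℂ := ∫ t, bKker k m x t

theorem norm_bKker (k m : ℂ) (x t : ℝ) :
    ‖bKker k m x t‖ = Real.exp (-(k.re * x) * Real.cosh t + m.re * t) := by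
  rw [bKker, Complex.norm_exp]
  congr 1
  simp [-Complex.ofReal_cosh]

theorem continuous_bKker (k m : ℂ) (x : ℝ) : Continuous (bKker k m x) := by
  unfold bKker
  fun_prop

theorem bKker_add (k m n : ℂ) (x t : ℝ) :
    bKker k (m + n) x t = Complex.exp (n * t) * bKker k m x t := by
  rw [bKker, bKker, ← Complex.exp_add]
  congr 1
  ring

theorem integrable_bKker {k : ℂ} (hk : 0 < k.re)
    (m : ℂ) {x : ℝ} (hx : 0 < x) : Integrable (bKker k m x) := by
  refine (integrable_exp_cosh (mul_pos hk hx) m.re).mono' (continuous_bKker k m x).aestronglyMeasurable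
    (Eventually.of_forall fun t => (norm_bKker k m x t).le)

/-- Differentiation in x brings down -k cosh t = -k(eᵗ + e⁻ᵗ)/2, and multiplication by e^{±t} shifts
the index by ±1. On the neighbourhood y > x/2 the integrand has a fixed majorant. -/
theorem hasDerivAt_bK_aux {k : ℂ} (hk : 0 < k.re) (m : ℂ) {x : ℝ} (hx : 0 < x) :
    HasDerivAt (bK k m) (-(k / 2) * (bK k (m + 1) x + bK k (m - 1) x)) x := by
  have hcosh (t : ℝ) : ((Real.cosh t : ℝ) : ℂ) = (Complex.exp (1 * t) + Complex.exp (-1 * t)) / 2 := by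
    rw [Complex.ofReal_cosh, Complex.cosh]
    simp
  have hF' (y t : ℝ) : -(k * Real.cosh t) * bKker k m y t
      = -(k / 2) * (bKker k (m + 1) y t + bKker k (m - 1) y t) := by
    rw [sub_eq_add_neg, bKker_add, bKker_add, hcosh]
    ring
  have hc : 0 < k.re * (x / 2) := by positivity
  have key := (hasDerivAt_integral_of_dominated_loc_of_deriv_le (μ := volume) (𝕜 := ℝ)
    (F := fun y t => bKker k m y t) (F' := fun y t => -(k * Real.cosh t) * bKker k m y t) (x₀ := x)
    (s := Ioi (x / 2))
    (bound := fun t => ‖k‖ / 2 * (Real.exp (-(k.re * (x / 2)) * Real.cosh t + (m + 1).re * t)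
      + Real.exp (-(k.re * (x / 2)) * Real.cosh t + (m - 1).re * t)))
    (Ioi_mem_nhds (by linarith)) (Eventually.of_forall fun y =>
      (continuous_bKker k m y).aestronglyMeasurable) (integrable_bKker hk m hx)
    (by
      have := continuous_bKker k m x
      exact Continuous.aestronglyMeasurable (by fun_prop))
    (Eventually.of_forall fun t y hy => by
      have hy' : x / 2 < y := hy
      rw [hF', norm_mul, norm_neg, norm_div, RCLike.norm_ofNat]
      refine mul_le_mul_of_nonneg_left ((norm_add_le _ _).trans ?_) (by positivity)
      rw [norm_bKker, norm_bKker]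
      have := Real.cosh_pos t
      gcongr)
    (((integrable_exp_cosh hc _).add (integrable_exp_cosh hc _)).const_mul _)
    (Eventually.of_forall fun t y _ => by
      have h1 : HasDerivAt (fun y : ℝ => -(k * (y : ℂ) * Real.cosh t) + m * t)
          (-(k * Real.cosh t)) y := by
        have := ((Complex.ofRealCLM.hasDerivAt (x := y)).const_mul k).mul_const (Real.cosh t : ℂ)
        simpa using this.neg.add_const (m * t)
      have h2 := h1.cexp
      refine h2.congr_deriv ?_
      rw [mul_comm]
      rfl)).2
  refine key.congr_deriv ?_
  simp_rw [hF']
  rw [integral_const_mul, integral_add (integrable_bKker hk _ hx) (integrable_bKker hk _ hx)]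
  rfl

/-- The integral over ℝ of the t-derivative of the integrand is zero. -/
theorem bK_recurrence {k : ℂ} (hk : 0 < k.re) (m : ℂ) {x : ℝ} (hx : 0 < x) :
    k * x / 2 * (bK k (m + 1) x - bK k (m - 1) x) = m * bK k m x := by
  have hsinh (t : ℝ) : ((Real.sinh t : ℝ) : ℂ) = (Complex.exp (1 * t) - Complex.exp (-1 * t)) / 2 := by
    rw [Complex.ofReal_sinh, Complex.sinh]
    simp
  have hF' (t : ℝ) : bKker k m x t * (-(k * x * Real.sinh t) + m)
      = m * bKker k m x t - k * x / 2 * (bKker k (m + 1) x t - bKker k (m - 1) x t) := by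
    rw [sub_eq_add_neg m 1, bKker_add, bKker_add, hsinh]
    ring
  have i0 := integrable_bKker hk m hx
  have i1 := integrable_bKker hk (m + 1) hx
  have i2 := integrable_bKker hk (m - 1) hx
  have key := integral_eq_zero_of_hasDerivAt_of_integrable (f := bKker k m x)
    (f' := fun t => bKker k m x t * (-(k * x * Real.sinh t) + m)) (fun t => by
      have h1 : HasDerivAt (fun t : ℝ => -(k * x * (Real.cosh t : ℂ)) + m * t)
          (-(k * x * Real.sinh t) + m) t := by
        have h3 := ((Real.hasDerivAt_cosh t).ofReal_comp).const_mul (k * x)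
        have h4 := (Complex.ofRealCLM.hasDerivAt (x := t)).const_mul m
        exact (h3.neg.add h4).congr_deriv (by simp)
      exact h1.cexp) (by
      simp_rw [hF']
      exact (i0.const_mul m).sub ((i1.sub i2).const_mul _)) i0
  simp_rw [hF'] at key
  have e := (integral_sub (i0.const_mul m) ((i1.sub i2).const_mul (k * x / 2))).symm.trans key
  rw [integral_const_mul, integral_const_mul, sub_eq_zero] at e
  exact (e.trans (congrArg _ (integral_sub i1 i2))).symm

/-- The recurrence eliminates the index m - 1. Together with its companion for m + 1, this closes
into a first order system for the indices m and m + 1. -/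
theorem hasDerivAt_bK {k : ℂ} (hk : 0 < k.re) (m : ℂ) {x : ℝ} (hx : 0 < x) :
    HasDerivAt (bK k m) (m / x * bK k m x - k * bK k (m + 1) x) x := by
  have hx' : (x : ℂ) ≠ 0 := Complex.ofReal_ne_zero.2 hx.ne'
  refine (hasDerivAt_bK_aux hk m hx).congr_deriv ?_
  have h := bK_recurrence hk m hx
  field_simp
  linear_combination 2 * h

theorem hasDerivAt_bK_succ {k : ℂ} (hk : 0 < k.re) (m : ℂ) {x : ℝ} (hx : 0 < x) :
    HasDerivAt (bK k (m + 1)) (-((m + 1) / x * bK k (m + 1) x) - k * bK k m x) x := by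
  have hx' : (x : ℂ) ≠ 0 := Complex.ofReal_ne_zero.2 hx.ne'
  refine (hasDerivAt_bK_aux hk (m + 1) hx).congr_deriv ?_
  have h := bK_recurrence hk (m + 1) hx
  rw [add_sub_cancel_right] at h ⊢
  field_simp
  linear_combination -2 * h

theorem differentiable_bK_index {k : ℂ} (hk : 0 < k.re)
    {x : ℝ} (hx : 0 < x) : Differentiable ℂ fun m => bK k m x := by
  intro m
  have hc : 0 < k.re * x := by positivity
  have key := (hasDerivAt_integral_of_dominated_loc_of_deriv_le (μ := volume) (𝕜 := ℂ)
    (F := fun n t => bKker k n x t) (F' := fun n t => t * bKker k n x t) (x₀ := m)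
    (s := Metric.ball m 1)
    -- The shift by 2 absorbs the factor |t| ≤ e^{|t|} and the variation of Re n by less than 1 on
    -- the ball; the two exponentials cover the two signs of t.
    (bound := fun t => Real.exp (-(k.re * x) * Real.cosh t + (m.re + 2) * t)
      + Real.exp (-(k.re * x) * Real.cosh t + (m.re - 2) * t))
    (Metric.ball_mem_nhds m one_pos) (Eventually.of_forall fun y =>
      (continuous_bKker k y x).aestronglyMeasurable) (integrable_bKker hk m hx)
    (by
      have := continuous_bKker k m x
      exact Continuous.aestronglyMeasurable (by fun_prop))
    (Eventually.of_forall fun t n hn => by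
      have hre : |n.re - m.re| < 1 :=
        (Complex.abs_re_le_norm (n - m)).trans_lt (by simpa [dist_eq_norm] using hn)
      obtain ⟨h1, h2⟩ := abs_lt.1 hre
      rw [norm_mul, norm_bKker, Complex.norm_real, Real.norm_eq_abs]
      have h3 : |t| ≤ Real.exp |t| := (by linarith : |t| ≤ |t| + 1).trans (Real.add_one_le_exp _)
      refine (mul_le_mul_of_nonneg_right h3 (Real.exp_pos _).le).trans ?_
      rw [← Real.exp_add]
      rcases le_total 0 t with ht | ht
      · refine le_add_of_le_of_nonneg (Real.exp_le_exp.2 ?_) (Real.exp_pos _).le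
        rw [abs_of_nonneg ht]
        nlinarith
      · refine le_add_of_nonneg_of_le (Real.exp_pos _).le (Real.exp_le_exp.2 ?_)
        rw [abs_of_nonpos ht]
        nlinarith)
    ((integrable_exp_cosh hc _).add (integrable_exp_cosh hc _))
    (Eventually.of_forall fun t n _ => by
      have h1 : HasDerivAt (fun n : ℂ => -(k * (x : ℂ) * Real.cosh t) + n * t) t n := by
        simpa using ((hasDerivAt_id n).mul_const (t : ℂ)).const_add (-(k * (x : ℂ) * Real.cosh t))
      refine h1.cexp.congr_deriv ?_
      rw [mul_comm]
      rfl)).2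
  exact key.differentiableAt

/-! ### The integral `∫ exp(-k eᵗ + m t) dt` -/

/-- The Gamma integral in logarithmic variables. -/
def logGamma (k m : ℂ) : ℂ := ∫ t : ℝ, Complex.exp (-(k * Real.exp t) + m * t)

/-- For t ≤ 0 the factor e^{st} is integrable because s > 0. For t > 0, eᵗ ≥ cosh t reduces to the
Gaussian majorant. -/
theorem integrable_exp_exp {c s : ℝ} (hc : 0 < c) (hs : 0 < s) :
    Integrable fun t : ℝ => Real.exp (-c * Real.exp t + s * t) := by
  have h := (integrable_exp_neg_mul_sq (show 0 < c / 4 by positivity)).const_mul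
    (Real.exp (-c + s ^ 2 / c))
  rw [← integrableOn_univ, ← Iic_union_Ioi (a := (0 : ℝ))]
  refine IntegrableOn.union ?_ ?_
  · refine (integrableOn_exp_mul_Iic hs 0).mono' (by fun_prop) ?_
    refine Eventually.of_forall fun t => ?_
    rw [Real.norm_of_nonneg (Real.exp_pos _).le]
    refine Real.exp_le_exp.2 ?_
    nlinarith [mul_pos hc (Real.exp_pos t)]
  · refine h.integrableOn.mono' (by fun_prop) ?_
    filter_upwards [ae_restrict_mem measurableSet_Ioi] with t ht
    rw [Real.norm_of_nonneg (Real.exp_pos _).le]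
    refine le_trans (Real.exp_le_exp.2 ?_) (exp_cosh_le hc s t)
    have : Real.cosh t ≤ Real.exp t := by
      rw [Real.cosh_eq]
      have : Real.exp (-t) ≤ Real.exp t := Real.exp_le_exp.2 (by linarith [show (0 : ℝ) < t from ht])
      linarith
    nlinarith

theorem norm_logGamma_ker (k m : ℂ) (t : ℝ) :
    ‖Complex.exp (-(k * Real.exp t) + m * t)‖ = Real.exp (-k.re * Real.exp t + m.re * t) := by
  rw [Complex.norm_exp]
  congr 1
  simp [-Complex.ofReal_exp]

theorem integrable_logGamma_ker {k m : ℂ} (hk : 0 < k.re) (hm : 0 < m.re) :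
    Integrable fun t : ℝ => Complex.exp (-(k * Real.exp t) + m * t) :=
  (integrable_exp_exp hk hm).mono' (by fun_prop)
    (Eventually.of_forall fun t => (norm_logGamma_ker k m t).le)

theorem logGamma_ker_succ (k m : ℂ) (t : ℝ) :
    (Real.exp t : ℂ) * Complex.exp (-(k * Real.exp t) + m * t)
      = Complex.exp (-(k * Real.exp t) + (m + 1) * t) := by
  rw [Complex.ofReal_exp, ← Complex.exp_add]
  congr 1
  ring

theorem hasDerivAt_logGamma {k m : ℂ} (hk : 0 < k.re) (hm : 0 < m.re) :
    HasDerivAt (fun k => logGamma k m) (-logGamma k (m + 1)) k := by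
  have hm1 : 0 < (m + 1).re := by simp; linarith
  have key := (hasDerivAt_integral_of_dominated_loc_of_deriv_le (μ := volume) (𝕜 := ℂ)
    (F := fun k (t : ℝ) => Complex.exp (-(k * Real.exp t) + m * t))
    (F' := fun k t => -Complex.exp (-(k * Real.exp t) + (m + 1) * t)) (x₀ := k)
    (s := {z | k.re / 2 < z.re})
    (bound := fun t => Real.exp (-(k.re / 2) * Real.exp t + (m + 1).re * t))
    ((isOpen_lt continuous_const Complex.continuous_re).mem_nhds
      (show k.re / 2 < k.re by linarith))
    (Eventually.of_forall fun y => by fun_prop)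
    (integrable_logGamma_ker hk hm) (by fun_prop)
    (Eventually.of_forall fun t z hz => by
      have hz' : k.re / 2 < z.re := hz
      rw [norm_neg, norm_logGamma_ker]
      gcongr)
    (integrable_exp_exp (by linarith) hm1)
    (Eventually.of_forall fun t z _ => by
      have h1 : HasDerivAt (fun z : ℂ => -(z * Real.exp t) + m * t) (-Real.exp t) z := by
        simpa using ((hasDerivAt_id z).mul_const (Real.exp t : ℂ)).neg.add_const (m * t)
      refine h1.cexp.congr_deriv ?_
      rw [← logGamma_ker_succ]
      ring)).2
  refine key.congr_deriv ?_
  rw [integral_neg]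
  rfl

theorem logGamma_recurrence {k m : ℂ} (hk : 0 < k.re) (hm : 0 < m.re) :
    k * logGamma k (m + 1) = m * logGamma k m := by
  have hm1 : 0 < (m + 1).re := by simp; linarith
  have i0 := integrable_logGamma_ker hk hm
  have i1 := integrable_logGamma_ker hk hm1
  have hF' (t : ℝ) : Complex.exp (-(k * Real.exp t) + m * t) * (-(k * Real.exp t) + m)
      = m * Complex.exp (-(k * Real.exp t) + m * t)
        - k * Complex.exp (-(k * Real.exp t) + (m + 1) * t) := by
    rw [← logGamma_ker_succ]
    ring
  have key := integral_eq_zero_of_hasDerivAt_of_integrable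
    (f := fun t : ℝ => Complex.exp (-(k * Real.exp t) + m * t))
    (f' := fun t => Complex.exp (-(k * Real.exp t) + m * t) * (-(k * Real.exp t) + m)) (fun t => by
      have h1 : HasDerivAt (fun t : ℝ => -(k * (Real.exp t : ℂ)) + m * t)
          (-(k * Real.exp t) + m) t := by
        have h3 := ((Real.hasDerivAt_exp t).ofReal_comp).const_mul k
        have h4 := (Complex.ofRealCLM.hasDerivAt (x := t)).const_mul m
        exact (h3.neg.add h4).congr_deriv (by simp)
      exact h1.cexp) (by
      simp_rw [hF']
      exact (i0.const_mul m).sub (i1.const_mul _)) i0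
  simp_rw [hF'] at key
  rw [integral_sub (i0.const_mul m) (i1.const_mul _), integral_const_mul,
    integral_const_mul, sub_eq_zero] at key
  exact key.symm

theorem logGamma_one {m : ℂ} (hm : 0 < m.re) : logGamma 1 m = Complex.Gamma m := by
  rw [Complex.Gamma_eq_integral hm, Complex.GammaIntegral, ← Real.range_exp, ← image_univ,
    integral_image_eq_integral_abs_deriv_smul MeasurableSet.univ
      (fun t _ => (Real.hasDerivAt_exp t).hasDerivWithinAt) Real.exp_injective.injOn, setIntegral_univ]
  refine integral_congr_ae (Eventually.of_forall fun t => ?_)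
  simp only
  rw [abs_of_pos (Real.exp_pos t), Complex.real_smul, Complex.cpow_def_of_ne_zero (by
    simp), ← Complex.ofReal_log (Real.exp_pos t).le, Real.log_exp, Complex.ofReal_exp,
    Complex.ofReal_exp, ← Complex.exp_add, ← Complex.exp_add]
  congr 1
  push_cast
  ring

/-- By the recurrence, k^m · `logGamma k m` has zero derivative in k on the right half-plane. Its
value at k = 1 is Γ(m), which has no zeros. -/
theorem logGamma_ne_zero {k m : ℂ} (hk : 0 < k.re) (hm : 0 < m.re) : logGamma k m ≠ 0 := by
  have hopen : IsOpen {z : ℂ | 0 < z.re} := isOpen_lt continuous_const Complex.continuous_re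
  have hd (z : ℂ) (hz : 0 < z.re) : HasDerivAt (fun z => z ^ m * logGamma z m) 0 z := by
    have hz0 : z ≠ 0 := fun h => by simp [h] at hz
    have h1 := ((hasDerivAt_id z).cpow_const (c := m) (Or.inl hz)).mul (hasDerivAt_logGamma hz hm)
    refine h1.congr_deriv ?_
    have h2 := logGamma_recurrence hz hm
    rw [id, Complex.cpow_sub _ _ hz0, Complex.cpow_one]
    field_simp
    linear_combination -z ^ m * h2
  have hconst := hopen.is_const_of_deriv_eq_zero (f := fun z => z ^ m * logGamma z m)
    (convex_halfSpace_re_gt 0).isPreconnected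
    (fun z hz => (hd z hz).differentiableAt.differentiableWithinAt)
    (fun z hz => (hd z hz).deriv) hk (show (1 : ℂ) ∈ {z : ℂ | 0 < z.re} by simp)
  intro h0
  simp only [h0, mul_zero, Complex.one_cpow, one_mul, logGamma_one hm] at hconst
  refine Complex.Gamma_ne_zero (fun n hn => ?_) hconst.symm
  rw [hn] at hm
  simp at hm
  linarith [n.cast_nonneg (α := ℝ)]

/-! ### Asymptotics of the Macdonald function -/

/-- Translating t by log x absorbs the factor x^m and turns x cosh t into (eᵗ + x²e⁻ᵗ)/2. The
behaviour of K_m at 0 then follows by letting x → 0 under the integral. -/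
theorem cpow_mul_bKker (k m : ℂ) {x : ℝ} (hx : 0 < x) (t : ℝ) :
    (x : ℂ) ^ m * bKker k m x (t - Real.log x)
      = Complex.exp (-(k / 2 * (Real.exp t + x ^ 2 * Real.exp (-t))) + m * t) := by
  have h1 : (x : ℂ) * ((Real.cosh (t - Real.log x) : ℝ) : ℂ)
      = (Real.exp t + x ^ 2 * Real.exp (-t)) / 2 := by
    have : x * Real.cosh (t - Real.log x) = (Real.exp t + x ^ 2 * Real.exp (-t)) / 2 := by
      rw [Real.cosh_eq, neg_sub, Real.exp_sub, Real.exp_sub, Real.exp_log hx, Real.exp_neg]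
      have := Real.exp_pos t
      field_simp
    exact_mod_cast this
  rw [Complex.cpow_def_of_ne_zero (Complex.ofReal_ne_zero.2 hx.ne'), bKker, ← Complex.exp_add,
    ← Complex.ofReal_log hx.le, mul_assoc k, h1]
  congr 1
  push_cast
  ring

theorem cpow_mul_bK (k m : ℂ) {x : ℝ} (hx : 0 < x) :
    (x : ℂ) ^ m * bK k m x
      = ∫ t : ℝ, Complex.exp (-(k / 2 * (Real.exp t + x ^ 2 * Real.exp (-t))) + m * t) := by
  simp_rw [← cpow_mul_bKker k m hx]
  rw [integral_const_mul, integral_sub_right_eq_self (fun t => bKker k m x t)]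
  rfl

theorem norm_cpow_mul_bKker_le {k : ℂ} (hk : 0 < k.re) (m : ℂ) (x t : ℝ) :
    ‖Complex.exp (-(k / 2 * (Real.exp t + x ^ 2 * Real.exp (-t))) + m * t)‖
      ≤ Real.exp (-(k.re / 2) * Real.exp t + m.re * t) := by
  rw [Complex.norm_exp]
  refine Real.exp_le_exp.2 ?_
  have h : (k / 2 * (Real.exp t + x ^ 2 * Real.exp (-t))).re
      = k.re / 2 * (Real.exp t + x ^ 2 * Real.exp (-t)) := by
    rw [show ((Real.exp t : ℂ) + (x : ℂ) ^ 2 * (Real.exp (-t) : ℂ))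
      = ((Real.exp t + x ^ 2 * Real.exp (-t) : ℝ) : ℂ) by push_cast; ring, Complex.re_mul_ofReal]
    simp
  rw [Complex.add_re, Complex.neg_re, h, Complex.re_mul_ofReal]
  have : 0 ≤ k.re / 2 * (x ^ 2 * Real.exp (-t)) := by positivity
  linarith

theorem tendsto_cpow_mul_bK {k m : ℂ} (hk : 0 < k.re) (hm : 0 < m.re) :
    Tendsto (fun x : ℝ => (x : ℂ) ^ m * bK k m x) (𝓝[>] 0) (𝓝 (logGamma (k / 2) m)) := by
  have h : Tendsto (fun x : ℝ => ∫ t : ℝ, Complex.exp (-(k / 2 * (Real.exp t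
      + x ^ 2 * Real.exp (-t))) + m * t)) (𝓝[>] 0) (𝓝 (logGamma (k / 2) m)) := by
    refine tendsto_integral_filter_of_dominated_convergence
      (fun t => Real.exp (-(k.re / 2) * Real.exp t + m.re * t))
      (Eventually.of_forall fun x => by fun_prop)
      (Eventually.of_forall fun x => Eventually.of_forall fun t => norm_cpow_mul_bKker_le hk m x t)
      (integrable_exp_exp (by linarith) hm) (Eventually.of_forall fun t => ?_)
    have hc : Continuous fun x : ℝ => Complex.exp (-(k / 2 * (Real.exp t
      + x ^ 2 * Real.exp (-t))) + m * t) := by fun_prop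
    have := (hc.tendsto 0).mono_left (nhdsWithin_le_nhds (s := Ioi 0))
    simpa using this
  refine h.congr' ?_
  filter_upwards [self_mem_nhdsWithin] with x hx
  exact (cpow_mul_bK k m hx).symm

/-- All indices with |Re m| ≤ ν are compared with the real index ν: e^{t Re m} ≤ e^{νt} + e^{-νt},
and the two resulting integrals agree by t ↦ -t. -/
theorem norm_bK_le {k : ℂ} (hk : 0 < k.re) {ν : ℝ} (m : ℂ) (hm : |m.re| ≤ ν) {x : ℝ}
    (hx : 0 < x) : ‖bK k m x‖ ≤ 2 * ∫ t, Real.exp (-(k.re * x) * Real.cosh t + ν * t) := by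
  have hc : 0 < k.re * x := by positivity
  have i1 := integrable_exp_cosh hc ν
  have i2 := integrable_exp_cosh hc (-ν)
  have e : ∫ t, Real.exp (-(k.re * x) * Real.cosh t + -ν * t)
      = ∫ t, Real.exp (-(k.re * x) * Real.cosh t + ν * t) := by
    rw [← integral_neg_eq_self (fun t => Real.exp (-(k.re * x) * Real.cosh t + ν * t))]
    simp
  rw [two_mul]
  nth_rewrite 2 [← e]
  rw [← integral_add i1 i2]
  refine (norm_integral_le_integral_norm _).trans
    (integral_mono (integrable_bKker hk m hx).norm (i1.add i2) fun t => ?_)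
  simp only [norm_bKker]
  obtain ⟨h1, h2⟩ := abs_le.1 hm
  rcases le_total 0 t with ht | ht
  · refine le_add_of_le_of_nonneg (Real.exp_le_exp.2 ?_) (Real.exp_pos _).le
    nlinarith
  · refine le_add_of_nonneg_of_le (Real.exp_pos _).le (Real.exp_le_exp.2 ?_)
    nlinarith

/-- For x ≤ 1 the translated integral gives x^{-ν}, and e^{-x Re k} is bounded below. For x ≥ 1 the
Gaussian majorant gives e^{-x Re k} x^{-1/2}, whose power cancels √x. Uniformity over the strip |Re
m| ≤ ν is needed for the dependence on the index. -/
theorem exists_bound_bK {k : ℂ} (hk : 0 < k.re) {ν : ℝ} (hν : 0 < ν) :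
    ∃ C : ℝ, 0 ≤ C ∧ ∀ m : ℂ, |m.re| ≤ ν → ∀ x : ℝ, 0 < x →
      ‖(Real.sqrt x : ℂ) * bK k m x‖ ≤ C * (min x 1 ^ (1 / 2 - ν) * Real.exp (-k.re * x)) := by
  set J := ∫ t : ℝ, Real.exp (-(k.re / 2) * Real.exp t + ν * t) with hJ
  have hJ0 : 0 ≤ J := integral_nonneg fun t => (Real.exp_pos _).le
  refine ⟨max (2 * J * Real.exp k.re) (2 * (Real.exp (ν ^ 2 / k.re) * Real.sqrt (Real.pi / (k.re / 4)))),
    le_max_of_le_left (by positivity), fun m hm x hx => ?_⟩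
  have hb := norm_bK_le hk m hm hx
  rw [norm_mul, Complex.norm_real, Real.norm_of_nonneg (Real.sqrt_nonneg x)]
  rcases le_total x 1 with h1 | h1
  · have hKJ : ∫ t, Real.exp (-(k.re * x) * Real.cosh t + ν * t) ≤ x ^ (-ν) * J := by
      have e : ∫ t, Real.exp (-(k.re * x) * Real.cosh t + ν * t)
          = ∫ t, ‖bKker k ν x t‖ := by simp [norm_bKker]
      rw [e, ← integral_sub_right_eq_self (fun t => ‖bKker k ν x t‖) (Real.log x), hJ,
        ← integral_const_mul]
      refine integral_mono ?_ ((integrable_exp_exp (by linarith) hν).const_mul _) fun t => ?_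
      · exact (integrable_bKker hk ν hx).norm.comp_sub_right (Real.log x)
      · have h2 := norm_cpow_mul_bKker_le hk ν x t
        rw [← cpow_mul_bKker k ν hx t, norm_mul, norm_ofReal_cpow _ hx, Complex.ofReal_re] at h2
        have h3 : (0 : ℝ) < x ^ ν := Real.rpow_pos_of_pos hx ν
        simp only
        rw [Real.rpow_neg hx.le, ← div_eq_inv_mul, le_div_iff₀ h3, mul_comm]
        exact h2
    rw [min_eq_left h1]
    calc Real.sqrt x * ‖bK k m x‖ ≤ Real.sqrt x * (2 * (x ^ (-ν) * J)) := by gcongr; linarith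
      _ = 2 * J * x ^ (1 / 2 - ν) := by
        rw [Real.sqrt_eq_rpow, sub_eq_add_neg, Real.rpow_add hx]
        ring
      _ ≤ 2 * J * x ^ (1 / 2 - ν) * (Real.exp k.re * Real.exp (-k.re * x)) := by
        refine le_mul_of_one_le_right (by positivity) ?_
        rw [← Real.exp_add]
        refine Real.one_le_exp ?_
        nlinarith
      _ = (2 * J * Real.exp k.re) * (x ^ (1 / 2 - ν) * Real.exp (-k.re * x)) := by ring
      _ ≤ _ := by
        gcongr
        exact le_max_left _ _
  · have hc : 0 < k.re * x := by positivity
    have hK : ∫ t, Real.exp (-(k.re * x) * Real.cosh t + ν * t) ≤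
        Real.exp (-(k.re * x) + ν ^ 2 / (k.re * x)) * Real.sqrt (Real.pi / (k.re * x / 4)) := by
      rw [← integral_gaussian, ← integral_const_mul]
      exact integral_mono (integrable_exp_cosh hc ν)
        ((integrable_exp_neg_mul_sq (by positivity)).const_mul _) fun t => exp_cosh_le hc ν t
    have hsq : Real.sqrt x * Real.sqrt (Real.pi / (k.re * x / 4))
        = Real.sqrt (Real.pi / (k.re / 4)) := by
      rw [← Real.sqrt_mul hx.le]
      congr 1
      field_simp
    rw [min_eq_right h1, Real.one_rpow, one_mul]
    calc Real.sqrt x * ‖bK k m x‖ ≤ Real.sqrt x * (2 * (Real.exp (-(k.re * x) + ν ^ 2 / (k.re * x))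
          * Real.sqrt (Real.pi / (k.re * x / 4)))) := by gcongr; linarith
      _ = 2 * (Real.exp (ν ^ 2 / (k.re * x)) * Real.sqrt (Real.pi / (k.re / 4)))
          * Real.exp (-k.re * x) := by
        rw [← hsq, Real.exp_add, neg_mul]
        ring
      _ ≤ 2 * (Real.exp (ν ^ 2 / k.re) * Real.sqrt (Real.pi / (k.re / 4)))
          * Real.exp (-k.re * x) := by
        gcongr
        exact le_mul_of_one_le_right hk.le h1
      _ ≤ _ := by
        gcongr
        exact le_max_right _ _

/-! ### The power series of the modified Bessel function -/

/-- The coefficients `1 / (j! (m+1)_j)`. -/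
def bIcoef (m : ℂ) (j : ℕ) : ℂ := ((j.factorial : ℂ) * ∏ i ∈ Finset.range j, (m + 1 + i))⁻¹

/-- The power series `∑ wʲ / (j! (m+1)_j)`. -/
def bIser (m w : ℂ) : ℂ := ∑' j, bIcoef m j * w ^ j

theorem add_one_add_nat_ne_zero {m : ℂ} (hm : -1 < m.re) (i : ℕ) : m + 1 + i ≠ 0 := by
  intro h
  have := congrArg Complex.re h
  simp at this
  linarith [i.cast_nonneg (α := ℝ)]

theorem bIcoef_zero (m : ℂ) : bIcoef m 0 = 1 := by simp [bIcoef]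

theorem bIcoef_succ_mul {m : ℂ} (hm : -1 < m.re) (j : ℕ) :
    bIcoef m (j + 1) * (j + 1) = bIcoef (m + 1) j / (m + 1) := by
  have h0 : m + 1 ≠ 0 := by simpa using add_one_add_nat_ne_zero hm 0
  have h1 : ∏ i ∈ Finset.range (j + 1), (m + 1 + i)
      = (∏ i ∈ Finset.range j, (m + 1 + 1 + i)) * (m + 1) := by
    rw [Finset.prod_range_succ']
    simp only [Nat.cast_add, Nat.cast_one, Nat.cast_zero, add_zero]
    congr 1
    exact Finset.prod_congr rfl fun i _ => by ring
  have h2 : (j : ℂ) + 1 ≠ 0 := Nat.cast_add_one_ne_zero j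
  rw [bIcoef, bIcoef, h1, Nat.factorial_succ]
  push_cast
  rw [mul_inv, mul_inv, mul_inv, mul_inv]
  field_simp

theorem bIcoef_index_succ {m : ℂ} (hm : -1 < m.re) (j : ℕ) :
    (m + 1 + j) * bIcoef (m + 1) j = (m + 1) * bIcoef m j := by
  have h0 : m + 1 ≠ 0 := by simpa using add_one_add_nat_ne_zero hm 0
  have hp : ∏ i ∈ Finset.range j, (m + 1 + i) ≠ 0 :=
    Finset.prod_ne_zero_iff.2 fun i _ => add_one_add_nat_ne_zero hm i
  have hp' : ∏ i ∈ Finset.range j, (m + 1 + 1 + i) ≠ 0 :=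
    Finset.prod_ne_zero_iff.2 fun i _ => add_one_add_nat_ne_zero (by simp; linarith) i
  have h1 : (∏ i ∈ Finset.range j, (m + 1 + i)) * (m + 1 + j)
      = (∏ i ∈ Finset.range j, (m + 1 + 1 + i)) * (m + 1) := by
    rw [← Finset.prod_range_succ (fun i : ℕ => m + 1 + (i : ℂ)), Finset.prod_range_succ']
    simp only [Nat.cast_add, Nat.cast_one, Nat.cast_zero, add_zero]
    congr 1
    exact Finset.prod_congr rfl fun i _ => by ring
  have hf : (j.factorial : ℂ) ≠ 0 := Nat.cast_ne_zero.2 j.factorial_ne_zero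
  rw [bIcoef, bIcoef]
  field_simp
  linear_combination h1

/-- Every factor m + 1 + i has real part at least δ. The series is thus dominated by an exponential
series uniformly on Re m ≥ δ - 1, which also controls its derivatives and its dependence on m. -/
theorem norm_bIcoef_le {δ : ℝ} (hδ : 0 < δ) {m : ℂ} (hm : δ ≤ m.re + 1)
    (j : ℕ) : ‖bIcoef m j‖ ≤ (1 / δ) ^ j / j.factorial := by
  have hp : δ ^ j ≤ ‖∏ i ∈ Finset.range j, (m + 1 + i)‖ := by
    rw [norm_prod, ← Finset.card_range j, ← Finset.prod_const, Finset.card_range]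
    refine Finset.prod_le_prod (fun _ _ => hδ.le) fun i _ => ?_
    refine le_trans ?_ (Complex.re_le_norm _)
    simp only [Complex.add_re, Complex.one_re, Complex.natCast_re]
    linarith [i.cast_nonneg (α := ℝ)]
  have hf : (0 : ℝ) < j.factorial := by exact_mod_cast j.factorial_pos
  have hd : 0 < δ ^ j := by positivity
  rw [bIcoef, norm_inv, norm_mul, Complex.norm_natCast, one_div, inv_pow, ← one_div, ← one_div,
    div_div]
  rw [mul_comm (δ ^ j)]
  gcongr

theorem norm_bIcoef_mul_le {δ : ℝ} (hδ : 0 < δ) {m : ℂ} (hm : δ ≤ m.re + 1)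
    (w : ℂ) (j : ℕ) : ‖bIcoef m j * w ^ j‖ ≤ (‖w‖ / δ) ^ j / j.factorial := by
  rw [norm_mul, norm_pow]
  calc _ ≤ (1 / δ) ^ j / j.factorial * ‖w‖ ^ j := by
        gcongr
        exact norm_bIcoef_le hδ hm j
    _ = _ := by rw [div_pow, div_pow]; ring

theorem summable_bIser {δ : ℝ} (hδ : 0 < δ) {m : ℂ} (hm : δ ≤ m.re + 1)
    (w : ℂ) : Summable fun j => bIcoef m j * w ^ j :=
  Summable.of_norm_bounded (Real.summable_pow_div_factorial _) (norm_bIcoef_mul_le hδ hm w)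

theorem norm_bIser_le {δ : ℝ} (hδ : 0 < δ) {m : ℂ} (hm : δ ≤ m.re + 1)
    (w : ℂ) : ‖bIser m w‖ ≤ Real.exp (‖w‖ / δ) := by
  refine tsum_of_norm_bounded ?_ (norm_bIcoef_mul_le hδ hm w)
  rw [Real.exp_eq_exp_ℝ]
  exact NormedSpace.expSeries_div_hasSum_exp _

/-- The left series is w d/dw applied termwise; differentiating the series raises the index by one.
-/
theorem bIser_shift {δ : ℝ} (hδ : 0 < δ) {m : ℂ} (hm : δ ≤ m.re + 1) (w : ℂ) :
    HasSum (fun j : ℕ => bIcoef m j * j * w ^ j) (w * (bIser (m + 1) w / (m + 1))) := by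
  have hm1 : -1 < m.re := by linarith
  have h : HasSum (fun j : ℕ => bIcoef m (j + 1) * ((j + 1 : ℕ) : ℂ) * w ^ (j + 1))
      (w * (bIser (m + 1) w / (m + 1))) := by
    have h1 := ((summable_bIser hδ (m := m + 1) (by simp; linarith) w).hasSum.div_const
      (m + 1)).mul_left w
    have e : (fun j : ℕ => bIcoef m (j + 1) * ((j + 1 : ℕ) : ℂ) * w ^ (j + 1))
        = fun j : ℕ => w * (bIcoef (m + 1) j * w ^ j / (m + 1)) := by
      ext j
      push_cast
      rw [bIcoef_succ_mul hm1]
      ring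
    rw [e]
    exact h1
  have h2 := (hasSum_nat_add_iff (f := fun j : ℕ => bIcoef m j * j * w ^ j) 1).1 h
  simpa using h2

theorem norm_bIser_sub_one_le {δ : ℝ} (hδ : 0 < δ) {m : ℂ} (hm : δ ≤ m.re + 1)
    (w : ℂ) : ‖bIser m w - 1‖ ≤ ‖w‖ / δ * Real.exp (‖w‖ / δ) := by
  have h1 : bIser m w - 1 = ∑' j, bIcoef m (j + 1) * w ^ (j + 1) := by
    rw [bIser, (summable_bIser hδ hm w).tsum_eq_zero_add, bIcoef_zero]
    simp
  rw [h1]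
  have hs : HasSum (fun j : ℕ => ‖w‖ / δ * ((‖w‖ / δ) ^ j / j.factorial))
      (‖w‖ / δ * Real.exp (‖w‖ / δ)) := by
    rw [Real.exp_eq_exp_ℝ]
    exact (NormedSpace.expSeries_div_hasSum_exp (‖w‖ / δ)).mul_left (‖w‖ / δ)
  refine tsum_of_norm_bounded hs fun j => (norm_bIcoef_mul_le hδ hm w (j + 1)).trans ?_
  rw [pow_succ', mul_div_assoc]
  gcongr
  exact j.le_succ

theorem hasDerivAt_bIser {δ : ℝ} (hδ : 0 < δ) {m : ℂ} (hm : δ ≤ m.re + 1)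
    (w : ℂ) : HasDerivAt (bIser m) (bIser (m + 1) w / (m + 1)) w := by
  have hm1 : -1 < m.re := by linarith
  set r := ‖w‖ + 1 with hr
  have hr0 : 0 < r := by positivity
  -- Termwise differentiation is dominated on the ball of radius ‖w‖ + 1 by the differentiated
  -- exponential series.
  have hu : Summable fun j : ℕ => (1 / δ) ^ j / j.factorial * (j * r ^ (j - 1)) := by
    rw [← summable_nat_add_iff 1]
    refine ((Real.summable_pow_div_factorial (r / δ)).mul_left (1 / δ)).congr fun j => ?_
    rw [Nat.factorial_succ, Nat.add_sub_cancel]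
    have : (j.factorial : ℝ) ≠ 0 := by exact_mod_cast j.factorial_ne_zero
    have : (j : ℝ) + 1 ≠ 0 := by positivity
    push_cast
    rw [div_pow, div_pow, pow_succ, one_pow]
    field_simp
    ring
  have key := hasDerivAt_tsum_of_isPreconnected (𝕜 := ℂ) (g := fun j w => bIcoef m j * w ^ j)
    (g' := fun j w => bIcoef m j * (j * w ^ (j - 1))) (t := Metric.ball 0 r) (y₀ := 0) (y := w)
    hu Metric.isOpen_ball (convex_ball 0 r).isPreconnected
    (fun j y _ => (hasDerivAt_pow j y).const_mul _)
    (fun j y hy => by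
      rw [norm_mul, norm_mul, norm_pow, Complex.norm_natCast]
      have h1 := norm_bIcoef_le hδ hm j
      have h2 : ‖y‖ ≤ r := (mem_ball_zero_iff.1 hy).le
      gcongr)
    (Metric.mem_ball_self hr0) (summable_bIser hδ hm 0)
    (by rw [mem_ball_zero_iff]; linarith)
  refine key.congr_deriv ?_
  have hs : Summable fun j : ℕ => bIcoef m j * (j * w ^ (j - 1)) :=
    Summable.of_norm_bounded hu fun j => by
      rw [norm_mul, norm_mul, norm_pow, Complex.norm_natCast]
      have h1 := norm_bIcoef_le hδ hm j
      have h2 : ‖w‖ ≤ r := by linarith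
      gcongr
  rw [hs.tsum_eq_zero_add, bIser, ← tsum_div_const]
  simp only [Nat.cast_zero, zero_mul, mul_zero, zero_add, Nat.add_sub_cancel]
  refine tsum_congr fun j => ?_
  push_cast
  rw [← mul_assoc, bIcoef_succ_mul hm1]
  ring

/-- The identity (m+1+j) c_j(m+1) = (m+1) c_j(m) between coefficients, multiplied by wʲ and summed;
the factor j is supplied by `bIser_shift`. -/
theorem bIser_recurrence {δ : ℝ} (hδ : 0 < δ) {m : ℂ} (hm : δ ≤ m.re + 1)
    (w : ℂ) : (m + 1) * bIser (m + 1) w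
    + w * (bIser (m + 1 + 1) w / (m + 1 + 1)) = (m + 1) * bIser m w := by
  have hm1 : -1 < m.re := by linarith
  have hm2 : δ ≤ (m + 1).re + 1 := by simp; linarith
  have h1 := ((summable_bIser hδ hm2 w).hasSum.mul_left (m + 1)).add (bIser_shift hδ hm2 w)
  have h2 := (summable_bIser hδ hm w).hasSum.mul_left (m + 1)
  refine h1.unique ?_
  refine HasSum.congr_fun h2 fun j => ?_
  have := bIcoef_index_succ hm1 j
  linear_combination w ^ j * this

theorem differentiableOn_bIser_index (w : ℂ) :
    DifferentiableOn ℂ (fun m => bIser m w) {m : ℂ | -1 < m.re} := by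
  intro m hm
  have hm' : -1 < m.re := hm
  -- Half the distance to the line Re m = -1, so that the majorant is uniform on a neighbourhood of
  -- m.
  set δ := (m.re + 1) / 2 with hδ
  have hδ0 : 0 < δ := by linarith
  have hopen : IsOpen {n : ℂ | δ - 1 < n.re} := isOpen_lt continuous_const Complex.continuous_re
  have h := Complex.differentiableOn_tsum_of_summable_norm (F := fun j n => bIcoef n j * w ^ j)
    (Real.summable_pow_div_factorial (‖w‖ / δ)) (fun j => ?_) hopen
    (fun j n hn => norm_bIcoef_mul_le hδ0 (by linarith [show δ - 1 < n.re from hn]) w j)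
  · exact ((h m (show δ - 1 < m.re by linarith)).differentiableAt
      (hopen.mem_nhds (show δ - 1 < m.re by linarith))).differentiableWithinAt
  · refine DifferentiableOn.mul_const (DifferentiableOn.inv ?_ fun n hn => ?_) _
    · refine Differentiable.differentiableOn (Differentiable.const_mul ?_ _)
      exact Differentiable.fun_finsetProd fun i _ => by fun_prop
    · refine mul_ne_zero (Nat.cast_ne_zero.2 j.factorial_ne_zero)
        (Finset.prod_ne_zero_iff.2 fun i _ => add_one_add_nat_ne_zero ?_ i)
      linarith [show δ - 1 < n.re from hn]

/-! ### Second order equations -/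

/-- The potential of the equation `u'' = q u` solved by the Bessel functions below. -/
def bPot (k m : ℂ) (x : ℝ) : ℂ := (m ^ 2 - 1 / 4) / (x : ℂ) ^ 2 + k ^ 2

theorem contDiffOn_bPot (k m : ℂ) : ContDiffOn ℝ ∞ (bPot k m) (Ioi 0) := by
  unfold bPot
  simp only [div_eq_mul_inv]
  refine (contDiffOn_const.mul ((Complex.ofRealCLM.contDiff.contDiffOn.pow 2).inv
    fun x hx => ?_)).add contDiffOn_const
  exact pow_ne_zero 2 (Complex.ofReal_ne_zero.2 (ne_of_gt hx))

/-- `u` solves `u'' = q u + h` on the half-line, with first derivative `u₁`. -/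
structure SolvesODE (q h u u₁ : ℝ → ℂ) : Prop where
  hasDerivAt : ∀ x, 0 < x → HasDerivAt u (u₁ x) x
  hasDerivAt' : ∀ x, 0 < x → HasDerivAt u₁ (q x * u x + h x) x

theorem SolvesODE.contDiffOn {q h u u₁ : ℝ → ℂ} (H : SolvesODE q h u u₁)
    (hq : ContDiffOn ℝ ∞ q (Ioi 0)) (hh : ContDiffOn ℝ ∞ h (Ioi 0)) :
    ContDiffOn ℝ ∞ u (Ioi 0) := by
  have key (n : ℕ) : ContDiffOn ℝ n u (Ioi 0) ∧ ContDiffOn ℝ n u₁ (Ioi 0) := by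
    induction n with
    | zero =>
      simp only [Nat.cast_zero, contDiffOn_zero]
      exact ⟨fun x hx => (H.hasDerivAt x hx).continuousAt.continuousWithinAt,
        fun x hx => (H.hasDerivAt' x hx).continuousAt.continuousWithinAt⟩
    | succ n ih =>
      push_cast
      rw [contDiffOn_succ_iff_deriv_of_isOpen isOpen_Ioi,
        contDiffOn_succ_iff_deriv_of_isOpen isOpen_Ioi]
      refine ⟨⟨fun x hx => (H.hasDerivAt x hx).differentiableAt.differentiableWithinAt, by simp,
        ih.2.congr fun x hx => (H.hasDerivAt x hx).deriv⟩,
        fun x hx => (H.hasDerivAt' x hx).differentiableAt.differentiableWithinAt, by simp, ?_⟩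
      have h1 : ContDiffOn ℝ n (fun x => q x * u x + h x) (Ioi 0) :=
        ((hq.of_le (by exact_mod_cast le_top)).mul ih.1).add (hh.of_le (by exact_mod_cast le_top))
      exact h1.congr fun x hx => (H.hasDerivAt' x hx).deriv
  exact contDiffOn_infty.2 fun n => (key n).1

theorem SolvesODE.expr_eq {k m : ℂ} {h u u₁ : ℝ → ℂ} (H : SolvesODE (bPot k m) h u u₁) {x : ℝ}
    (hx : 0 < x) : expr (m ^ 2) u x = -(k ^ 2 * u x) - h x := by
  rw [expr_eq_of_hasDerivAt (m ^ 2) (f' := u₁) ?_ (H.hasDerivAt' x hx), bPot]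
  · ring
  · filter_upwards [Ioi_mem_nhds hx] with y hy using H.hasDerivAt y hy

/-- A first order system for a pair of Bessel functions with neighbouring indices. -/
structure BesselPair (m a b : ℂ) (u v : ℝ → ℂ) : Prop where
  left : ∀ x, 0 < x → HasDerivAt u ((1 / 2 + m) / x * u x + a * v x) x
  right : ∀ x, 0 < x → HasDerivAt v (-((1 / 2 + m) / x * v x) + b * u x) x

theorem hasDerivAt_const_div (c : ℂ) {x : ℝ} (hx : 0 < x) :
    HasDerivAt (fun y : ℝ => c / (y : ℂ)) (-c / (x : ℂ) ^ 2) x := by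
  have h0 : (x : ℂ) ≠ 0 := Complex.ofReal_ne_zero.2 hx.ne'
  have := (((hasDerivAt_id (x : ℂ)).inv h0).const_mul c).comp_ofReal
  refine (this.congr_deriv ?_).congr_of_eventuallyEq (Eventually.of_forall fun y => ?_)
  · simp only [id]; ring
  · simp [div_eq_mul_inv]

theorem BesselPair.solvesODE {k m a b : ℂ} {u v : ℝ → ℂ} (h : BesselPair m a b u v)
    (hab : a * b = k ^ 2) :
    SolvesODE (bPot k m) 0 u fun x => (1 / 2 + m) / x * u x + a * v x := by
  refine ⟨h.left, fun x hx => ?_⟩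
  have h0 : (x : ℂ) ≠ 0 := Complex.ofReal_ne_zero.2 hx.ne'
  have h1 := ((hasDerivAt_const_div (1 / 2 + m) hx).mul (h.left x hx)).add
    ((h.right x hx).const_mul a)
  refine h1.congr_deriv ?_
  rw [bPot, ← hab, Pi.zero_apply]
  field_simp
  ring

/-- This is the Wronskian of u and u': the terms (1/2+m)/x cancel. By the system its derivative is
(c² - ab) u u' = 0. -/
theorem BesselPair.wronskian_const {m a b c : ℂ} {u v u' v' : ℝ → ℂ} (h : BesselPair m a b u v)
    (h' : BesselPair m c c u' v') (hab : a * b = c ^ 2) {x y : ℝ} (hx : 0 < x) (hy : 0 < y) :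
    c * u x * v' x - a * v x * u' x = c * u y * v' y - a * v y * u' y := by
  have hd (x : ℝ) (hx : 0 < x) : HasDerivAt (fun x => c * u x * v' x - a * v x * u' x) 0 x := by
    refine ((((h.left x hx).const_mul c).mul (h'.right x hx)).sub
      (((h.right x hx).const_mul a).mul (h'.left x hx))).congr_deriv ?_
    linear_combination -u x * u' x * hab
  exact isOpen_Ioi.is_const_of_deriv_eq_zero (f := fun x => c * u x * v' x - a * v x * u' x)
    isPreconnected_Ioi
    (fun z hz => (hd z hz).differentiableAt.differentiableWithinAt)
    (fun z hz => (hd z hz).deriv) hx hy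

/-! ### The two solutions of the Bessel equation -/

/-- The solution that behaves like `x^{1/2+m}` at `0`. -/
def phi (k m : ℂ) (x : ℝ) : ℂ := (x : ℂ) ^ (1 / 2 + m) * bIser m (k ^ 2 / 4 * (x : ℂ) ^ 2)

/-- The solution that decays at infinity. -/
def psi (k m : ℂ) (x : ℝ) : ℂ := (Real.sqrt x : ℂ) * bK k m x

theorem phi_succ (k m : ℂ) {x : ℝ} (hx : 0 < x) :
    phi k (m + 1) x = x * ((x : ℂ) ^ (1 / 2 + m) * bIser (m + 1) (k ^ 2 / 4 * (x : ℂ) ^ 2)) := by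
  have h0 : (x : ℂ) ≠ 0 := Complex.ofReal_ne_zero.2 hx.ne'
  rw [phi, ← add_assoc, Complex.cpow_add _ _ h0, Complex.cpow_one]
  ring

theorem hasDerivAt_phi (k : ℂ) {m : ℂ} (hm : -1 < m.re) {x : ℝ} (hx : 0 < x) :
    HasDerivAt (phi k m) ((1 / 2 + m) / x * phi k m x + k ^ 2 / (2 * (m + 1)) * phi k (m + 1) x) x := by
  have h0 : (x : ℂ) ≠ 0 := Complex.ofReal_ne_zero.2 hx.ne'
  have hm0 : m + 1 ≠ 0 := by simpa using add_one_add_nat_ne_zero hm 0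
  have h1 : HasDerivAt (fun y : ℂ => k ^ 2 / 4 * y ^ 2) (k ^ 2 / 4 * (2 * x)) (x : ℂ) := by
    simpa using (hasDerivAt_pow 2 (x : ℂ)).const_mul (k ^ 2 / 4)
  have h2 := (HasDerivAt.comp (h₂ := bIser m) (h := fun y : ℂ => k ^ 2 / 4 * y ^ 2) (x : ℂ)
    (hasDerivAt_bIser (δ := m.re + 1) (by linarith) le_rfl (k ^ 2 / 4 * (x : ℂ) ^ 2)) h1).comp_ofReal
  refine ((hasDerivAt_ofReal_cpow (1 / 2 + m) hx).mul h2).congr_deriv ?_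
  rw [phi_succ k m hx, phi, Function.comp_apply]
  generalize (x : ℂ) ^ (1 / 2 + m) = P
  field_simp
  ring

/-- The unsymmetric coefficients reflect the normalization of the power series to 1 at the origin;
only their product k² enters the second order equation. -/
theorem besselPair_phi (k : ℂ) {m : ℂ} (hm : -1 < m.re) :
    BesselPair m (k ^ 2 / (2 * (m + 1))) (2 * (m + 1)) (phi k m) (phi k (m + 1)) := by
  refine ⟨fun x hx => hasDerivAt_phi k hm hx, fun x hx => ?_⟩
  have h0 : (x : ℂ) ≠ 0 := Complex.ofReal_ne_zero.2 hx.ne'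
  have hm1 : -1 < (m + 1).re := by simp; linarith
  have hm0 : m + 1 + 1 ≠ 0 := by simpa using add_one_add_nat_ne_zero hm1 0
  refine (hasDerivAt_phi k hm1 hx).congr_deriv ?_
  have h := bIser_recurrence (δ := m.re + 1) (by linarith) le_rfl (k ^ 2 / 4 * (x : ℂ) ^ 2)
  have e1 : phi k (m + 1 + 1) x
      = x ^ 2 * ((x : ℂ) ^ (1 / 2 + m) * bIser (m + 1 + 1) (k ^ 2 / 4 * (x : ℂ) ^ 2)) := by
    rw [phi_succ k (m + 1) hx, ← add_assoc, Complex.cpow_add _ _ h0, Complex.cpow_one]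
    ring
  rw [e1, phi_succ k m hx, phi]
  generalize (x : ℂ) ^ (1 / 2 + m) = P at *
  generalize bIser m (k ^ 2 / 4 * (x : ℂ) ^ 2) = b₀ at *
  generalize bIser (m + 1) (k ^ 2 / 4 * (x : ℂ) ^ 2) = b₁ at *
  generalize bIser (m + 1 + 1) (k ^ 2 / 4 * (x : ℂ) ^ 2) = b₂ at *
  field_simp at h ⊢
  linear_combination P * h

theorem hasDerivAt_sqrt_mul {x : ℝ} (hx : 0 < x) {f : ℝ → ℂ} {f' : ℂ} (hf : HasDerivAt f f' x) :
    HasDerivAt (fun y : ℝ => (Real.sqrt y : ℂ) * f y)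
      (1 / 2 / x * (Real.sqrt x * f x) + Real.sqrt x * f') x := by
  refine ((Real.hasDerivAt_sqrt hx.ne').ofReal_comp.mul hf).congr_deriv ?_
  congr 1
  have h0 : (x : ℂ) ≠ 0 := Complex.ofReal_ne_zero.2 hx.ne'
  have h1 : (Real.sqrt x : ℂ) ≠ 0 := Complex.ofReal_ne_zero.2 (Real.sqrt_pos.2 hx).ne'
  have h2 : (Real.sqrt x : ℂ) ^ 2 = x := by exact_mod_cast Real.sq_sqrt hx.le
  push_cast
  field_simp
  rw [h2]
  ring

theorem besselPair_psi {k : ℂ} (hk : 0 < k.re)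
    (m : ℂ) : BesselPair m (-k) (-k) (psi k m) (psi k (m + 1)) := by
  refine ⟨fun x hx => ?_, fun x hx => ?_⟩
  · refine (hasDerivAt_sqrt_mul hx (hasDerivAt_bK hk m hx)).congr_deriv ?_
    rw [psi, psi]
    ring
  · refine (hasDerivAt_sqrt_mul hx (hasDerivAt_bK_succ hk m hx)).congr_deriv ?_
    rw [psi, psi]
    ring

/-- The Wronskian of `phi` and `psi`. -/
def wronsk (k m : ℂ) : ℂ := -k * phi k m 1 * psi k (m + 1) 1
  - k ^ 2 / (2 * (m + 1)) * phi k (m + 1) 1 * psi k m 1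

theorem tendsto_bIser (k : ℂ) {m : ℂ} (hm : -1 < m.re) :
    Tendsto (fun x : ℝ => bIser m (k ^ 2 / 4 * (x : ℂ) ^ 2)) (𝓝[>] 0) (𝓝 1) := by
  have hc : ContinuousAt (bIser m) (k ^ 2 / 4 * ((0 : ℝ) : ℂ) ^ 2) :=
    (hasDerivAt_bIser (δ := m.re + 1) (by linarith) le_rfl _).continuousAt
  have h1 : ContinuousAt (fun x : ℝ => k ^ 2 / 4 * (x : ℂ) ^ 2) 0 := by fun_prop
  have h := (ContinuousAt.comp (g := bIser m)
    (f := fun x : ℝ => k ^ 2 / 4 * (x : ℂ) ^ 2) (x := (0 : ℝ)) hc h1).tendsto.mono_left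
    (nhdsWithin_le_nhds (s := Ioi 0))
  have h2 : bIser m (k ^ 2 / 4 * ((0 : ℝ) : ℂ) ^ 2) = 1 := by
    have h3 := norm_bIser_sub_one_le (δ := m.re + 1) (m := m) (by linarith) le_rfl
      (k ^ 2 / 4 * ((0 : ℝ) : ℂ) ^ 2)
    simp only [Complex.ofReal_zero, ne_eq, OfNat.ofNat_ne_zero, not_false_eq_true, zero_pow,
      mul_zero, norm_zero, zero_div, Real.exp_zero, mul_one] at h3 ⊢
    exact sub_eq_zero.1 (norm_le_zero_iff.1 h3)
  simpa only [Function.comp_def, h2] using h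

theorem wronsk_eq_at {k : ℂ} (hk : 0 < k.re) {m : ℂ} (hm : -1 < m.re) {x : ℝ} (hx : 0 < x) :
    wronsk k m = -k * phi k m x * psi k (m + 1) x
      - k ^ 2 / (2 * (m + 1)) * phi k (m + 1) x * psi k m x := by
  have hm0 : m + 1 ≠ 0 := by simpa using add_one_add_nat_ne_zero hm 0
  exact (besselPair_phi k hm).wronskian_const (besselPair_psi hk m) (by field_simp) one_pos hx

/-- The Wronskian is evaluated in the limit x → 0. There φ_m ψ_{m+1} behaves like x^{1/2+m} √x
K_{m+1} and has a finite limit, while φ_{m+1} ψ_m tends to 0. -/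
theorem wronsk_eq {k : ℂ} (hk : 0 < k.re)
    {m : ℂ} (hm : -1 < m.re) : wronsk k m = -k * logGamma (k / 2) (m + 1) := by
  have hm1 : 0 < (m + 1).re := by simp; linarith
  have t1 : Tendsto (fun x : ℝ => phi k m x * psi k (m + 1) x) (𝓝[>] 0)
      (𝓝 (1 * logGamma (k / 2) (m + 1))) := by
    refine ((tendsto_bIser k hm).mul (tendsto_cpow_mul_bK hk hm1)).congr' ?_
    filter_upwards [self_mem_nhdsWithin] with x hx
    have hx' : (0 : ℝ) < x := hx
    have h0 : (x : ℂ) ≠ 0 := Complex.ofReal_ne_zero.2 hx'.ne'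
    have e : (x : ℂ) ^ (m + 1) = (x : ℂ) ^ (1 / 2 + m) * (Real.sqrt x : ℂ) := by
      rw [Real.sqrt_eq_rpow, Complex.ofReal_cpow hx'.le, ← Complex.cpow_add _ _ h0]
      congr 1
      push_cast
      ring
    rw [phi, psi, e]
    ring
  have t2 : Tendsto (fun x : ℝ => phi k (m + 1) x * psi k m x) (𝓝[>] 0) (𝓝 0) := by
    -- φ_{m+1} is of order x^{3/2 + Re m} and ψ_m is O(x^{1/2-ν}), so the product has exponent 2 +
    -- Re m - ν. This is positive for Re m > -1, and the maximum with 1 keeps ν > 0 when Re m = 0.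
    set ν := max |m.re| 1 with hν
    have hν0 : 0 < ν := lt_max_of_lt_right one_pos
    have hν2 : 0 < 2 + m.re - ν := by
      rcases max_cases |m.re| 1 with ⟨h, -⟩ | ⟨h, -⟩ <;> rw [hν, h]
      · rcases abs_cases m.re with ⟨h, -⟩ | ⟨h, -⟩ <;> rw [h] <;> linarith
      · linarith
    obtain ⟨C, hC0, hC⟩ := exists_bound_bK hk hν0
    have hb := (tendsto_bIser k (m := m + 1) (by linarith)).norm
    rw [norm_one] at hb
    have hlim : Tendsto (fun x : ℝ => ‖bIser (m + 1) (k ^ 2 / 4 * (x : ℂ) ^ 2)‖ * C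
        * x ^ (2 + m.re - ν)) (𝓝[>] 0) (𝓝 0) := by
      have h1 : Tendsto (fun x : ℝ => x ^ (2 + m.re - ν)) (𝓝[>] 0) (𝓝 0) := by
        have := (Real.continuousAt_rpow_const 0 (2 + m.re - ν) (Or.inr hν2.le)).tendsto.mono_left
          (nhdsWithin_le_nhds (s := Ioi 0))
        rwa [Real.zero_rpow hν2.ne'] at this
      simpa using (hb.mul_const C).mul h1
    refine squeeze_zero_norm' ?_ hlim
    filter_upwards [Ioc_mem_nhdsGT (zero_lt_one' ℝ)] with x hx
    have h1 := hC m (le_max_left _ _) x hx.1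
    have h2 : Real.exp (-k.re * x) ≤ 1 := Real.exp_le_one_iff.2 (by nlinarith [hx.1])
    rw [min_eq_left hx.2] at h1
    rw [norm_mul, phi, psi, norm_mul, norm_ofReal_cpow _ hx.1]
    have hx0 := hx.1
    calc _ ≤ x ^ (1 / 2 + (m + 1)).re * ‖bIser (m + 1) (k ^ 2 / 4 * (x : ℂ) ^ 2)‖
          * (C * (x ^ (1 / 2 - ν) * 1)) := by
          refine mul_le_mul_of_nonneg_left (h1.trans ?_) (by positivity)
          gcongr
      _ = ‖bIser (m + 1) (k ^ 2 / 4 * (x : ℂ) ^ 2)‖ * C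
          * (x ^ (1 / 2 + (m + 1)).re * x ^ (1 / 2 - ν)) := by ring
      _ = _ := by
        rw [← Real.rpow_add hx.1]
        congr 2
        simp
        ring
  have t3 := (t1.const_mul (-k)).sub (t2.const_mul (k ^ 2 / (2 * (m + 1))))
  have t4 : Tendsto (fun _ : ℝ => wronsk k m) (𝓝[>] 0) (𝓝 (-k * logGamma (k / 2) (m + 1))) := by
    have : -k * logGamma (k / 2) (m + 1) = -k * (1 * logGamma (k / 2) (m + 1))
        - k ^ 2 / (2 * (m + 1)) * 0 := by ring
    rw [this]
    refine t3.congr' ?_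
    filter_upwards [self_mem_nhdsWithin] with x hx
    rw [wronsk_eq_at hk hm hx]
    ring
  exact tendsto_nhds_unique tendsto_const_nhds t4

theorem wronsk_ne_zero {k : ℂ} (hk : 0 < k.re) {m : ℂ} (hm : -1 < m.re) : wronsk k m ≠ 0 := by
  rw [wronsk_eq hk hm]
  refine mul_ne_zero (neg_ne_zero.2 fun h => by simp [h] at hk)
    (logGamma_ne_zero (by simpa using hk) (by simp; linarith))

/-! ### Growth at infinity -/

/-- With p, q = e^{-kx}(u' ± ku) the equation becomes p' = V, q' = -2kq + V, where V is the x⁻² part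
of the potential times e^{-kx}u = (p - q)/(2k). As Re k > 0, the term -2kq is dissipative. The
energy E = |p|² + |q|² satisfies E' ≤ (A/x²)E, so E·e^{A/x} decreases on [1,∞[, and E stays bounded
because x⁻² is integrable at infinity. Hence u = O(e^{x Re k}) with explicit constants. -/
theorem growth_of_solvesODE {k : ℂ} (hk : 0 < k.re)
    {m : ℂ} {u u₁ : ℝ → ℂ} (h : SolvesODE (bPot k m) 0 u u₁) {x : ℝ}
    (hx : 1 ≤ x) : ‖u x‖ ≤ 2 * Real.exp (‖m ^ 2 - 1 / 4‖ / ‖k‖) / ‖k‖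
      * (‖u₁ 1‖ + ‖k‖ * ‖u 1‖) * Real.exp (k.re * x) := by
  have hk0 : k ≠ 0 := fun h => by simp [h] at hk
  have hkn : 0 < ‖k‖ := norm_pos_iff.2 hk0
  set A : ℝ := 2 * (‖m ^ 2 - 1 / 4‖ / ‖k‖) with hA
  set p : ℝ → ℂ := fun x => Complex.exp (-k * x) * (u₁ x + k * u x) with hp
  set q : ℝ → ℂ := fun x => Complex.exp (-k * x) * (u₁ x - k * u x) with hq
  set V : ℝ → ℂ := fun x => (m ^ 2 - 1 / 4) / (x : ℂ) ^ 2 * ((p x - q x) / (2 * k)) with hV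
  have hpq (x : ℝ) : (p x - q x) / (2 * k) = Complex.exp (-k * x) * u x := by
    simp only [hp, hq]
    field_simp
    ring
  have hexp (x : ℝ) : HasDerivAt (fun x : ℝ => Complex.exp (-k * x)) (Complex.exp (-k * x) * -k) x := by
    have := (((hasDerivAt_id (x : ℂ)).const_mul (-k)).cexp).comp_ofReal
    simpa using this
  have hp' (x : ℝ) (hx : 0 < x) : HasDerivAt p (V x) x := by
    refine ((hexp x).mul ((h.hasDerivAt' x hx).add ((h.hasDerivAt x hx).const_mul k))).congr_deriv ?_
    simp only [hV, hpq, bPot, Pi.zero_apply, Pi.add_apply]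
    ring
  have hq' (x : ℝ) (hx : 0 < x) : HasDerivAt q (-(2 * k * q x) + V x) x := by
    refine ((hexp x).mul ((h.hasDerivAt' x hx).sub ((h.hasDerivAt x hx).const_mul k))).congr_deriv ?_
    simp only [hV, hpq, bPot, Pi.zero_apply, Pi.sub_apply]
    simp only [hq]
    ring
  set E : ℝ → ℝ := fun x => ‖p x‖ ^ 2 + ‖q x‖ ^ 2 with hE
  have hE' (x : ℝ) (hx : 0 < x) : HasDerivAt (fun x => E x * Real.exp (A / x))
      ((2 * inner ℝ (p x) (V x) + 2 * inner ℝ (q x) (-(2 * k * q x) + V x)) * Real.exp (A / x)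
        + E x * (Real.exp (A / x) * (-A / x ^ 2))) x := by
    have h1 : HasDerivAt (fun y : ℝ => A / y) (-A / x ^ 2) x := by
      have := (hasDerivAt_inv hx.ne').const_mul A
      simpa [div_eq_mul_inv] using this
    exact ((hp' x hx).norm_sq.add (hq' x hx).norm_sq).mul h1.exp
  have hVn (x : ℝ) (hx : 0 < x) : ‖V x‖ ≤ A / (4 * x ^ 2) * (‖p x‖ + ‖q x‖) := by
    rw [hV]
    simp only
    rw [norm_mul, norm_div, norm_div, norm_pow, norm_mul, Complex.norm_real,
      Real.norm_of_nonneg hx.le, RCLike.norm_ofNat, hA]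
    calc _ ≤ ‖m ^ 2 - 1 / 4‖ / x ^ 2 * ((‖p x‖ + ‖q x‖) / (2 * ‖k‖)) := by
          gcongr
          exact norm_sub_le _ _
      _ = _ := by
        field_simp
        norm_num
  have hdec (x : ℝ) (hx : 0 < x) :
      (2 * inner ℝ (p x) (V x) + 2 * inner ℝ (q x) (-(2 * k * q x) + V x)) * Real.exp (A / x)
        + E x * (Real.exp (A / x) * (-A / x ^ 2)) ≤ 0 := by
    have i1 : inner ℝ (p x) (V x) ≤ ‖p x‖ * (A / (4 * x ^ 2) * (‖p x‖ + ‖q x‖)) :=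
      (real_inner_le_norm _ _).trans (mul_le_mul_of_nonneg_left (hVn x hx) (norm_nonneg _))
    have i2 : inner ℝ (q x) (V x) ≤ ‖q x‖ * (A / (4 * x ^ 2) * (‖p x‖ + ‖q x‖)) :=
      (real_inner_le_norm _ _).trans (mul_le_mul_of_nonneg_left (hVn x hx) (norm_nonneg _))
    have i3 : inner ℝ (q x) (-(2 * k * q x)) ≤ 0 := by
      rw [inner_neg_right, Complex.inner]
      have : (2 * k * q x * (starRingEnd ℂ) (q x)).re = 2 * k.re * ‖q x‖ ^ 2 := by
        rw [show 2 * k * q x * (starRingEnd ℂ) (q x) = 2 * k * (q x * (starRingEnd ℂ) (q x)) by ring,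
          Complex.mul_conj, Complex.re_mul_ofReal, Complex.normSq_eq_norm_sq]
        simp
      rw [this]
      have : 0 ≤ 2 * k.re * ‖q x‖ ^ 2 := by positivity
      linarith
    have i4 : (‖p x‖ + ‖q x‖) ^ 2 ≤ 2 * E x := by
      simp only [hE]
      nlinarith [sq_nonneg (‖p x‖ - ‖q x‖)]
    have hA0 : 0 ≤ A / (4 * x ^ 2) := by positivity
    have i5 : 2 * inner ℝ (p x) (V x) + 2 * inner ℝ (q x) (-(2 * k * q x) + V x)
        ≤ E x * (A / x ^ 2) := by
      rw [inner_add_right]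
      calc _ ≤ 2 * (A / (4 * x ^ 2)) * (‖p x‖ + ‖q x‖) ^ 2 := by nlinarith
        _ ≤ 2 * (A / (4 * x ^ 2)) * (2 * E x) := by gcongr
        _ = _ := by field_simp; ring
    calc _ ≤ E x * (A / x ^ 2) * Real.exp (A / x) + E x * (Real.exp (A / x) * (-A / x ^ 2)) := by
          gcongr
      _ = 0 := by ring
  have hanti : AntitoneOn (fun x => E x * Real.exp (A / x)) (Ici 1) := by
    refine antitoneOn_of_deriv_nonpos (convex_Ici 1) (fun y hy => ?_) (fun y hy => ?_) (fun y hy => ?_)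
    · exact (hE' y (lt_of_lt_of_le one_pos hy)).continuousAt.continuousWithinAt
    · rw [interior_Ici] at hy
      exact (hE' y (one_pos.trans hy)).differentiableAt.differentiableWithinAt
    · rw [interior_Ici] at hy
      rw [(hE' y (one_pos.trans hy)).deriv]
      exact hdec y (one_pos.trans hy)
  have hx0 : 0 < x := one_pos.trans_le hx
  have hE1 : E x ≤ E 1 * Real.exp A := by
    have h1 := hanti (mem_Ici.2 le_rfl) (mem_Ici.2 hx) hx
    simp only [div_one] at h1
    refine le_trans (le_mul_of_one_le_right (by positivity) (Real.one_le_exp (by positivity))) h1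
  set B := ‖u₁ 1‖ + ‖k‖ * ‖u 1‖ with hB
  have hB0 : 0 ≤ B := by positivity
  have hn (z : ℝ) (hz : 0 ≤ z) : ‖Complex.exp (-k * z)‖ = Real.exp (-k.re * z) := by
    rw [Complex.norm_exp]
    simp
  have hE0 : E 1 ≤ 2 * B ^ 2 := by
    have e1 : ‖Complex.exp (-k * (1 : ℝ))‖ ≤ 1 := by
      rw [hn 1 zero_le_one]
      exact Real.exp_le_one_iff.2 (by linarith)
    have b1 : ‖p 1‖ ≤ B := by
      simp only [hp]
      rw [norm_mul]
      refine (mul_le_of_le_one_left (norm_nonneg _) e1).trans ((norm_add_le _ _).trans ?_)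
      rw [norm_mul]
    have b2 : ‖q 1‖ ≤ B := by
      simp only [hq]
      rw [norm_mul]
      refine (mul_le_of_le_one_left (norm_nonneg _) e1).trans ((norm_sub_le _ _).trans ?_)
      rw [norm_mul]
    simp only [hE]
    nlinarith [norm_nonneg (p 1), norm_nonneg (q 1)]
  have hsum : ‖p x‖ + ‖q x‖ ≤ 2 * B * Real.exp (A / 2) := by
    refine abs_le_of_sq_le_sq' ?_ (by positivity) |>.2
    have e : (2 * B * Real.exp (A / 2)) ^ 2 = 4 * B ^ 2 * Real.exp A := by
      rw [mul_pow, ← Real.exp_nat_mul]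
      congr 1
      · ring
      · congr 1
        push_cast
        ring
    rw [e]
    have : E 1 * Real.exp A ≤ 2 * B ^ 2 * Real.exp A := by gcongr
    simp only [hE] at hE1 this
    nlinarith [sq_nonneg (‖p x‖ - ‖q x‖)]
  have hu : ‖u x‖ = Real.exp (k.re * x) * (‖p x - q x‖ / (2 * ‖k‖)) := by
    have h1 := congrArg norm (hpq x)
    rw [norm_div, norm_mul, norm_mul, RCLike.norm_ofNat, hn x hx0.le] at h1
    rw [h1, ← mul_assoc, ← Real.exp_add]
    simp
  have hA2 : A / 2 = ‖m ^ 2 - 1 / 4‖ / ‖k‖ := by rw [hA]; ring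
  rw [hu, ← hA2]
  calc _ ≤ Real.exp (k.re * x) * (2 * B * Real.exp (A / 2) / (2 * ‖k‖)) := by
        gcongr
        exact (norm_sub_le _ _).trans hsum
    _ = Real.exp (A / 2) / ‖k‖ * B * Real.exp (k.re * x) := by field_simp
    _ ≤ _ := by
      gcongr
      linarith [Real.exp_pos (A / 2)]

/-- Bounds on `phi` that are locally uniform in the index. -/
theorem exists_bound_phi {k : ℂ} (hk : 0 < k.re) {δ : ℝ} (hδ : 0 < δ) (M : ℝ) :
    ∃ C : ℝ, 0 ≤ C ∧ ∀ m : ℂ, δ ≤ m.re + 1 → ‖m‖ ≤ M → ∀ x : ℝ, 0 < x →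
      ‖phi k m x‖ ≤ C * (min x 1 ^ (1 / 2 + m.re) * Real.exp (k.re * x)) := by
  have hk0 : k ≠ 0 := fun h => by simp [h] at hk
  have hkn : 0 < ‖k‖ := norm_pos_iff.2 hk0
  set e₀ := Real.exp (‖k‖ ^ 2 / 4 / δ) with he₀
  set D := 2 * Real.exp ((M ^ 2 + 1) / ‖k‖) / ‖k‖
    * (((1 + M) * e₀ + ‖k‖ ^ 2 / (2 * δ) * e₀) + ‖k‖ * e₀) with hD
  have hser (m : ℂ) (hm : δ ≤ m.re + 1) (x : ℝ) (hx : 0 < x) (hx1 : x ≤ 1) :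
      ‖bIser m (k ^ 2 / 4 * (x : ℂ) ^ 2)‖ ≤ e₀ := by
    refine (norm_bIser_le hδ hm _).trans (Real.exp_le_exp.2 ?_)
    rw [norm_mul, norm_div, norm_pow, norm_pow, RCLike.norm_ofNat, Complex.norm_real,
      Real.norm_of_nonneg hx.le]
    gcongr
    exact mul_le_of_le_one_right (by positivity) (pow_le_one₀ hx.le hx1)
  refine ⟨max e₀ D, le_max_of_le_left (Real.exp_pos _).le, fun m hm hM x hx => ?_⟩
  have hm1 : -1 < m.re := by linarith
  -- Up to 1 the power series suffices. Beyond 1 the growth estimate starts from the data at x = 1,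
  -- themselves bounded by the series; this is the origin of D.
  rcases le_total x 1 with h1 | h1
  · rw [min_eq_left h1, phi, norm_mul, norm_ofReal_cpow _ hx]
    have e1 : (1 / 2 + m).re = 1 / 2 + m.re := by simp
    have e2 : 1 ≤ Real.exp (k.re * x) := Real.one_le_exp (by positivity)
    rw [e1]
    calc _ ≤ x ^ (1 / 2 + m.re) * e₀ := by
          gcongr
          exact hser m hm x hx h1
      _ = e₀ * (x ^ (1 / 2 + m.re) * 1) := by ring
      _ ≤ _ := by
        gcongr
        exact le_max_left _ _
  · have hM0 : 0 ≤ M := (norm_nonneg m).trans hM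
    have hm0 : m + 1 ≠ 0 := by simpa using add_one_add_nat_ne_zero hm1 0
    have h2 := growth_of_solvesODE hk ((besselPair_phi k hm1).solvesODE (k := k) (by field_simp)) h1
    rw [min_eq_right h1, Real.one_rpow, one_mul]
    refine h2.trans (mul_le_mul_of_nonneg_right (le_trans ?_ (le_max_right _ _)) (Real.exp_pos _).le)
    have b0 : ‖phi k m 1‖ ≤ e₀ := by
      have := hser m hm 1 one_pos le_rfl
      simpa [phi] using this
    have b1 : ‖phi k (m + 1) 1‖ ≤ e₀ := by
      have := hser (m + 1) (by simp; linarith) 1 one_pos le_rfl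
      simpa [phi] using this
    have b2 : δ ≤ ‖m + 1‖ := le_trans (by simpa using hm) (Complex.re_le_norm _)
    have b3 : ‖m ^ 2 - 1 / 4‖ ≤ M ^ 2 + 1 := by
      refine (norm_sub_le _ _).trans ?_
      rw [norm_pow]
      have : ‖(1 / 4 : ℂ)‖ ≤ 1 := by norm_num
      gcongr
    have b4 : ‖(1 / 2 + m) / ((1 : ℝ) : ℂ) * phi k m 1 + k ^ 2 / (2 * (m + 1)) * phi k (m + 1) 1‖
        ≤ (1 + M) * e₀ + ‖k‖ ^ 2 / (2 * δ) * e₀ := by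
      refine (norm_add_le _ _).trans ?_
      rw [norm_mul, norm_mul, Complex.ofReal_one, div_one, norm_div, norm_pow, norm_mul,
        RCLike.norm_ofNat]
      gcongr
      refine (norm_add_le _ _).trans ?_
      have : ‖(1 / 2 : ℂ)‖ ≤ 1 := by norm_num
      gcongr
    rw [hD]
    gcongr

/-! ### Variation of constants -/

theorem exists_Icc_of_test_pos (g : 𝓓(halfLine, ℂ)) : ∃ a b, 0 < a ∧ ∀ x ∉ Icc a b, g x = 0 := by
  obtain ⟨a, b, ha, -, h⟩ := exists_Icc_of_test g
  exact ⟨a, b, ha, fun x hx => image_eq_zero_of_notMem_tsupport fun h' => hx (h h')⟩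

theorem continuous_mul_test {f : ℝ → ℂ} (hf : ContinuousOn f (Ioi 0)) (g : 𝓓(halfLine, ℂ)) :
    Continuous fun x => f x * g x := by
  rw [continuous_iff_continuousAt]
  intro x
  by_cases hx : 0 < x
  · exact (hf.continuousAt (Ioi_mem_nhds hx)).mul g.continuous.continuousAt
  · have h0 : x ∉ tsupport g := fun h => hx (g.tsupport_subset h)
    refine (continuousAt_const (y := (0 : ℂ))).congr ?_
    filter_upwards [notMem_tsupport_iff_eventuallyEq.1 h0] with y hy
    simp [hy]

theorem integrable_mul_test {f : ℝ → ℂ} (hf : ContinuousOn f (Ioi 0)) (g : 𝓓(halfLine, ℂ)) :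
    Integrable (fun x => f x * g x) volume :=
  (continuous_mul_test hf g).integrable_of_hasCompactSupport g.hasCompactSupport.mul_left

/-- The solution of `u'' = q u - g` built from two solutions of the homogeneous equation. -/
def varConst (c : ℂ) (f h f₁ h₁ : ℝ → ℂ) (g : ℝ → ℂ) (x : ℝ) : ℂ :=
  c * (h₁ x * (∫ t in (0 : ℝ)..x, f t * g t)
    + f₁ x * ((∫ t in Ioi (0 : ℝ), h t * g t) - ∫ t in (0 : ℝ)..x, h t * g t))

theorem SolvesODE.continuousOn {q r u u₁ : ℝ → ℂ} (H : SolvesODE q r u u₁) :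
    ContinuousOn u (Ioi 0) :=
  fun x hx => (H.hasDerivAt x hx).continuousAt.continuousWithinAt

/-- In the derivative of the formula the terms from differentiating the integrals cancel, so the
derivative is the same expression with f, h replaced by f₁, h₁ in the outer slots. In the second
derivative they survive with the Wronskian as factor, and the normalization -1 yields the
inhomogeneity -g. -/
theorem solvesODE_varConst {q f f₁ h h₁ : ℝ → ℂ} {c : ℂ} (hf : SolvesODE q 0 f f₁)
    (hh : SolvesODE q 0 h h₁) (hW : ∀ x, 0 < x → c * (f x * h₁ x - f₁ x * h x) = -1)
    (g : 𝓓(halfLine, ℂ)) :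
    SolvesODE q (fun x => -g x) (varConst c f h f h g) (varConst c f h f₁ h₁ g) := by
  have hF (x : ℝ) : HasDerivAt (fun x => ∫ t in (0 : ℝ)..x, f t * g t) (f x * g x) x :=
    (continuous_mul_test hf.continuousOn g).integral_hasStrictDerivAt 0 x |>.hasDerivAt
  have hG (x : ℝ) : HasDerivAt (fun x => (∫ t in Ioi (0 : ℝ), h t * g t)
      - ∫ t in (0 : ℝ)..x, h t * g t) (-(h x * g x)) x :=
    ((continuous_mul_test hh.continuousOn g).integral_hasStrictDerivAt 0 x |>.hasDerivAt).const_sub _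
  refine ⟨fun x hx => ?_, fun x hx => ?_⟩
  · refine (((hh.hasDerivAt x hx).mul (hF x)).add ((hf.hasDerivAt x hx).mul (hG x))
      |>.const_mul c).congr_deriv ?_
    rw [varConst]
    ring
  · refine (((hh.hasDerivAt' x hx).mul (hF x)).add ((hf.hasDerivAt' x hx).mul (hG x))
      |>.const_mul c).congr_deriv ?_
    rw [varConst, Pi.zero_apply]
    linear_combination g x * hW x hx

theorem intervalIntegral_test_of_le {f : ℝ → ℂ} (g : 𝓓(halfLine, ℂ)) {a b x : ℝ}
    (h : ∀ x ∉ Icc a b, g x = 0) (hx : 0 < x) (hxa : x < a) :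
    ∫ t in (0 : ℝ)..x, f t * g t = 0 := by
  rw [intervalIntegral.integral_of_le hx.le]
  refine (setIntegral_congr_fun measurableSet_Ioc fun t ht => ?_).trans (integral_zero _ _)
  rw [h t fun h' => absurd (h'.1.trans ht.2) (not_le.2 hxa), mul_zero]

theorem intervalIntegral_test_of_ge {f : ℝ → ℂ} (g : 𝓓(halfLine, ℂ)) {a b x : ℝ}
    (h : ∀ x ∉ Icc a b, g x = 0) (hx : 0 < x) (hxb : b < x) :
    ∫ t in (0 : ℝ)..x, f t * g t = ∫ t in Ioi (0 : ℝ), f t * g t := by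
  rw [intervalIntegral.integral_of_le hx.le]
  refine (setIntegral_eq_of_subset_of_forall_sdiff_eq_zero measurableSet_Ioi
    (fun t ht => ht.1) fun t ht => ?_).symm
  have hxt : x < t := not_le.1 fun h' => ht.2 ⟨ht.1, h'⟩
  rw [h t fun h' => absurd (h'.2.trans_lt hxb) (not_lt.2 hxt.le), mul_zero]

/-- Below the support of g only f survives, which imposes its behaviour at 0. The companion
statement at infinity leaves only h, hence decay. -/
theorem varConst_eventuallyEq_zero (c : ℂ) (f h f₁ h₁ : ℝ → ℂ) (g : 𝓓(halfLine, ℂ)) :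
    ∀ᶠ x in 𝓝[>] 0, varConst c f h f₁ h₁ g =ᶠ[𝓝 x]
      fun y => c * (∫ t in Ioi (0 : ℝ), h t * g t) * f₁ y := by
  obtain ⟨a, b, ha, hab⟩ := exists_Icc_of_test_pos g
  filter_upwards [Ioo_mem_nhdsGT ha] with x hx
  filter_upwards [Ioo_mem_nhds hx.1 hx.2] with y hy
  rw [varConst, intervalIntegral_test_of_le g hab hy.1 hy.2,
    intervalIntegral_test_of_le g hab hy.1 hy.2]
  ring

theorem varConst_eventuallyEq_atTop (c : ℂ) (f h f₁ h₁ : ℝ → ℂ) (g : 𝓓(halfLine, ℂ)) :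
    ∀ᶠ x in atTop, varConst c f h f₁ h₁ g =ᶠ[𝓝 x]
      fun y => c * (∫ t in Ioi (0 : ℝ), f t * g t) * h₁ y := by
  obtain ⟨a, b, ha, hab⟩ := exists_Icc_of_test_pos g
  filter_upwards [eventually_gt_atTop (max b 0)] with x hx
  filter_upwards [Ioi_mem_nhds hx] with y hy
  have hy' := max_lt_iff.1 (show max b 0 < y from hy)
  rw [varConst, intervalIntegral_test_of_ge g hab hy'.2 hy'.1,
    intervalIntegral_test_of_ge g hab hy'.2 hy'.1]
  ring

/-! ### Green's function -/

/-- Green's function of `L_{m²} + k²` with the boundary condition of `H_m`. -/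
def green (k m : ℂ) (x y : ℝ) : ℂ :=
  (Ioi (0 : ℝ) ×ˢ Ioi (0 : ℝ)).indicator
    (fun p => -(wronsk k m)⁻¹ * (phi k m (min p.1 p.2) * psi k m (max p.1 p.2))) (x, y)

theorem green_apply (k m : ℂ) {x y : ℝ} (hx : 0 < x) (hy : 0 < y) :
    green k m x y = -(wronsk k m)⁻¹ * (phi k m (min x y) * psi k m (max x y)) :=
  indicator_of_mem (show (x, y) ∈ Ioi (0 : ℝ) ×ˢ Ioi (0 : ℝ) from ⟨hx, hy⟩) _

theorem solvesODE_phi (k : ℂ) {m : ℂ} (hm : -1 < m.re) : SolvesODE (bPot k m) 0 (phi k m)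
    fun x => (1 / 2 + m) / x * phi k m x + k ^ 2 / (2 * (m + 1)) * phi k (m + 1) x := by
  have hm0 : m + 1 ≠ 0 := by simpa using add_one_add_nat_ne_zero hm 0
  exact (besselPair_phi k hm).solvesODE (by field_simp)

theorem differentiableOn_phi_index (k : ℂ) {x : ℝ} (hx : 0 < x) :
    DifferentiableOn ℂ (fun m => phi k m x) {m | -1 < m.re} := by
  unfold phi
  refine DifferentiableOn.mul (Differentiable.differentiableOn fun m => ?_)
    (differentiableOn_bIser_index _)
  exact ((differentiableAt_const _).add differentiableAt_id).const_cpow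
    (Or.inl (Complex.ofReal_ne_zero.2 hx.ne'))

theorem solvesODE_psi {k : ℂ} (hk : 0 < k.re) (m : ℂ) : SolvesODE (bPot k m) 0 (psi k m)
    fun x => (1 / 2 + m) / x * psi k m x + -k * psi k (m + 1) x :=
  (besselPair_psi hk m).solvesODE (by ring)

theorem differentiable_psi_index {k : ℂ} (hk : 0 < k.re)
    {x : ℝ} (hx : 0 < x) : Differentiable ℂ fun m => psi k m x :=
  (differentiable_bK_index hk hx).const_mul _

theorem differentiableOn_wronsk {k : ℂ} (hk : 0 < k.re) :
    DifferentiableOn ℂ (wronsk k) {m | -1 < m.re} := by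
  have h1 := differentiableOn_phi_index k one_pos
  have h2 : DifferentiableOn ℂ (fun m => phi k (m + 1) 1) {m | -1 < m.re} :=
    h1.comp (f := fun m : ℂ => m + 1) (s := {m | -1 < m.re})
      (Differentiable.differentiableOn (by fun_prop)) fun m (hm : -1 < m.re) => by
        change -1 < (m + 1).re
        rw [Complex.add_re, Complex.one_re]
        linarith
  have h3 := (differentiable_psi_index hk one_pos).differentiableOn (s := {m : ℂ | -1 < m.re})
  have h4 : DifferentiableOn ℂ (fun m => psi k (m + 1) 1) {m | -1 < m.re} :=
    ((differentiable_psi_index hk one_pos).comp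
      (by fun_prop : Differentiable ℂ fun m : ℂ => m + 1)).differentiableOn
  have h5 : DifferentiableOn ℂ (fun m : ℂ => k ^ 2 / (2 * (m + 1))) {m | -1 < m.re} := by
    refine (differentiableOn_const _).div (Differentiable.differentiableOn (by fun_prop))
      fun m hm => ?_
    exact mul_ne_zero two_ne_zero (by simpa using add_one_add_nat_ne_zero hm 0)
  exact ((h1.const_mul (-k)).mul h4).sub ((h5.mul h2).mul h3)

theorem differentiableOn_green {k : ℂ} (hk : 0 < k.re) (x y : ℝ) :
    DifferentiableOn ℂ (fun m => green k m x y) {m | -1 < m.re} := by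
  by_cases h : (x, y) ∈ Ioi (0 : ℝ) ×ˢ Ioi (0 : ℝ)
  · have hx : 0 < x := h.1
    have hy : 0 < y := h.2
    simp only [green_apply k _ hx hy]
    refine DifferentiableOn.mul ((differentiableOn_wronsk hk).inv
      fun m hm => wronsk_ne_zero hk hm).neg ?_
    exact (differentiableOn_phi_index k (lt_min hx hy)).mul
      (differentiable_psi_index hk (lt_max_of_lt_left hx)).differentiableOn
  · simp only [green, indicator_of_notMem h]
    exact differentiableOn_const _

theorem measurable_green {k : ℂ} (hk : 0 < k.re)
    {m : ℂ} (hm : -1 < m.re) : Measurable (Function.uncurry (green k m)) := by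
  have h1 := (solvesODE_phi k hm).continuousOn
  have h2 := (solvesODE_psi hk m).continuousOn
  have hc : ContinuousOn (fun p : ℝ × ℝ => -(wronsk k m)⁻¹ *
      (phi k m (min p.1 p.2) * psi k m (max p.1 p.2))) (Ioi (0 : ℝ) ×ˢ Ioi (0 : ℝ)) := by
    refine continuousOn_const.mul (ContinuousOn.mul ?_ ?_)
    · exact h1.comp (by fun_prop) fun p hp => mem_Ioi.2 (lt_min hp.1 hp.2)
    · exact h2.comp (by fun_prop) fun p hp => mem_Ioi.2 (lt_max_of_lt_left hp.1)
  classical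
  have h3 := hc.measurable_piecewise (g := fun _ => 0) continuousOn_const
    (measurableSet_Ioi.prod measurableSet_Ioi)
  convert h3 using 1
  ext ⟨x, y⟩
  simp only [Function.uncurry_apply_pair, green, indicator_apply, piecewise]

/-- The kernel bound on Green's function, locally uniform in the index. -/
theorem exists_kernelBound_green {k : ℂ} (hk : 0 < k.re) {m₀ : ℂ} (hm₀ : -1 < m₀.re) :
    ∃ s < 1, ∃ r > 0, ∃ C ≥ 0, ∀ m ∈ Metric.ball m₀ r, -1 < m.re ∧
      KernelBound s k.re C (green k m) := by
  set ε := min 1 (1 + m₀.re) / 2 with hε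
  have hε0 : 0 < ε := by
    have : 0 < min 1 (1 + m₀.re) := lt_min one_pos (by linarith)
    positivity
  have hε1 : ε ≤ 1 / 2 := by
    have := min_le_left 1 (1 + m₀.re)
    linarith
  have hε2 : ε ≤ (1 + m₀.re) / 2 := by
    have := min_le_right 1 (1 + m₀.re)
    linarith
  -- The weight exponent must exceed -Re m for all m near m₀ and yet be smaller than 1. Both are
  -- possible because -Re m₀ < 1 and ε is at most half of 1 + Re m₀ and at most 1/2.
  set s := max 0 (-m₀.re) + ε with hs
  have hs1 : s < 1 := by
    rcases max_cases 0 (-m₀.re) with ⟨h, h'⟩ | ⟨h, h'⟩ <;> rw [hs, h] <;> linarith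
  have hs2 : -m₀.re + ε ≤ s := by
    have := le_max_right 0 (-m₀.re)
    linarith
  have hs3 : |m₀.re| - m₀.re + 2 * ε ≤ 2 * s := by
    rcases abs_cases m₀.re with ⟨h, h'⟩ | ⟨h, h'⟩ <;> rw [h]
    · have := le_max_left 0 (-m₀.re)
      linarith
    · linarith
  obtain ⟨C₁, hC₁, hb₁⟩ := exists_bound_phi hk (δ := (1 + m₀.re) / 2) (by linarith) (‖m₀‖ + ε)
  obtain ⟨C₂, hC₂, hb₂⟩ := exists_bound_bK hk (ν := |m₀.re| + ε) (by positivity)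
  have hopen : IsOpen {m : ℂ | -1 < m.re} := isOpen_lt continuous_const Complex.continuous_re
  have hWc : ContinuousAt (fun m => (wronsk k m)⁻¹) m₀ :=
    (((differentiableOn_wronsk hk).continuousOn.continuousAt (hopen.mem_nhds hm₀)).inv₀
      (wronsk_ne_zero hk hm₀))
  have hWb : ∀ᶠ m in 𝓝 m₀, ‖(wronsk k m)⁻¹‖ < ‖(wronsk k m₀)⁻¹‖ + 1 :=
    hWc.norm.eventually_lt continuousAt_const (lt_add_one _)
  obtain ⟨r, hr, hball⟩ := Metric.eventually_nhds_iff_ball.1 hWb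
  refine ⟨s, hs1, min r ε, lt_min hr hε0, (‖(wronsk k m₀)⁻¹‖ + 1) * (C₁ * C₂), by positivity,
    fun m hm => ?_⟩
  have hmε : ‖m - m₀‖ < ε := by
    rw [← dist_eq_norm]
    exact (Metric.mem_ball.1 hm).trans_le (min_le_right _ _)
  have hre : |m.re - m₀.re| < ε := by
    rw [← Complex.sub_re]
    exact (Complex.abs_re_le_norm _).trans_lt hmε
  have hre' := abs_lt.1 hre
  have hm1 : -1 < m.re := by linarith
  refine ⟨hm1, measurable_green hk hm1, ?_⟩
  have hmn : ‖m‖ ≤ ‖m₀‖ + ε := by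
    have := norm_add_le m₀ (m - m₀)
    rw [add_sub_cancel] at this
    linarith
  have habs : |m.re| ≤ |m₀.re| + ε := by
    have := abs_add_le m₀.re (m.re - m₀.re)
    rw [add_sub_cancel] at this
    linarith
  have key (x y : ℝ) (hx : 0 < x) (hy : 0 < y) (hxy : x ≤ y) :
      ‖phi k m x * psi k m y‖ ≤ C₁ * C₂ * envelope s k.re x y := by
    have e1 := hb₁ m (by linarith) hmn x hx
    have e2 := hb₂ m habs y hy
    have hX : 0 < min x 1 := lt_min hx one_pos
    have hY : 0 < min y 1 := lt_min hy one_pos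
    have hXY : min x 1 ≤ min y 1 := min_le_min_right 1 hxy
    have hY1 : min y 1 ≤ 1 := min_le_right _ _
    obtain ⟨X, hXe⟩ : ∃ X, X = min x 1 := ⟨_, rfl⟩
    obtain ⟨Y, hYe⟩ : ∃ Y, Y = min y 1 := ⟨_, rfl⟩
    rw [← hXe] at e1 hX hXY
    rw [← hYe] at e2 hY hXY hY1
    -- Here X ≤ Y ≤ 1. The surplus power Re m + s ≥ 0 of X is increased to the same power of Y; the
    -- exponent then left over on Y is nonpositive, so that factor is at least 1.
    have e3 : X ^ (1 / 2 + m.re) * Y ^ (1 / 2 - (|m₀.re| + ε)) ≤ X ^ (1 / 2 - s) * Y ^ (1 / 2 - s) := by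
      have a1 : X ^ (1 / 2 + m.re) = X ^ (1 / 2 - s) * X ^ (m.re + s) := by
        rw [← Real.rpow_add hX]
        congr 1
        ring
      have a2 : Y ^ (1 / 2 - s) = Y ^ (m.re + s) * Y ^ (1 / 2 - (|m₀.re| + ε))
          * Y ^ ((|m₀.re| + ε) - m.re - 2 * s) := by
        rw [← Real.rpow_add hY, ← Real.rpow_add hY]
        congr 1
        ring
      have a3 : X ^ (m.re + s) ≤ Y ^ (m.re + s) :=
        Real.rpow_le_rpow hX.le hXY (by linarith)
      have a4 : 1 ≤ Y ^ ((|m₀.re| + ε) - m.re - 2 * s) :=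
        Real.one_le_rpow_of_pos_of_le_one_of_nonpos hY hY1 (by linarith)
      rw [a1, a2, mul_assoc]
      refine mul_le_mul_of_nonneg_left ?_ (by positivity)
      calc X ^ (m.re + s) * Y ^ (1 / 2 - (|m₀.re| + ε))
          ≤ Y ^ (m.re + s) * Y ^ (1 / 2 - (|m₀.re| + ε)) := by gcongr
        _ ≤ _ := le_mul_of_one_le_right (by positivity) a4
    have e4 : Real.exp (k.re * x) * Real.exp (-k.re * y) = Real.exp (-k.re * |x - y|) := by
      rw [← Real.exp_add, abs_of_nonpos (by linarith)]
      congr 1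
      ring
    rw [norm_mul]
    calc _ ≤ C₁ * (X ^ (1 / 2 + m.re) * Real.exp (k.re * x))
          * (C₂ * (Y ^ (1 / 2 - (|m₀.re| + ε)) * Real.exp (-k.re * y))) := by
          gcongr
          exact e2
      _ = C₁ * C₂ * ((X ^ (1 / 2 + m.re) * Y ^ (1 / 2 - (|m₀.re| + ε)))
          * (Real.exp (k.re * x) * Real.exp (-k.re * y))) := by ring
      _ ≤ C₁ * C₂ * ((X ^ (1 / 2 - s) * Y ^ (1 / 2 - s)) * Real.exp (-k.re * |x - y|)) := by
          rw [e4]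
          gcongr
      _ = _ := by rw [envelope, weight, weight, ← hXe, ← hYe]
  intro x y hx hy
  have hW := (hball m (Metric.ball_subset_ball (min_le_left _ _) hm)).le
  rw [green_apply k m hx hy, norm_mul, norm_neg, mul_assoc]
  gcongr
  rcases le_total x y with h | h
  · rw [min_eq_left h, max_eq_right h]
    exact key x y hx hy h
  · rw [min_eq_right h, max_eq_left h]
    have : envelope s k.re x y = envelope s k.re y x := by
      rw [envelope, envelope, abs_sub_comm]
      ring
    rw [this]
    exact key y x hy hx h

theorem exists_hasKernel_green {k : ℂ} (hk : 0 < k.re) {m : ℂ} (hm : -1 < m.re) :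
    ∃ T : HalfLineL2 →L[ℂ] HalfLineL2, HasKernel T (green k m) := by
  obtain ⟨s, hs, r, hr, C, hC, h⟩ := exists_kernelBound_green hk hm
  obtain ⟨A, -, hA⟩ := exists_hasKernel hs hk
  obtain ⟨T, hT, -⟩ := hA _ C hC (h m (Metric.mem_ball_self hr)).2
  exact ⟨T, hT⟩

open Classical in
/-- The integral operator with kernel `green k m`. -/
def greenOp (k m : ℂ) : HalfLineL2 →L[ℂ] HalfLineL2 :=
  if h : ∃ T : HalfLineL2 →L[ℂ] HalfLineL2, HasKernel T (green k m) then h.choose else 0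

theorem hasKernel_greenOp {k m : ℂ} (hk : 0 < k.re) (hm : -1 < m.re) :
    HasKernel (greenOp k m) (green k m) := by
  rw [greenOp, dif_pos (exists_hasKernel_green hk hm)]
  exact (exists_hasKernel_green hk hm).choose_spec

/-! ### The range of the Green operator -/

theorem isBigO_ofReal_cpow (c : ℂ) :
    (fun x : ℝ => (x : ℂ) ^ c) =O[𝓝[>] 0] fun x : ℝ => x ^ c.re := by
  refine Asymptotics.IsBigO.of_bound 1 ?_
  filter_upwards [self_mem_nhdsWithin] with x hx
  have hx' : (0 : ℝ) < x := hx
  rw [norm_ofReal_cpow _ hx', one_mul, Real.norm_of_nonneg (by positivity)]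

theorem isBigO_cpow_mul_bIser (k : ℂ) {m n : ℂ} (hn : -1 < n.re) :
    (fun x : ℝ => (x : ℂ) ^ (1 / 2 + m) * bIser n (k ^ 2 / 4 * (x : ℂ) ^ 2))
      =O[𝓝[>] 0] fun x : ℝ => x ^ (1 / 2 + m.re) := by
  have h := (isBigO_ofReal_cpow (1 / 2 + m)).mul ((tendsto_bIser k hn).isBigO_one ℝ)
  simpa using h

theorem isBigO_phi (k : ℂ) {m : ℂ} (hm : -1 < m.re) :
    phi k m =O[𝓝[>] 0] fun x : ℝ => x ^ (1 / 2 + m.re) :=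
  isBigO_cpow_mul_bIser k hm

theorem isBigO_phi_succ_div (k : ℂ) {m : ℂ} (hm : -1 < m.re) :
    (fun x : ℝ => phi k (m + 1) x / x) =O[𝓝[>] 0] fun x : ℝ => x ^ (1 / 2 + m.re) := by
  refine (isBigO_cpow_mul_bIser k (m := m) (n := m + 1) (by simp; linarith)).congr' ?_
    EventuallyEq.rfl
  filter_upwards [self_mem_nhdsWithin] with x hx
  have h0 : (x : ℂ) ≠ 0 := Complex.ofReal_ne_zero.2 (ne_of_gt hx)
  rw [phi_succ k m hx, mul_div_cancel_left₀ _ h0]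

/-- The power series runs in x² with constant term 1, so φ - x^{1/2+m} gains two powers of x. This
gain places the remainder in the minimal domain. -/
theorem isBigO_phi_sub_div (k : ℂ) {m : ℂ} (hm : -1 < m.re) :
    (fun x : ℝ => (phi k m x - (x : ℂ) ^ (1 / 2 + m)) / (x : ℂ) ^ 2)
      =O[𝓝[>] 0] fun x : ℝ => x ^ (1 / 2 + m.re) := by
  have h1 : (fun x : ℝ => (bIser m (k ^ 2 / 4 * (x : ℂ) ^ 2) - 1) / (x : ℂ) ^ 2)
      =O[𝓝[>] 0] fun _ => (1 : ℝ) := by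
    refine Asymptotics.IsBigO.of_bound
      (‖k‖ ^ 2 / 4 / (m.re + 1) * Real.exp (‖k‖ ^ 2 / 4 / (m.re + 1))) ?_
    filter_upwards [Ioc_mem_nhdsGT one_pos] with x hx
    have hx0 := hx.1
    have hδ : 0 < m.re + 1 := by linarith
    have h := norm_bIser_sub_one_le hδ le_rfl (k ^ 2 / 4 * (x : ℂ) ^ 2)
    rw [norm_mul, norm_div, norm_pow, norm_pow, RCLike.norm_ofNat, Complex.norm_real,
      Real.norm_of_nonneg hx.1.le] at h
    rw [norm_div, norm_pow, Complex.norm_real, Real.norm_of_nonneg hx.1.le, norm_one, mul_one,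
      div_le_iff₀ (by positivity)]
    refine h.trans ?_
    have h2 : Real.exp (‖k‖ ^ 2 / 4 * x ^ 2 / (m.re + 1)) ≤ Real.exp (‖k‖ ^ 2 / 4 / (m.re + 1)) := by
      gcongr
      exact mul_le_of_le_one_right (by positivity) (pow_le_one₀ hx.1.le hx.2)
    calc _ ≤ ‖k‖ ^ 2 / 4 * x ^ 2 / (m.re + 1) * Real.exp (‖k‖ ^ 2 / 4 / (m.re + 1)) := by gcongr
      _ = _ := by ring
  have h := (isBigO_ofReal_cpow (1 / 2 + m)).mul h1
  have e : (1 / 2 + m).re = 1 / 2 + m.re := by simp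
  simp only [mul_one, e] at h
  refine h.congr_left fun x => ?_
  rw [phi]
  ring

theorem isBigO_psi_atTop {k : ℂ} (hk : 0 < k.re)
    (m : ℂ) : psi k m =O[atTop] fun x : ℝ => Real.exp (-k.re * x) := by
  obtain ⟨C, hC, h⟩ := exists_bound_bK hk (ν := |m.re| + 1) (by positivity)
  refine Asymptotics.IsBigO.of_bound C ?_
  filter_upwards [eventually_ge_atTop 1] with x hx
  have := h m (by linarith) x (by linarith)
  rwa [min_eq_right hx, Real.one_rpow, one_mul, ← Real.norm_of_nonneg (Real.exp_pos _).le] at this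

theorem isBigO_psi_zero {k : ℂ} (hk : 0 < k.re) {m : ℂ} {ν : ℝ} (hν : 0 < ν) (hm : |m.re| ≤ ν) :
    psi k m =O[𝓝[>] 0] fun x : ℝ => x ^ (1 / 2 - ν) := by
  obtain ⟨C, hC, h⟩ := exists_bound_bK hk hν
  refine Asymptotics.IsBigO.of_bound C ?_
  filter_upwards [Ioc_mem_nhdsGT one_pos] with x hx
  have hx0 := hx.1
  have h1 := h m hm x hx.1
  rw [min_eq_left hx.2] at h1
  rw [Real.norm_of_nonneg (by positivity)]
  refine h1.trans (mul_le_mul_of_nonneg_left ?_ hC)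
  exact mul_le_of_le_one_right (by positivity) (Real.exp_le_one_iff.2 (by nlinarith))

/-- Splitting at y = x separates the variables in the kernel and gives the variation of constants
formula. -/
theorem integral_green_mul {k : ℂ} (hk : 0 < k.re)
    {m : ℂ} (hm : -1 < m.re) (g : 𝓓(halfLine, ℂ)) {x : ℝ} (hx : 0 < x) :
    ∫ y, green k m x y * g y ∂halfLineMeasure
      = varConst (-(wronsk k m)⁻¹) (phi k m) (psi k m) (phi k m) (psi k m) g x := by
  have i1 := integrable_mul_test (solvesODE_phi k hm).continuousOn g
  have i2 := integrable_mul_test (solvesODE_psi hk m).continuousOn g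
  have e1 : ∀ y ∈ Ioc 0 x, green k m x y * g y
      = -(wronsk k m)⁻¹ * psi k m x * (phi k m y * g y) := fun y hy => by
    rw [green_apply k m hx hy.1, min_eq_right hy.2, max_eq_left hy.2]
    ring
  have e2 : ∀ y ∈ Ioi x, green k m x y * g y
      = -(wronsk k m)⁻¹ * phi k m x * (psi k m y * g y) := fun y hy => by
    rw [green_apply k m hx (hx.trans hy), min_eq_left (le_of_lt hy), max_eq_right (le_of_lt hy)]
    ring
  have hd : Disjoint (Ioc 0 x) (Ioi x) := by
    rw [Set.disjoint_left]
    exact fun y hy hy' => not_lt.2 hy.2 hy'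
  have hu : Ioi (0 : ℝ) = Ioc 0 x ∪ Ioi x := (Ioc_union_Ioi_eq_Ioi hx.le).symm
  have h2 : ∫ t in Ioi (0 : ℝ), psi k m t * g t
      = (∫ t in (0 : ℝ)..x, psi k m t * g t) + ∫ t in Ioi x, psi k m t * g t := by
    rw [hu, setIntegral_union hd measurableSet_Ioi i2.integrableOn i2.integrableOn,
      intervalIntegral.integral_of_le hx.le]
  change ∫ y in Ioi 0, green k m x y * g y = _
  rw [varConst, h2, add_sub_cancel_left, hu, setIntegral_union hd measurableSet_Ioi,
    setIntegral_congr_fun measurableSet_Ioc e1, setIntegral_congr_fun measurableSet_Ioi e2,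
    integral_const_mul, integral_const_mul, intervalIntegral.integral_of_le hx.le]
  · ring
  · exact IntegrableOn.congr_fun (i1.const_mul _).integrableOn (fun y hy => (e1 y hy).symm) measurableSet_Ioc
  · exact IntegrableOn.congr_fun (i2.const_mul _).integrableOn (fun y hy => (e2 y hy).symm) measurableSet_Ioi

theorem coeFn_greenOp_testLp {k : ℂ} (hk : 0 < k.re) {m : ℂ} (hm : -1 < m.re) (g : 𝓓(halfLine, ℂ)) :
    greenOp k m (testLp g) =ᵐ[halfLineMeasure]
      varConst (-(wronsk k m)⁻¹) (phi k m) (psi k m) (phi k m) (psi k m) g := by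
  filter_upwards [hasKernel_greenOp hk hm (testLp g), ae_restrict_mem measurableSet_Ioi] with x h hx
  rw [h, ← integral_green_mul hk hm g hx]
  refine integral_congr_ae ?_
  filter_upwards [coeFn_testLp g] with y hy
  rw [hy]

/-- The Green operator applied to a test function lies in the domain of the minimal operator up to
a multiple of `x^{1/2+m} ξ`. -/
theorem greenOp_test_sub_mem {k : ℂ} (hk : 0 < k.re) {ξ : ℝ → ℝ} (hξ : IsCutoff ξ)
    {m : ℂ} (hm : -1 < m.re) (g : 𝓓(halfLine, ℂ)) :
    (greenOp k m (testLp g), testLp g - k ^ 2 • greenOp k m (testLp g))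
      - (-(wronsk k m)⁻¹ * ∫ x, psi k m x * g x ∂halfLineMeasure) • wPair hξ hm
      ∈ (testGraph (m ^ 2)).topologicalClosure := by
  set c := -(wronsk k m)⁻¹ with hc
  set d := c * ∫ x, psi k m x * g x ∂halfLineMeasure with hd
  have hφ := solvesODE_phi k hm
  have hψ := solvesODE_psi hk m
  set φ₁ : ℝ → ℂ := fun x => (1 / 2 + m) / x * phi k m x + k ^ 2 / (2 * (m + 1)) * phi k (m + 1) x
  set ψ₁ : ℝ → ℂ := fun x => (1 / 2 + m) / x * psi k m x + -k * psi k (m + 1) x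
  -- The factor -1/W in Green's function is the normalization required by variation of constants.
  have hW (x : ℝ) (hx : 0 < x) : c * (phi k m x * ψ₁ x - φ₁ x * psi k m x) = -1 := by
    have h1 : phi k m x * ψ₁ x - φ₁ x * psi k m x = wronsk k m := by
      rw [wronsk_eq_at hk hm hx]
      ring
    rw [h1, hc, neg_mul, inv_mul_cancel₀ (wronsk_ne_zero hk hm)]
  have hu := solvesODE_varConst hφ hψ hW g
  set u := varConst c (phi k m) (psi k m) (phi k m) (psi k m) g with hu_def
  have huc : ContDiffOn ℝ ∞ u (Ioi 0) :=
    hu.contDiffOn (contDiffOn_bPot k m) g.contDiff.neg.contDiffOn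
  set v : ℝ → ℂ := fun x => u x - d * wFun ξ m x with hv
  have hvc : ContDiffOn ℝ ∞ v (Ioi 0) := huc.sub (contDiffOn_const.mul (contDiffOn_wFun hξ m))
  -- The constant d is the coefficient of φ in u near 0. Subtracting d·x^{1/2+m} ξ therefore leaves
  -- d(φ - x^{1/2+m}) there, and far out only a multiple of ψ. These two forms give the L²
  -- conditions on v, v'/x and v/x²; the one on Lv follows from the equation.
  have hv0 : ∀ᶠ x in 𝓝[>] (0 : ℝ), v =ᶠ[𝓝 x] fun y => d * (phi k m y - (y : ℂ) ^ (1 / 2 + m)) := by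
    filter_upwards [varConst_eventuallyEq_zero c (phi k m) (psi k m) (phi k m) (psi k m) g,
      wFun_eventuallyEq_zero hξ m] with x h1 h2
    filter_upwards [h1, h2] with y h1 h2
    simp only [hv, hu_def]
    rw [h1, h2]
    ring
  set e := c * ∫ x in Ioi (0 : ℝ), phi k m x * g x with he
  have hvt : ∀ᶠ x in atTop, v =ᶠ[𝓝 x] fun y => e * psi k m y := by
    filter_upwards [varConst_eventuallyEq_atTop c (phi k m) (psi k m) (phi k m) (psi k m) g,
      wFun_eventuallyEq_atTop hξ m] with x h1 h2
    filter_upwards [h1, h2] with y h1 h2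
    simp only [hv, hu_def]
    rw [h1, h2, Pi.zero_apply, mul_zero, sub_zero]
  have hβ : -(1 / 2) < 1 / 2 + m.re := by linarith
  have hcpow : (1 / 2 + m).re = 1 / 2 + m.re := by simp
  have hdiv : ∀ x : ℝ, 1 ≤ x → ‖(x : ℂ)⁻¹‖ ≤ 1 := fun x hx => by
    rw [norm_inv, Complex.norm_real, Real.norm_of_nonneg (by linarith)]
    exact inv_le_one_of_one_le₀ hx
  have hinv : (fun x : ℝ => (x : ℂ)⁻¹) =O[atTop] fun _ => (1 : ℝ) := by
    refine Asymptotics.IsBigO.of_bound 1 ?_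
    filter_upwards [eventually_ge_atTop 1] with x hx
    simpa using hdiv x hx
  have hψO := isBigO_psi_atTop hk m
  have hψO' := isBigO_psi_atTop hk (m + 1)
  have hne : ∀ x ∈ Ioi (0 : ℝ), (x : ℂ) ≠ 0 := fun x hx => Complex.ofReal_ne_zero.2 (ne_of_gt hx)
  have hofr : ContinuousOn (fun x : ℝ => (x : ℂ)) (Ioi 0) := by fun_prop
  have m0 : MemLp v 2 halfLineMeasure := by
    refine memLp_of_isBigO hvc.continuousOn hβ hk ?_ ?_
    · have h := isBigO_ofReal_cpow (1 / 2 + m)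
      rw [hcpow] at h
      refine (((isBigO_phi k hm).sub h).const_mul_left d).congr' ?_ EventuallyEq.rfl
      filter_upwards [hv0] with x hx
      exact hx.eq_of_nhds.symm
    · refine (hψO.const_mul_left e).congr' ?_ EventuallyEq.rfl
      filter_upwards [hvt] with x hx
      exact hx.eq_of_nhds.symm
  have m2 : MemLp (fun x => v x / (x : ℂ) ^ 2) 2 halfLineMeasure := by
    refine memLp_of_isBigO (hvc.continuousOn.div (hofr.pow 2) fun x hx => pow_ne_zero 2 (hne x hx))
      hβ hk ?_ ?_
    · refine ((isBigO_phi_sub_div k hm).const_mul_left d).congr' ?_ EventuallyEq.rfl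
      filter_upwards [hv0] with x hx
      rw [hx.eq_of_nhds]
      ring
    · have h := (hψO.const_mul_left e).mul (hinv.mul hinv)
      simp only [mul_one] at h
      refine h.congr' ?_ EventuallyEq.rfl
      filter_upwards [hvt] with x hx
      rw [hx.eq_of_nhds]
      ring
  have m1 : MemLp (fun x => deriv v x / x) 2 halfLineMeasure := by
    refine memLp_of_isBigO ((contDiffOn_deriv hvc).continuousOn.div hofr hne) hβ hk ?_ ?_
    · refine ((((isBigO_phi_sub_div k hm).const_mul_left (1 / 2 + m)).add
        ((isBigO_phi_succ_div k hm).const_mul_left (k ^ 2 / (2 * (m + 1))))).const_mul_left d).congr'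
        ?_ EventuallyEq.rfl
      filter_upwards [hv0, self_mem_nhdsWithin] with x hx hx0
      have hx1 := hne x hx0
      have hdv : HasDerivAt (fun y => d * (phi k m y - (y : ℂ) ^ (1 / 2 + m))) _ x :=
        ((hφ.hasDerivAt x hx0).sub (hasDerivAt_ofReal_cpow (1 / 2 + m) hx0)).const_mul d
      rw [hx.deriv_eq, hdv.deriv]
      simp only [φ₁]
      field_simp
      ring
    · have h1 := (hψO.const_mul_left (1 / 2 + m)).mul hinv
      simp only [mul_one] at h1
      have h := ((h1.add (hψO'.const_mul_left (-k))).const_mul_left e).mul hinv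
      simp only [mul_one] at h
      refine h.congr' ?_ EventuallyEq.rfl
      filter_upwards [hvt, eventually_gt_atTop 0] with x hx hx0
      rw [hx.deriv_eq, ((hψ.hasDerivAt x hx0).const_mul e).deriv]
      simp only [ψ₁]
      ring
  have mu : MemLp u 2 halfLineMeasure := by
    refine (m0.add ((memLp_wFun hξ hm).const_mul d)).congr_norm ?_ ?_
    · exact huc.continuousOn.aestronglyMeasurable measurableSet_Ioi
    · refine Eventually.of_forall fun x => ?_
      simp [hv]
  have hev : ∀ x ∈ Ioi (0 : ℝ), expr (m ^ 2) v x
      = g x - k ^ 2 * u x - d * expr (m ^ 2) (wFun ξ m) x := fun x hx => by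
    rw [hv, expr_sub_smul (m ^ 2) d huc (contDiffOn_wFun hξ m) hx, hu.expr_eq hx]
    ring
  have m3' : MemLp (fun x => g x - k ^ 2 * u x - d * expr (m ^ 2) (wFun ξ m) x) 2 halfLineMeasure :=
    ((memLp_test g).sub (mu.const_mul (k ^ 2))).sub ((memLp_expr_wFun hξ m).const_mul d)
  have hev' : expr (m ^ 2) v =ᵐ[halfLineMeasure]
      fun x => g x - k ^ 2 * u x - d * expr (m ^ 2) (wFun ξ m) x := by
    filter_upwards [ae_restrict_mem measurableSet_Ioi] with x hx using hev x hx
  have m3 : MemLp (expr (m ^ 2) v) 2 halfLineMeasure := (memLp_congr_ae hev').2 m3'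
  have hR := coeFn_greenOp_testLp hk hm g
  refine mem_closure_testGraph (m ^ 2) hvc m0 m1 m2 m3 ?_ ?_
  · filter_upwards [hR, Lp.coeFn_sub (greenOp k m (testLp g)) (d • (wPair hξ hm).1),
      Lp.coeFn_smul d (wPair hξ hm).1, (memLp_wFun hξ hm).coeFn_toLp] with x h1 h2 h3 h4
    change (greenOp k m (testLp g) - d • (wPair hξ hm).1 : HalfLineL2) x = _
    rw [h2, Pi.sub_apply, h1, h3, Pi.smul_apply, smul_eq_mul, show (wPair hξ hm).1 x = _ from h4]
  · filter_upwards [hR, hev',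
      Lp.coeFn_sub (testLp g - k ^ 2 • greenOp k m (testLp g)) (d • (wPair hξ hm).2),
      Lp.coeFn_sub (testLp g) (k ^ 2 • greenOp k m (testLp g)),
      Lp.coeFn_smul (k ^ 2) (greenOp k m (testLp g)), coeFn_testLp g,
      Lp.coeFn_smul d (wPair hξ hm).2, (memLp_expr_wFun hξ m).coeFn_toLp] with x h1 h0 h2 h5 h6 h7 h3 h4
    change (testLp g - k ^ 2 • greenOp k m (testLp g) - d • (wPair hξ hm).2 : HalfLineL2) x = _
    rw [h2, Pi.sub_apply, h5, Pi.sub_apply, h6, Pi.smul_apply, h1, h7, h3, Pi.smul_apply, smul_eq_mul,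
      smul_eq_mul, show (wPair hξ hm).2 x = _ from h4, h0]

/-- The Green operator is a right inverse of `H_m + k²`. -/
theorem greenOp_mem_graph_H {k : ℂ} (hk : 0 < k.re) {ξ : ℝ → ℝ} (hξ : IsCutoff ξ)
    {m : ℂ} (hm : -1 < m.re) (g : HalfLineL2) :
    (greenOp k m g, g - k ^ 2 • greenOp k m g) ∈ (H ξ m).graph := by
  -- Since H_m is closed and the Green operator bounded, it suffices to treat the dense set of test
  -- functions.
  have hcl : IsClosed {g : HalfLineL2 | (greenOp k m g, g - k ^ 2 • greenOp k m g) ∈ (H ξ m).graph} :=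
    IsClosed.preimage (f := fun g : HalfLineL2 => (greenOp k m g, g - k ^ 2 • greenOp k m g))
      (by fun_prop) (isClosed_H hξ hm)
  refine hcl.closure_subset_iff.2 ?_ (dense_testLp g)
  rintro _ ⟨φ, rfl⟩
  have h := closure_testGraph_le_graph_H hξ hm (greenOp_test_sub_mem hk hξ hm φ)
  have hw : wPair hξ hm ∈ (H ξ m).graph := by
    rw [graph_H hξ hm]
    exact Submodule.mem_sup_right (Submodule.mem_span_singleton_self _)
  have := add_mem h (Submodule.smul_mem _ (-(wronsk k m)⁻¹ * ∫ x, psi k m x * φ x ∂halfLineMeasure) hw)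
  rwa [sub_add_cancel] at this

/-! ### The kernel of `L_{m²}^max + k²` -/

theorem memLp_psi {k : ℂ} (hk : 0 < k.re)
    {m : ℂ} (hm : |m.re| < 1) : MemLp (psi k m) 2 halfLineMeasure := by
  have h0 := abs_nonneg m.re
  -- ν = (|Re m| + 1)/2 lies between |Re m| and 1 and is positive even for Re m = 0; ν < 1 gives
  -- integrability at 0.
  exact memLp_of_isBigO (solvesODE_psi hk m).continuousOn (β := 1 / 2 - (|m.re| + 1) / 2)
    (by linarith) hk (isBigO_psi_zero hk (by linarith) (by linarith)) (isBigO_psi_atTop hk m)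

theorem psi_mem_maxGraph {k : ℂ} (hk : 0 < k.re) {m : ℂ} (hm : |m.re| < 1) :
    ((memLp_psi hk hm).toLp, -(k ^ 2 • (memLp_psi hk hm).toLp)) ∈ maxGraph (m ^ 2) := by
  have h := solvesODE_psi hk m
  refine mem_maxGraph_of_contDiffOn _ (h.contDiffOn (contDiffOn_bPot k m) contDiffOn_const)
    (memLp_psi hk hm).coeFn_toLp ?_
  have hp := (memLp_psi hk hm).coeFn_toLp
  filter_upwards [ae_restrict_mem measurableSet_Ioi, hp,
    Lp.coeFn_neg (k ^ 2 • (memLp_psi hk hm).toLp),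
    Lp.coeFn_smul (k ^ 2) (memLp_psi hk hm).toLp] with x hx h1 h2 h3
  rw [h.expr_eq hx, h2, Pi.neg_apply, h3, Pi.smul_apply, h1]
  simp

/-- If ψ_m vanished identically, the first order system at x = 1 would force ψ_{m+1}(1) = 0 too, and
the Wronskian would be zero. -/
theorem psi_not_ae_zero {k : ℂ} (hk : 0 < k.re)
    {m : ℂ} (hm : -1 < m.re) : ¬ psi k m =ᵐ[halfLineMeasure] 0 := by
  intro h
  have h1 : EqOn (psi k m) 0 (Ioi 0) :=
    Measure.eqOn_open_of_ae_eq h isOpen_Ioi (solvesODE_psi hk m).continuousOn continuousOn_const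
  have hd := (besselPair_psi hk m).left 1 one_pos
  have hd0 : HasDerivAt (psi k m) 0 1 := by
    refine (hasDerivAt_const (1 : ℝ) (0 : ℂ)).congr_of_eventuallyEq ?_
    filter_upwards [Ioi_mem_nhds one_pos] with y hy using h1 hy
  have h2 := hd.unique hd0
  have h3 : psi k m 1 = 0 := h1 (mem_Ioi.2 one_pos)
  have hk0 : k ≠ 0 := fun h => by simp [h] at hk
  rw [h3, mul_zero, zero_add, mul_eq_zero, or_iff_right (neg_ne_zero.2 hk0)] at h2
  exact wronsk_ne_zero hk hm (by rw [wronsk, h2, h3]; ring)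

theorem exists_test_integral_psi_eq_one {k : ℂ} (hk : 0 < k.re) {m : ℂ} (hm : -1 < m.re) :
    ∃ g : 𝓓(halfLine, ℂ), ∫ x, psi k m x * g x ∂halfLineMeasure = 1 := by
  by_contra! hcon
  refine psi_not_ae_zero hk hm (ae_eq_zero_of_integral_test
    ((solvesODE_psi hk m).continuousOn.locallyIntegrableOn measurableSet_Ioi) fun g => ?_)
  by_contra hne
  refine hcon ((∫ x, psi k m x * g x ∂halfLineMeasure)⁻¹ • g) ?_
  rw [← inv_mul_cancel₀ hne, ← integral_const_mul]
  refine integral_congr_ae (Eventually.of_forall fun x => ?_)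
  change psi k m x * (_ * g x) = _
  ring

/-- An `L²` function that annihilates all test functions orthogonal to `psi` is a multiple of it. -/
theorem exists_eq_mul_psi {k : ℂ} (hk : 0 < k.re) {m : ℂ} (hm : -1 < m.re) {f : HalfLineL2}
    (h : ∀ g : 𝓓(halfLine, ℂ), ∫ x, psi k m x * g x ∂halfLineMeasure = 0 → pair f (testLp g) = 0) :
    ∃ c : ℂ, f =ᵐ[halfLineMeasure] fun x => c * psi k m x := by
  obtain ⟨g₀, hg₀⟩ := exists_test_integral_psi_eq_one hk hm
  have hψ := (solvesODE_psi hk m).continuousOn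
  have int (g : 𝓓(halfLine, ℂ)) : Integrable (fun x => psi k m x * g x) halfLineMeasure :=
    (integrable_mul_test hψ g).integrableOn
  have intf (g : 𝓓(halfLine, ℂ)) : Integrable (fun x => f x * g x) halfLineMeasure :=
    (Lp.memLp f).integrable_mul (memLp_test g)
  refine ⟨pair f (testLp g₀), ?_⟩
  set c := pair f (testLp g₀) with hc
  have hz := ae_eq_zero_of_integral_test (f := fun x => f x - c * psi k m x)
    ((locallyIntegrableOn_L2 f).sub ((continuousOn_const.mul hψ).locallyIntegrableOn
      measurableSet_Ioi)) fun g => ?_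
  · filter_upwards [hz] with x hx using sub_eq_zero.1 hx
  set a := ∫ x, psi k m x * g x ∂halfLineMeasure with ha
  have hadd (x : ℝ) : (g + (-a) • g₀ : 𝓓(halfLine, ℂ)) x = g x - a * g₀ x := by
    change g x + -a * g₀ x = _
    ring
  -- Subtracting a multiple of g₀, for which ∫ ψ g₀ = 1, moves any test function into the
  -- annihilator of ψ.
  have h1 := h (g + (-a) • g₀) ?_
  · rw [pair_testLp] at h1 hc
    simp only [hadd, mul_sub, mul_left_comm _ a] at h1
    rw [integral_sub (intf g) ((intf g₀).const_mul a), integral_const_mul, ← hc] at h1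
    simp only [sub_mul, mul_assoc]
    rw [integral_sub (intf g) ((int g).const_mul c), integral_const_mul, ← ha]
    linear_combination h1
  · simp only [hadd, mul_sub, mul_left_comm _ a]
    rw [integral_sub (int g) ((int g₀).const_mul a), integral_const_mul, hg₀, ← ha]
    ring

/-- Near 0, |x^m K_m(kx)| is bounded below, hence |ψ|² ≥ c x^{1 - 2 Re m} ≥ c/x when Re m ≥ 1, which
is not integrable. -/
theorem not_memLp_psi {k : ℂ} (hk : 0 < k.re)
    {m : ℂ} (hm : 1 ≤ m.re) : ¬ MemLp (psi k m) 2 halfLineMeasure := by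
  intro h
  have hL := logGamma_ne_zero (k := k / 2) (m := m) (by simpa using hk) (by linarith)
  have ht := (tendsto_cpow_mul_bK hk (m := m) (by linarith)).norm
  have hL0 := norm_pos_iff.2 hL
  have hev := ht.eventually (lt_mem_nhds (half_lt_self hL0))
  set L := ‖logGamma (k / 2) m‖ / 2 with hLd
  have hLp : 0 < L := half_pos hL0
  obtain ⟨δ, hδ, hsub⟩ := (mem_nhdsGT_iff_exists_Ioo_subset' one_pos).1
    (inter_mem hev (Ioo_mem_nhdsGT (zero_lt_one' ℝ)))
  have hδ0 : (0 : ℝ) < δ := hδ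
  have hint : IntegrableOn (fun x => ‖psi k m x‖ ^ 2) (Ioo 0 δ) volume :=
    IntegrableOn.mono_set (t := Ioi 0) ((memLp_two_iff_integrable_sq_norm h.1).1 h) fun x hx => hx.1
  have hpow : IntegrableOn (fun x : ℝ => x ^ (-1 : ℝ)) (Ioo 0 δ) volume := by
    refine Integrable.mono' (hint.const_mul (1 / L ^ 2)) (by fun_prop) ?_
    filter_upwards [ae_restrict_mem measurableSet_Ioo] with x hx
    obtain ⟨h1, h2⟩ := hsub hx
    have hx0 := hx.1
    have h1' : L < ‖(x : ℂ) ^ m * bK k m x‖ := h1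
    rw [norm_mul, norm_ofReal_cpow _ hx0] at h1'
    rw [psi, norm_mul, Complex.norm_real, Real.norm_of_nonneg (Real.sqrt_nonneg x), mul_pow,
      Real.sq_sqrt hx0.le, Real.norm_of_nonneg (by positivity), Real.rpow_neg_one]
    have h3 : x ^ m.re ≤ x := by
      simpa using Real.rpow_le_rpow_of_exponent_ge hx0 h2.2.le hm
    have h4 : L ≤ x * ‖bK k m x‖ := h1'.le.trans (by gcongr)
    have h5 : L ^ 2 ≤ (x * ‖bK k m x‖) ^ 2 := by gcongr
    rw [inv_eq_one_div, div_mul_eq_mul_div, div_le_div_iff₀ hx0 (by positivity)]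
    nlinarith
  exact absurd ((intervalIntegral.integrableOn_Ioo_rpow_iff hδ0).1 hpow) (by norm_num)

theorem eq_zero_of_eq_mul_psi {k : ℂ} (hk : 0 < k.re)
    {m : ℂ} (hm : 1 ≤ m.re) {f : HalfLineL2} {c : ℂ}
    (h : f =ᵐ[halfLineMeasure] fun x => c * psi k m x) : f = 0 := by
  by_cases hc : c = 0
  · subst hc
    refine Lp.ext (h.trans (EventuallyEq.trans ?_ (Lp.coeFn_zero _ _ _).symm))
    exact Eventually.of_forall fun x => by simp
  · refine absurd ?_ (not_memLp_psi hk hm)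
    have h1 := ((memLp_congr_ae h).1 (Lp.memLp f)).const_mul c⁻¹
    simpa [hc] using h1

/-- The coefficient of x^{1/2+m} ξ is proportional to ∫ ψ g. Thus the range of L^min + k² contains
every test function annihilated by ψ, the fact behind all comparisons of the three operators. -/
theorem greenOp_test_mem_of_integral_eq_zero {k : ℂ} (hk : 0 < k.re) {ξ : ℝ → ℝ} (hξ : IsCutoff ξ)
    {m : ℂ} (hm : -1 < m.re) {g : 𝓓(halfLine, ℂ)}
    (hg : ∫ x, psi k m x * g x ∂halfLineMeasure = 0) :
    (greenOp k m (testLp g), testLp g - k ^ 2 • greenOp k m (testLp g))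
      ∈ (testGraph (m ^ 2)).topologicalClosure := by
  have := greenOp_test_sub_mem hk hξ hm g
  rwa [hg, mul_zero, zero_smul, sub_zero] at this

/-- The kernel of L^max + k² annihilates the range of L^min + k², hence all test functions
orthogonal to ψ. This holds whether or not ψ is square integrable. -/
theorem exists_eq_mul_psi_of_mem_maxGraph {k : ℂ} (hk : 0 < k.re) {ξ : ℝ → ℝ} (hξ : IsCutoff ξ)
    {m : ℂ} (hm : -1 < m.re) {f : HalfLineL2}
    (hf : (f, -(k ^ 2 • f)) ∈ maxGraph (m ^ 2)) :
    ∃ c : ℂ, f =ᵐ[halfLineMeasure] fun x => c * psi k m x := by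
  refine exists_eq_mul_psi hk hm fun g hg => ?_
  have := pair_max_min hf (greenOp_test_mem_of_integral_eq_zero hk hξ hm hg)
  simp only [← neg_smul, pair_sub_right, pair_smul_left, pair_smul_right] at this
  linear_combination this

/-! ### Comparison of the minimal operator, H_m and the maximal operator -/

theorem maxGraph_sub_greenOp {k : ℂ} (hk : 0 < k.re) {ξ : ℝ → ℝ} (hξ : IsCutoff ξ)
    {m : ℂ} (hm : -1 < m.re) {p : HalfLineL2 × HalfLineL2}
    (hp : p ∈ maxGraph (m ^ 2)) :
    (p.1 - greenOp k m (p.2 + k ^ 2 • p.1), -(k ^ 2 • (p.1 - greenOp k m (p.2 + k ^ 2 • p.1))))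
      ∈ maxGraph (m ^ 2) := by
  have h := sub_mem hp (graph_H_le_maxGraph ξ m (greenOp_mem_graph_H hk hξ hm (p.2 + k ^ 2 • p.1)))
  convert h using 1
  refine Prod.ext rfl ?_
  simp only [Prod.snd_sub]
  module

theorem closure_testGraph_eq_graph_H {k : ℂ} (hk : 0 < k.re) {ξ : ℝ → ℝ} (hξ : IsCutoff ξ)
    {m : ℂ} (hm : 1 ≤ m.re) :
    (testGraph (m ^ 2)).topologicalClosure = (H ξ m).graph := by
  have hm' : -1 < m.re := by linarith
  refine le_antisymm (closure_testGraph_le_graph_H hξ hm') fun p hp => ?_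
  have hcl : IsClosed {g : HalfLineL2 | (greenOp k m g, g - k ^ 2 • greenOp k m g)
      ∈ (testGraph (m ^ 2)).topologicalClosure} :=
    IsClosed.preimage (f := fun g : HalfLineL2 => (greenOp k m g, g - k ^ 2 • greenOp k m g))
      (by fun_prop) (Submodule.isClosed_topologicalClosure _)
  -- S consists of the g that the Green operator sends into the minimal domain. It is closed, and a
  -- vector orthogonal to it is the conjugate of a multiple of ψ, hence zero because ψ is not in L².
  -- So S is everything.
  let S : Submodule ℂ HalfLineL2 := (testGraph (m ^ 2)).topologicalClosure.comap
    ((greenOp k m : HalfLineL2 →ₗ[ℂ] HalfLineL2).prod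
      (LinearMap.id - k ^ 2 • (greenOp k m : HalfLineL2 →ₗ[ℂ] HalfLineL2)))
  have hScl : IsClosed (S : Set HalfLineL2) := hcl
  have hS : S.topologicalClosure = ⊤ := by
    rw [Submodule.topologicalClosure_eq_top_iff, Submodule.eq_bot_iff]
    intro f hf
    have hsf : star f = 0 := by
      obtain ⟨c, hc⟩ := exists_eq_mul_psi hk hm' (f := star f) fun g hg => by
        rw [← inner_eq_pair]
        exact (Submodule.mem_orthogonal' S f).1 hf _
          (greenOp_test_mem_of_integral_eq_zero hk hξ hm' hg)
      exact eq_zero_of_eq_mul_psi hk hm hc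
    rw [← star_star f, hsf, ← zero_smul ℂ (0 : HalfLineL2), star_smul_L2, star_zero, zero_smul, zero_smul]
  rw [hScl.submodule_topologicalClosure_eq] at hS
  have h1 : p.2 + k ^ 2 • p.1 ∈ S := hS ▸ Submodule.mem_top
  have h2 : (greenOp k m (p.2 + k ^ 2 • p.1), (p.2 + k ^ 2 • p.1)
    - k ^ 2 • greenOp k m (p.2 + k ^ 2 • p.1)) ∈ (testGraph (m ^ 2)).topologicalClosure := h1
  rw [resolvent_left hξ hm' (greenOp_mem_graph_H hk hξ hm') hp, add_sub_cancel_right] at h2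
  exact h2

theorem graph_H_eq_maxGraph {k : ℂ} (hk : 0 < k.re) {ξ : ℝ → ℝ} (hξ : IsCutoff ξ)
    {m : ℂ} (hm : 1 ≤ m.re) : (H ξ m).graph = maxGraph (m ^ 2) := by
  have hm' : -1 < m.re := by linarith
  refine le_antisymm (graph_H_le_maxGraph ξ m) fun p hp => ?_
  obtain ⟨c, hc⟩ := exists_eq_mul_psi_of_mem_maxGraph hk hξ hm' (maxGraph_sub_greenOp hk hξ hm' hp)
  have h0 := sub_eq_zero.1 (eq_zero_of_eq_mul_psi hk hm hc)
  have h1 := greenOp_mem_graph_H hk hξ hm' (p.2 + k ^ 2 • p.1)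
  rwa [← h0, add_sub_cancel_right] at h1

/-- Otherwise H_m would be contained in L^min and L^min + k² would be surjective. But for |Re m| < 1
its range is annihilated by the nonzero L² function ψ. -/
theorem wPair_notMem {k : ℂ} (hk : 0 < k.re) {ξ : ℝ → ℝ} (hξ : IsCutoff ξ)
    {m : ℂ} (hm : -1 < m.re) (hm1 : m.re < 1) :
    wPair hξ hm ∉ (testGraph (m ^ 2)).topologicalClosure := by
  intro h
  have habs : |m.re| < 1 := abs_lt.2 ⟨hm, hm1⟩
  have hH : (H ξ m).graph ≤ (testGraph (m ^ 2)).topologicalClosure := by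
    rw [graph_H hξ hm]
    exact sup_le le_rfl ((Submodule.span_singleton_le_iff_mem _ _).2 h)
  obtain ⟨g, hg⟩ := exists_test_integral_psi_eq_one hk hm
  have := pair_max_min (psi_mem_maxGraph hk habs) (hH (greenOp_mem_graph_H hk hξ hm (testLp g)))
  simp only [← neg_smul, pair_sub_right, pair_smul_left, pair_smul_right] at this
  have h1 : pair (memLp_psi hk habs).toLp (testLp g) = 1 := by
    rw [pair_testLp, ← hg]
    refine integral_congr_ae ?_
    filter_upwards [(memLp_psi hk habs).coeFn_toLp] with x hx
    rw [hx]
  exact one_ne_zero (h1.symm.trans (by linear_combination this))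

theorem psi_notMem_graph_H {k : ℂ} (hk : 0 < k.re) {ξ : ℝ → ℝ} (hξ : IsCutoff ξ)
    {m : ℂ} (hm : -1 < m.re) (habs : |m.re| < 1) :
    ((memLp_psi hk habs).toLp, -(k ^ 2 • (memLp_psi hk habs).toLp)) ∉ (H ξ m).graph := by
  intro h
  have h0 := H_injective hξ hm (greenOp_mem_graph_H hk hξ hm) h
  refine psi_not_ae_zero hk hm ((memLp_psi hk habs).coeFn_toLp.symm.trans ?_)
  rw [h0]
  exact Lp.coeFn_zero _ _ _

/-- Subtracting the Green operator applied to (L^max + k²)f from f leaves a solution of the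
homogeneous equation, hence a multiple of ψ. -/
theorem maxGraph_eq_sup {k : ℂ} (hk : 0 < k.re) {ξ : ℝ → ℝ} (hξ : IsCutoff ξ)
    {m : ℂ} (hm : -1 < m.re) (habs : |m.re| < 1) :
    maxGraph (m ^ 2) = (H ξ m).graph
      ⊔ Submodule.span ℂ {((memLp_psi hk habs).toLp, -(k ^ 2 • (memLp_psi hk habs).toLp))} := by
  refine le_antisymm (fun p hp => ?_) (sup_le (graph_H_le_maxGraph ξ m)
    ((Submodule.span_singleton_le_iff_mem _ _).2 (psi_mem_maxGraph hk habs)))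
  obtain ⟨c, hc⟩ := exists_eq_mul_psi_of_mem_maxGraph hk hξ hm (maxGraph_sub_greenOp hk hξ hm hp)
  have h1 := greenOp_mem_graph_H hk hξ hm (p.2 + k ^ 2 • p.1)
  refine Submodule.mem_sup.2 ⟨_, h1, _, Submodule.smul_mem _ c
    (Submodule.mem_span_singleton_self _), ?_⟩
  have h2 : p.1 - greenOp k m (p.2 + k ^ 2 • p.1) = c • (memLp_psi hk habs).toLp := by
    refine Lp.ext (hc.trans ?_)
    filter_upwards [Lp.coeFn_smul c (memLp_psi hk habs).toLp, (memLp_psi hk habs).coeFn_toLp]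
      with x h3 h4
    rw [h3, Pi.smul_apply, h4, smul_eq_mul]
  have h3 : p.1 = greenOp k m (p.2 + k ^ 2 • p.1) + c • (memLp_psi hk habs).toLp := by
    rw [← h2, add_sub_cancel]
  refine Prod.ext h3.symm ?_
  have h4 := congrArg (fun f => k ^ 2 • f) h3
  simp only [smul_add] at h4
  simp only [Prod.snd_add, Prod.smul_snd]
  generalize greenOp k m (p.2 + k ^ 2 • p.1) = f at h4 ⊢
  rw [h4, smul_neg, smul_comm c]
  abel

/-! ### Codimensions of domains -/

theorem codim_eq_one {E : Type*} [AddCommGroup E] [Module ℂ E] {p q : Submodule ℂ E} {v : E}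
    (hq : q = p ⊔ Submodule.span ℂ {v}) (hv : v ∉ p) : codim p q = 1 := by
  have hvq : v ∈ q := hq ▸ Submodule.mem_sup_right (Submodule.mem_span_singleton_self v)
  refine rank_eq_one (Submodule.Quotient.mk ⟨v, hvq⟩) ?_ fun w => ?_
  · rw [Ne, Submodule.Quotient.mk_eq_zero]
    exact hv
  · obtain ⟨⟨w, hw⟩, rfl⟩ := Submodule.Quotient.mk_surjective _ w
    obtain ⟨a, ha, b, hb, hab⟩ := Submodule.mem_sup.1 (hq ▸ hw)
    obtain ⟨c, rfl⟩ := Submodule.mem_span_singleton.1 hb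
    refine ⟨c, ?_⟩
    rw [← Submodule.Quotient.mk_smul, Submodule.Quotient.eq]
    change c • v - w ∈ p
    rw [← hab, sub_add_cancel_right]
    exact neg_mem ha

/-- The projection of a graph to its domain is injective, so a one-dimensional extension of graphs
is one of domains. -/
theorem codim_domain_eq_one {E : Type*} [AddCommGroup E] [Module ℂ E] {S T : E →ₗ.[ℂ] E}
    {v : E × E} (h : T.graph = S.graph ⊔ Submodule.span ℂ {v}) (hv : v ∉ S.graph) :
    codim S.domain T.domain = 1 := by
  have hvT : v ∈ T.graph := h ▸ Submodule.mem_sup_right (Submodule.mem_span_singleton_self v)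
  have hST : S.graph ≤ T.graph := h ▸ le_sup_left
  refine codim_eq_one (v := v.1) ?_ fun h1 => hv ?_
  · ext x
    rw [LinearPMap.mem_domain_iff, h]
    constructor
    · rintro ⟨y, hy⟩
      obtain ⟨a, ha, b, hb, hab⟩ := Submodule.mem_sup.1 hy
      obtain ⟨c, rfl⟩ := Submodule.mem_span_singleton.1 hb
      rw [show x = a.1 + c • v.1 from (congrArg Prod.fst hab).symm]
      exact Submodule.add_mem_sup (LinearPMap.mem_domain_of_mem_graph (y := a.2) ha)
        (Submodule.smul_mem _ c (Submodule.mem_span_singleton_self _))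
    · intro hx
      obtain ⟨a, ha, b, hb, rfl⟩ := Submodule.mem_sup.1 hx
      obtain ⟨c, rfl⟩ := Submodule.mem_span_singleton.1 hb
      obtain ⟨a', ha'⟩ := LinearPMap.mem_domain_iff.1 ha
      exact ⟨_, Submodule.add_mem_sup ha' (Submodule.smul_mem _ c
        (Submodule.mem_span_singleton_self _))⟩
  · obtain ⟨y, hy⟩ := LinearPMap.mem_domain_iff.1 h1
    have : y = v.2 := T.mem_graph_snd_inj (hST hy) hvT rfl
    rwa [this] at hy

theorem lt_of_graph_lt {E : Type*} [AddCommGroup E] [Module ℂ E] {S T : E →ₗ.[ℂ] E} {v : E × E}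
    (h : S.graph ≤ T.graph) (hT : v ∈ T.graph) (hS : v ∉ S.graph) : S < T :=
  lt_of_le_of_ne (LinearPMap.le_of_le_graph h) fun h' => hS (h' ▸ hT)

theorem Lmin_eq_H {ξ : ℝ → ℝ} (hξ : IsCutoff ξ) {m : ℂ} (hm : 1 ≤ m.re) : Lmin (m ^ 2) = H ξ m :=
  LinearPMap.eq_of_eq_graph (by
    rw [graph_Lmin, closure_testGraph_eq_graph_H (k := 1) (by simp) hξ hm])

theorem H_eq_Lmax {ξ : ℝ → ℝ} (hξ : IsCutoff ξ) {m : ℂ} (hm : 1 ≤ m.re) : H ξ m = Lmax (m ^ 2) :=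
  LinearPMap.eq_of_eq_graph (by rw [graph_Lmax, graph_H_eq_maxGraph (k := 1) (by simp) hξ hm])

theorem Lmin_lt_H_lt_Lmax {ξ : ℝ → ℝ} (hξ : IsCutoff ξ) {m : ℂ} (hm : -1 < m.re) (hm1 : m.re < 1) :
    Lmin (m ^ 2) < H ξ m ∧ H ξ m < Lmax (m ^ 2) ∧
      codim (Lmin (m ^ 2)).domain (H ξ m).domain = 1 ∧
      codim (H ξ m).domain (Lmax (m ^ 2)).domain = 1 := by
  have hk : 0 < (1 : ℂ).re := by simp
  have habs : |m.re| < 1 := abs_lt.2 ⟨hm, hm1⟩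
  have h1 := graph_H hξ hm
  rw [← graph_Lmin] at h1
  have h2 := maxGraph_eq_sup hk hξ hm habs
  rw [← graph_Lmax] at h2
  have h3 := wPair_notMem hk hξ hm hm1
  rw [← graph_Lmin] at h3
  have h4 := psi_notMem_graph_H hk hξ hm habs
  refine ⟨lt_of_graph_lt (h1 ▸ le_sup_left) (h1 ▸ Submodule.mem_sup_right
    (Submodule.mem_span_singleton_self _)) h3, lt_of_graph_lt (h2 ▸ le_sup_left)
    (h2 ▸ Submodule.mem_sup_right (Submodule.mem_span_singleton_self _)) h4,
    codim_domain_eq_one h1 h3, codim_domain_eq_one h2 h4⟩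

theorem adjoint_H_eq {ξ : ℝ → ℝ} (hξ : IsCutoff ξ) {m : ℂ} (hm : -1 < m.re) : (H ξ m).adjoint = H ξ (star m) :=
  adjoint_H hξ hm (greenOp_mem_graph_H (k := 1) (by simp) hξ hm)

/-! ### Holomorphic dependence on the index -/

theorem norm_dslope_le_of_bound {f : ℂ → ℂ} {c : ℂ} {ρ M : ℝ}
    (hf : DifferentiableOn ℂ f (Metric.ball c ρ)) (hM : ∀ z ∈ Metric.ball c ρ, ‖f z‖ ≤ M)
    {z : ℂ} (hz : z ∈ Metric.ball c ρ) : ‖dslope f c z‖ ≤ 2 * M / ρ := by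
  have hρ : 0 < ρ := Metric.pos_of_mem_ball hz
  -- Schwarz's lemma: f maps the ball into the closed ball of radius 2M about f(c).
  refine Complex.norm_dslope_le_div_of_mapsTo_ball hf (fun w hw => ?_) hz
  rw [mem_closedBall_iff_norm]
  have := hM w hw
  have := hM c (Metric.mem_ball_self hρ)
  exact (norm_sub_le _ _).trans (by linarith)

/-- A second order Taylor estimate for bounded holomorphic functions. -/
theorem norm_taylor_le_of_bound {f : ℂ → ℂ} {c : ℂ} {ρ M : ℝ}
    (hf : DifferentiableOn ℂ f (Metric.ball c ρ)) (hM : ∀ z ∈ Metric.ball c ρ, ‖f z‖ ≤ M)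
    {z : ℂ} (hz : z ∈ Metric.ball c ρ) :
    ‖f z - f c - (z - c) * deriv f c‖ ≤ 4 * M / ρ ^ 2 * ‖z - c‖ ^ 2 := by
  have hρ : 0 < ρ := Metric.pos_of_mem_ball hz
  have h1 : DifferentiableOn ℂ (dslope f c) (Metric.ball c ρ) :=
    (Complex.differentiableOn_dslope (Metric.ball_mem_nhds c hρ)).2 hf
  have h2 := norm_dslope_le_of_bound h1 (fun w hw => norm_dslope_le_of_bound hf hM hw) hz
  -- The Taylor remainder is (z - c)² times the divided slope iterated twice; bounding the slope
  -- twice gives 2·(2M/ρ)/ρ = 4M/ρ².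
  have e : f z - f c - (z - c) * deriv f c = (z - c) ^ 2 * dslope (dslope f c) c z := by
    have e1 := sub_smul_dslope f c z
    have e2 := sub_smul_dslope (dslope f c) c z
    rw [dslope_same, smul_eq_mul] at e2
    rw [smul_eq_mul] at e1
    linear_combination -e1 - (z - c) * e2
  rw [e, norm_mul, norm_pow, mul_comm]
  refine mul_le_mul_of_nonneg_right (h2.trans_eq ?_) (by positivity)
  field_simp
  ring

theorem HasKernel.sub_sub_smul {T₁ T₂ T₃ : HalfLineL2 →L[ℂ] HalfLineL2} {G₁ G₂ G₃ : ℝ → ℝ → ℂ}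
    {s κ C₁ C₂ C₃ : ℝ} (hs : s < 1) (hκ : 0 < κ) (hC₁ : 0 ≤ C₁) (hC₂ : 0 ≤ C₂) (hC₃ : 0 ≤ C₃)
    (hT₁ : HasKernel T₁ G₁) (hT₂ : HasKernel T₂ G₂) (hT₃ : HasKernel T₃ G₃)
    (hG₁ : KernelBound s κ C₁ G₁) (hG₂ : KernelBound s κ C₂ G₂) (hG₃ : KernelBound s κ C₃ G₃)
    (c : ℂ) :
    HasKernel (T₁ - T₂ - c • T₃) fun x y => G₁ x y - G₂ x y - c * G₃ x y := by
  intro g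
  have e : (T₁ - T₂ - c • T₃) g = T₁ g - T₂ g - c • T₃ g := rfl
  rw [e]
  filter_upwards [hT₁ g, hT₂ g, hT₃ g, Lp.coeFn_sub (T₁ g - T₂ g) (c • T₃ g),
    Lp.coeFn_sub (T₁ g) (T₂ g), Lp.coeFn_smul c (T₃ g), ae_restrict_mem measurableSet_Ioi]
    with x h1 h2 h3 h4 h5 h6 hx
  have i1 : Integrable (fun y => G₁ x y * g y) halfLineMeasure :=
    (hG₁.memLp hC₁ hs hκ hx).integrable_mul (Lp.memLp g)
  have i2 : Integrable (fun y => G₂ x y * g y) halfLineMeasure :=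
    (hG₂.memLp hC₂ hs hκ hx).integrable_mul (Lp.memLp g)
  have i3 : Integrable (fun y => G₃ x y * g y) halfLineMeasure :=
    (hG₃.memLp hC₃ hs hκ hx).integrable_mul (Lp.memLp g)
  have i12 : Integrable (fun y => G₁ x y * g y - G₂ x y * g y) halfLineMeasure := i1.sub i2
  rw [h4, Pi.sub_apply, h5, Pi.sub_apply, h6, Pi.smul_apply, h1, h2, h3, smul_eq_mul,
    ← integral_const_mul, ← integral_sub i1 i2, ← integral_sub i12 (i3.const_mul c)]
  refine integral_congr_ae (Eventually.of_forall fun y => ?_)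
  simp only
  ring

/-- The second order Taylor remainder of the kernel is bounded by |m - n|² times the envelope.
`exists_hasKernel` turns this into an operator norm bound, so the operator whose kernel is ∂G/∂m is
the derivative in norm. -/
theorem differentiableAt_of_hasKernel {T : ℂ → HalfLineL2 →L[ℂ] HalfLineL2}
    {G : ℂ → ℝ → ℝ → ℂ} {s κ C ρ : ℝ} {n : ℂ} (hs : s < 1) (hκ : 0 < κ) (hC : 0 ≤ C) (hρ : 0 < ρ)
    (hT : ∀ m ∈ Metric.ball n ρ, HasKernel (T m) (G m))
    (hG : ∀ m ∈ Metric.ball n ρ, KernelBound s κ C (G m))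
    (hd : ∀ x y, DifferentiableOn ℂ (fun m => G m x y) (Metric.ball n ρ)) :
    DifferentiableAt ℂ T n := by
  obtain ⟨A, hA0, hA⟩ := exists_hasKernel hs hκ
  have hn : n ∈ Metric.ball n ρ := Metric.mem_ball_self hρ
  have hnhds := Metric.ball_mem_nhds n hρ
  set G' : ℝ → ℝ → ℂ := fun x y => deriv (fun m => G m x y) n with hG'
  have hbound (x y : ℝ) (hx : 0 < x) (hy : 0 < y) :
      ∀ z ∈ Metric.ball n ρ, ‖G z x y‖ ≤ C * envelope s κ x y :=
    fun z hz => (hG z hz).bound x y hx hy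
  -- The derivative kernel is the pointwise limit of difference quotients along a sequence, which
  -- makes it jointly measurable.
  have hmeas : Measurable (Function.uncurry G') := by
    obtain ⟨w, hw1, hw2⟩ : ∃ w : ℕ → ℂ, (∀ j, w j ∈ Metric.ball n ρ ∧ w j ≠ n) ∧
        Tendsto w atTop (𝓝 n) := by
      refine ⟨fun j => n + ((ρ / (j + 2) : ℝ) : ℂ), fun j => ⟨?_, ?_⟩, ?_⟩
      · rw [mem_ball_iff_norm, add_sub_cancel_left, Complex.norm_real, Real.norm_of_nonneg (by positivity)]
        exact div_lt_self hρ (by linarith [(Nat.cast_nonneg j : (0 : ℝ) ≤ j)])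
      · have : (ρ / (j + 2) : ℝ) ≠ 0 := by positivity
        simpa only [ne_eq, add_eq_left, Complex.ofReal_eq_zero] using this
      · have h1 : Tendsto (fun j : ℕ => ρ / ((j : ℝ) + 2)) atTop (𝓝 0) :=
          tendsto_const_nhds.div_atTop (tendsto_natCast_atTop_atTop.atTop_add tendsto_const_nhds)
        have h2 := (Complex.continuous_ofReal.tendsto 0).comp h1
        simpa using h2.const_add n
    refine measurable_of_tendsto_metrizable
      (f := fun j p => (w j - n)⁻¹ * (Function.uncurry (G (w j)) p - Function.uncurry (G n) p))
      (fun j => ((hG _ (hw1 j).1).measurable.sub (hG n hn).measurable).const_mul _) ?_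
    rw [tendsto_pi_nhds]
    rintro ⟨x, y⟩
    have h1 := ((hd x y).differentiableAt hnhds).hasDerivAt.tendsto_slope
    have h2 : Tendsto w atTop (𝓝[≠] n) :=
      tendsto_nhdsWithin_iff.2 ⟨hw2, Eventually.of_forall fun j => (hw1 j).2⟩
    exact h1.comp h2
  have hbd : KernelBound s κ (2 * C / ρ) G' := by
    refine ⟨hmeas, fun x y hx hy => ?_⟩
    have := norm_dslope_le_of_bound (hd x y) (hbound x y hx hy) hn
    rw [dslope_same] at this
    refine this.trans_eq ?_
    ring
  obtain ⟨T', hT', -⟩ := hA G' _ (by positivity) hbd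
  have key (m : ℂ) (hm : m ∈ Metric.ball n ρ) :
      ‖T m - T n - (m - n) • T'‖ ≤ A * (4 * C / ρ ^ 2 * ‖m - n‖ ^ 2) := by
    have hk := HasKernel.sub_sub_smul hs hκ hC hC (by positivity) (hT m hm) (hT n hn) hT'
      (hG m hm) (hG n hn) hbd (m - n)
    have hb : KernelBound s κ (4 * C / ρ ^ 2 * ‖m - n‖ ^ 2)
        fun x y => G m x y - G n x y - (m - n) * G' x y := by
      refine ⟨((hG m hm).measurable.sub (hG n hn).measurable).sub (hmeas.const_mul _),
        fun x y hx hy => ?_⟩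
      refine (norm_taylor_le_of_bound (hd x y) (hbound x y hx hy) hm).trans_eq ?_
      ring
    obtain ⟨S, hS, hSn⟩ := hA _ _ (by positivity) hb
    rwa [hk.unique hS]
  refine HasDerivAt.differentiableAt (f' := T') (hasDerivAt_iff_isLittleO.2 ?_)
  have hO : (fun m => T m - T n - (m - n) • T') =O[𝓝 n] fun m => ‖m - n‖ ^ 2 := by
    refine Asymptotics.IsBigO.of_bound (A * (4 * C / ρ ^ 2)) ?_
    filter_upwards [hnhds] with m hm
    rw [norm_pow, norm_norm, mul_assoc]
    exact key m hm
  refine hO.trans_isLittleO ?_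
  have h1 : (fun m : ℂ => m - n) =o[𝓝 n] fun _ => (1 : ℝ) := by
    rw [Asymptotics.isLittleO_one_iff]
    simpa using (continuous_sub_right n).tendsto n
  have h2 := h1.norm_left.mul_isBigO (Asymptotics.isBigO_refl (fun m : ℂ => ‖m - n‖) (𝓝 n))
  simp only [one_mul] at h2
  simpa only [sq] using h2.of_norm_right

theorem differentiableOn_greenOp {k : ℂ} (hk : 0 < k.re) :
    DifferentiableOn ℂ (greenOp k) {m | -1 < m.re} := by
  intro m₀ hm₀
  obtain ⟨s, hs, r, hr, C, hC, h⟩ := exists_kernelBound_green hk (show -1 < m₀.re from hm₀)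
  refine (differentiableAt_of_hasKernel hs hk hC hr
    (fun m hm => hasKernel_greenOp hk (h m hm).1) (fun m hm => (h m hm).2)
    fun x y => (differentiableOn_green hk x y).mono fun m hm => (h m hm).1).differentiableWithinAt

theorem isHolomorphicFamily_H {ξ : ℝ → ℝ} (hξ : IsCutoff ξ) :
    IsHolomorphicFamily {m : ℂ | -1 < m.re} (H ξ) := by
  have hopen : IsOpen {m : ℂ | -1 < m.re} := isOpen_lt continuous_const Complex.continuous_re
  have hk : 0 < (1 : ℂ).re := by simp
  -- With k = 1, B(m) = (H_m + 1)⁻¹ parametrizes the domain and H_m B(m) = 1 - B(m). A single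
  -- neighbourhood, the whole half-plane, serves for every point.
  refine ⟨hopen, fun m hm => isClosed_H hξ hm, fun m₀ hm₀ => ⟨_, hopen, hm₀, subset_rfl, HalfLineL2,
    inferInstance, inferInstance, inferInstance, greenOp 1,
    fun m => ContinuousLinearMap.id ℂ HalfLineL2 - greenOp 1 m, differentiableOn_greenOp hk,
    (differentiableOn_const _).sub (differentiableOn_greenOp hk), fun m hm => ?_⟩⟩
  have hR := greenOp_mem_graph_H hk hξ hm
  have hg (g : HalfLineL2) : (greenOp 1 m g, g - greenOp 1 m g) ∈ (H ξ m).graph := by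
    simpa using hR g
  refine ⟨?_, ?_, fun g => ?_⟩
  · rw [injective_iff_map_eq_zero]
    intro g h0
    have h1 := hg g
    rw [h0, sub_zero] at h1
    exact LinearPMap.graph_fst_eq_zero_snd _ h1 rfl
  · refine Subset.antisymm ?_ fun x hx => ?_
    · rintro _ ⟨g, rfl⟩
      exact LinearPMap.mem_domain_of_mem_graph (hg g)
    · obtain ⟨y, hy⟩ := LinearPMap.mem_domain_iff.1 hx
      exact ⟨_, resolvent_left hξ hm hR hy⟩
  · have hd := LinearPMap.mem_domain_of_mem_graph (hg g)
    exact ⟨hd, LinearPMap.mem_graph_snd_inj _ (LinearPMap.mem_graph _ ⟨_, hd⟩) (hg g) rfl⟩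

/-! ### Homogeneity -/

theorem norm_dilation (τ : ℝ) (f : HalfLineL2) : ‖dilation τ f‖ = ‖f‖ := by
  change ‖dilationFun τ f‖ = ‖f‖
  rw [Lp.norm_def, Lp.norm_def]
  congr 1
  have hf : AEStronglyMeasurable f (halfLineMeasure.map (fun x => Real.exp τ * x)) := by
    rw [map_dilation]
    exact (Lp.aestronglyMeasurable f).smul_measure _
  have h1 := eLpNorm_map_measure (p := 2) hf (f := fun x => Real.exp τ * x) (by fun_prop)
  rw [map_dilation, eLpNorm_smul_measure_of_ne_top (by norm_num)] at h1
  rw [eLpNorm_congr_ae (coeFn_dilationFun τ f)]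
  have h2 := eLpNorm_const_smul (p := 2) (μ := halfLineMeasure) (Real.exp (τ / 2) : ℂ)
    (f ∘ fun x => Real.exp τ * x)
  refine h2.trans ?_
  rw [← h1, ← ofReal_norm, Complex.norm_real, Real.norm_of_nonneg (Real.exp_pos _).le,
    smul_eq_mul, ← mul_assoc, ENNReal.ofReal_rpow_of_pos (Real.exp_pos _),
    ← ENNReal.ofReal_mul (Real.exp_pos _).le, ← Real.exp_mul, ← Real.exp_add]
  norm_num
  ring_nf
  norm_num

theorem continuous_dilation (τ : ℝ) : Continuous (dilation τ) :=
  AddMonoidHomClass.continuous_of_bound (dilation τ) 1 fun f => by rw [norm_dilation, one_mul]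

theorem expr_dilation (α c : ℂ) {l : ℝ} (hl : l ≠ 0) (u : ℝ → ℂ) (x : ℝ) :
    expr α (fun y => c * u (l * y)) x = l ^ 2 * (c * expr α u (l * x)) := by
  have h1 : deriv (fun y => c * u (l * y)) = fun y => c * l * deriv u (l * y) := by
    ext y
    rw [deriv_const_mul_field, deriv_comp_mul_left, Complex.real_smul]
    ring
  have h2 : deriv (fun y => c * l * deriv u (l * y)) x = c * l ^ 2 * deriv (deriv u) (l * x) := by
    rw [deriv_const_mul_field, deriv_comp_mul_left, Complex.real_smul]
    ring
  have hl' : (l : ℂ) ≠ 0 := Complex.ofReal_ne_zero.2 hl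
  rw [expr, expr, h1, h2, Complex.ofReal_mul]
  by_cases hx : (x : ℂ) = 0
  -- At x = 0 the potential is 0 on both sides because division by zero gives zero.
  · simp [hx]
    ring
  · field_simp

theorem contDiffOn_dilation {c : ℂ} {l : ℝ} (hl : 0 < l) {u : ℝ → ℂ}
    (hu : ContDiffOn ℝ ∞ u (Ioi 0)) : ContDiffOn ℝ ∞ (fun y => c * u (l * y)) (Ioi 0) :=
  contDiffOn_const.mul (hu.comp (by fun_prop) fun x hx => mem_Ioi.2 (mul_pos hl hx))

theorem mem_closure_testGraph_of_eventually_zero (α : ℂ) {u : ℝ → ℂ}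
    (hu : ContDiffOn ℝ ∞ u (Ioi 0)) (h0 : ∀ᶠ x in 𝓝[>] 0, u =ᶠ[𝓝 x] 0)
    (h1 : ∀ᶠ x in atTop, u =ᶠ[𝓝 x] 0) {p : HalfLineL2 × HalfLineL2}
    (hp1 : p.1 =ᵐ[halfLineMeasure] u) (hp2 : p.2 =ᵐ[halfLineMeasure] expr α u) :
    p ∈ (testGraph α).topologicalClosure := by
  have key {f : ℝ → ℂ} (hf : ContinuousOn f (Ioi 0)) (h : ∀ x, u =ᶠ[𝓝 x] 0 → f x = 0) :
      MemLp f 2 halfLineMeasure := by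
    refine memLp_of_isBigO hf (β := 0) (by norm_num) one_pos ?_ ?_
    · refine (Asymptotics.isBigO_zero _ _).congr' ?_ EventuallyEq.rfl
      filter_upwards [h0] with x hx using (h x hx).symm
    · refine (Asymptotics.isBigO_zero _ _).congr' ?_ EventuallyEq.rfl
      filter_upwards [h1] with x hx using (h x hx).symm
  have hofr : ContinuousOn (fun x : ℝ => (x : ℂ)) (Ioi 0) := by fun_prop
  have hne : ∀ x ∈ Ioi (0 : ℝ), (x : ℂ) ≠ 0 := fun x hx => Complex.ofReal_ne_zero.2 (ne_of_gt hx)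
  refine mem_closure_testGraph α hu (key hu.continuousOn fun x hx => hx.eq_of_nhds)
    (key ((contDiffOn_deriv hu).continuousOn.div hofr hne) fun x hx => ?_)
    (key (hu.continuousOn.div (hofr.pow 2) fun x hx => pow_ne_zero 2 (hne x hx)) fun x hx => ?_)
    (key (continuousOn_expr α hu) fun x hx => ?_) hp1 hp2
  · rw [hx.deriv_eq]
    simp
  · rw [hx.eq_of_nhds]
    simp
  · rw [expr_congr α hx]
    simp [expr, show (0 : ℝ → ℂ) = fun _ => 0 from rfl]

theorem eventually_nhds_dilation {l : ℝ} {u v : ℝ → ℂ} {x : ℝ}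
    (h : u =ᶠ[𝓝 (l * x)] v) : (fun y => u (l * y)) =ᶠ[𝓝 x] fun y => v (l * y) :=
  ((continuous_const_mul l).tendsto x).eventually h

theorem tendsto_mul_nhdsGT {l : ℝ} (hl : 0 < l) :
    Tendsto (fun x : ℝ => l * x) (𝓝[>] 0) (𝓝[>] 0) := by
  refine tendsto_nhdsWithin_iff.2 ⟨?_, ?_⟩
  · simpa using ((continuous_const_mul l).tendsto (0 : ℝ)).mono_left
      (nhdsWithin_le_nhds (s := Ioi 0))
  · filter_upwards [self_mem_nhdsWithin] with x hx using mul_pos hl hx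

/-- The map induced by a dilation on graphs. -/
def dilationPair (τ : ℝ) (p : HalfLineL2 × HalfLineL2) : HalfLineL2 × HalfLineL2 :=
  (dilation τ p.1, (Real.exp τ ^ 2 : ℂ) • dilation τ p.2)

theorem continuous_dilationPair (τ : ℝ) : Continuous (dilationPair τ) := by
  have := continuous_dilation τ
  unfold dilationPair
  fun_prop

theorem dilationPair_add (τ : ℝ) (p q : HalfLineL2 × HalfLineL2) :
    dilationPair τ (p + q) = dilationPair τ p + dilationPair τ q := by
  simp [dilationPair]

theorem dilationPair_smul (τ : ℝ) (c : ℂ) (p : HalfLineL2 × HalfLineL2) :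
    dilationPair τ (c • p) = c • dilationPair τ p := by
  simp only [dilationPair, Prod.smul_fst, Prod.smul_snd, map_smul, Prod.smul_mk]
  rw [smul_comm]

theorem coeFn_dilationPair (τ : ℝ) (α : ℂ) {p : HalfLineL2 × HalfLineL2} {u : ℝ → ℂ}
    (h1 : p.1 =ᵐ[halfLineMeasure] u) (h2 : p.2 =ᵐ[halfLineMeasure] expr α u) :
    (dilationPair τ p).1 =ᵐ[halfLineMeasure]
        (fun y => (Real.exp (τ / 2) : ℂ) * u (Real.exp τ * y)) ∧
      (dilationPair τ p).2 =ᵐ[halfLineMeasure]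
        expr α fun y => (Real.exp (τ / 2) : ℂ) * u (Real.exp τ * y) := by
  constructor
  · filter_upwards [coeFn_dilationFun τ p.1, (quasiMeasurePreserving_dilation τ).ae h1] with x h3 h4
    change dilationFun τ p.1 x = _
    rw [h3, h4]
  · filter_upwards [coeFn_dilationFun τ p.2, (quasiMeasurePreserving_dilation τ).ae h2,
      Lp.coeFn_smul (Real.exp τ ^ 2 : ℂ) (dilationFun τ p.2)] with x h3 h4 h5
    change ((Real.exp τ ^ 2 : ℂ) • dilationFun τ p.2 : HalfLineL2) x = _
    rw [h5, Pi.smul_apply, h3, h4, expr_dilation _ _ (Real.exp_pos τ).ne', smul_eq_mul]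

/-- Dilates of test functions are smooth and vanish near 0 and infinity, hence lie in the minimal
domain. Continuity of the dilation extends this to the closure. -/
theorem dilationPair_mem_closure (τ : ℝ) {α : ℂ} {p : HalfLineL2 × HalfLineL2}
    (hp : p ∈ (testGraph α).topologicalClosure) :
    dilationPair τ p ∈ (testGraph α).topologicalClosure := by
  have hcl : IsClosed {p | dilationPair τ p ∈ (testGraph α).topologicalClosure} :=
    (Submodule.isClosed_topologicalClosure (testGraph α)).preimage (continuous_dilationPair τ)
  refine closure_minimal (fun q hq => ?_) hcl hp
  obtain ⟨φ, h1, h2⟩ := hq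
  obtain ⟨h3, h4⟩ := coeFn_dilationPair τ α h1 h2
  obtain ⟨a, b, ha, hab⟩ := exists_Icc_of_test_pos φ
  have hl := Real.exp_pos τ
  have hφ0 : ∀ᶠ x in 𝓝[>] 0, φ =ᶠ[𝓝 x] 0 := by
    filter_upwards [Ioo_mem_nhdsGT ha] with x hx
    filter_upwards [Iio_mem_nhds hx.2] with y hy
    exact hab y fun h => absurd h.1 (not_le.2 hy)
  have hφ1 : ∀ᶠ x in atTop, φ =ᶠ[𝓝 x] 0 := by
    filter_upwards [eventually_gt_atTop b] with x hx
    filter_upwards [Ioi_mem_nhds hx] with y hy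
    exact hab y fun h => absurd h.2 (not_le.2 hy)
  refine mem_closure_testGraph_of_eventually_zero α (contDiffOn_dilation hl φ.contDiff.contDiffOn)
    ?_ ?_ h3 h4
  · filter_upwards [(tendsto_mul_nhdsGT hl).eventually hφ0] with x hx
    filter_upwards [eventually_nhds_dilation hx] with y hy
    simp [hy]
  · filter_upwards [(tendsto_id.const_mul_atTop hl).eventually hφ1] with x hx
    filter_upwards [eventually_nhds_dilation hx] with y hy
    simp [hy]

theorem dilationPair_wPair_mem {ξ : ℝ → ℝ} (hξ : IsCutoff ξ) {m : ℂ} (hm : -1 < m.re)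
    (τ : ℝ) : dilationPair τ (wPair hξ hm) ∈ (H ξ m).graph := by
  have hl := Real.exp_pos τ
  set l := Real.exp τ with hldef
  set b : ℂ := (Real.exp (τ / 2) : ℂ) with hb
  -- The pure power is an eigenfunction of the dilation with eigenvalue c. So the dilate of
  -- x^{1/2+m} ξ minus c times itself vanishes near 0 and near infinity and lies in the minimal
  -- domain.
  set c : ℂ := b * (l : ℂ) ^ (1 / 2 + m) with hc
  obtain ⟨h1, h2⟩ := coeFn_dilationPair τ (m ^ 2) (p := wPair hξ hm)
    (memLp_wFun hξ hm).coeFn_toLp (memLp_expr_wFun hξ m).coeFn_toLp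
  have hw := contDiffOn_wFun hξ m
  have hdw := contDiffOn_dilation (c := b) hl hw
  have key : dilationPair τ (wPair hξ hm) - c • wPair hξ hm
      ∈ (testGraph (m ^ 2)).topologicalClosure := by
    refine mem_closure_testGraph_of_eventually_zero (m ^ 2)
      (u := fun y => b * wFun ξ m (l * y) - c * wFun ξ m y) (hdw.sub (contDiffOn_const.mul hw))
      ?_ ?_ ?_ ?_
    · filter_upwards [(tendsto_mul_nhdsGT hl).eventually (wFun_eventuallyEq_zero hξ m),
        wFun_eventuallyEq_zero hξ m, self_mem_nhdsWithin] with x h3 h4 hx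
      filter_upwards [eventually_nhds_dilation h3, h4, Ioi_mem_nhds hx] with y h5 h6 hy
      have hy0 : (0 : ℝ) < y := hy
      rw [h5, h6, Complex.ofReal_mul, Complex.mul_cpow_ofReal_nonneg hl.le hy0.le, hc, Pi.zero_apply]
      ring
    · filter_upwards [(tendsto_id.const_mul_atTop hl).eventually (wFun_eventuallyEq_atTop hξ m),
        wFun_eventuallyEq_atTop hξ m] with x h3 h4
      filter_upwards [eventually_nhds_dilation h3, h4] with y h5 h6
      simp [h5, h6]
    · filter_upwards [h1, Lp.coeFn_sub (dilationPair τ (wPair hξ hm)).1 (c • (wPair hξ hm).1),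
        Lp.coeFn_smul c (wPair hξ hm).1, (memLp_wFun hξ hm).coeFn_toLp] with x h3 h4 h5 h6
      change ((dilationPair τ (wPair hξ hm)).1 - c • (wPair hξ hm).1 : HalfLineL2) x = _
      rw [h4, Pi.sub_apply, h3, h5, Pi.smul_apply, smul_eq_mul, show (wPair hξ hm).1 x = _ from h6]
    · filter_upwards [h2, Lp.coeFn_sub (dilationPair τ (wPair hξ hm)).2 (c • (wPair hξ hm).2),
        Lp.coeFn_smul c (wPair hξ hm).2, (memLp_expr_wFun hξ m).coeFn_toLp,
        ae_restrict_mem measurableSet_Ioi] with x h3 h4 h5 h6 hx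
      change ((dilationPair τ (wPair hξ hm)).2 - c • (wPair hξ hm).2 : HalfLineL2) x = _
      rw [h4, Pi.sub_apply, h3, h5, Pi.smul_apply, smul_eq_mul, show (wPair hξ hm).2 x = _ from h6,
        expr_sub_smul (m ^ 2) c hdw hw hx]
  rw [graph_H hξ hm]
  exact Submodule.mem_sup.2 ⟨_, key, _, Submodule.smul_mem _ c
    (Submodule.mem_span_singleton_self _), sub_add_cancel _ _⟩

theorem dilationPair_mem_graph_H {ξ : ℝ → ℝ} (hξ : IsCutoff ξ) {m : ℂ} (hm : -1 < m.re)
    (τ : ℝ) {p : HalfLineL2 × HalfLineL2} (hp : p ∈ (H ξ m).graph) :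
    dilationPair τ p ∈ (H ξ m).graph := by
  rw [graph_H hξ hm] at hp
  obtain ⟨a, ha, b, hb, rfl⟩ := Submodule.mem_sup.1 hp
  obtain ⟨c, rfl⟩ := Submodule.mem_span_singleton.1 hb
  rw [dilationPair_add, dilationPair_smul]
  exact add_mem (closure_testGraph_le_graph_H hξ hm (dilationPair_mem_closure τ ha))
    (Submodule.smul_mem _ c (dilationPair_wPair_mem hξ hm τ))

theorem isHomogeneous_H {ξ : ℝ → ℝ} (hξ : IsCutoff ξ) {m : ℂ} (hm : -1 < m.re) :
    IsHomogeneous (H ξ m) (-2) := by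
  intro τ
  have key (x : HalfLineL2) (hx : x ∈ (conjugate (dilation τ) (H ξ m)).domain) :
      (x, (Real.exp τ ^ 2 : ℂ) • conjugate (dilation τ) (H ξ m) ⟨x, hx⟩) ∈ (H ξ m).graph := by
    have h1 : (dilation τ).symm x ∈ (H ξ m).domain := hx
    have h2 := dilationPair_mem_graph_H hξ hm τ ((H ξ m).mem_graph ⟨_, h1⟩)
    rw [dilationPair] at h2
    simp only [LinearEquiv.apply_symm_apply] at h2
    exact h2
  refine LinearPMap.ext ?_ fun x h1 h2 => ?_
  · ext x
    refine ⟨fun hx => show x ∈ (H ξ m).domain from LinearPMap.mem_domain_of_mem_graph (key x hx),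
      fun hx => ?_⟩
    -- The reverse inclusion of domains uses invariance under the inverse dilation.
    have h3 := dilationPair_mem_graph_H hξ hm (-τ) ((H ξ m).mem_graph ⟨x, hx⟩)
    exact show dilation (-τ) x ∈ (H ξ m).domain from LinearPMap.mem_domain_of_mem_graph h3
  · have h3 := LinearPMap.mem_graph_snd_inj _ ((H ξ m).mem_graph ⟨x, h2⟩) (key x h1) rfl
    rw [LinearPMap.smul_apply]
    change _ = (Real.exp (-2 * τ) : ℂ) • H ξ m ⟨x, h2⟩
    rw [show H ξ m ⟨x, h2⟩ = _ from h3, smul_smul, ← Complex.ofReal_pow, ← Complex.ofReal_mul,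
      ← Real.exp_nat_mul, ← Real.exp_add]
    simp

/-! ### The spectrum -/

theorem neg_sq_mem_resolventSet {ξ : ℝ → ℝ} (hξ : IsCutoff ξ) {m : ℂ} (hm : -1 < m.re)
    {k : ℂ} (hk : 0 < k.re) : -k ^ 2 ∈ resolventSet (H ξ m) :=
  mem_resolventSet_of_graph (greenOp_mem_graph_H hk hξ hm)
    fun _ hp => resolvent_left hξ hm (greenOp_mem_graph_H hk hξ hm) hp

/-- k is the principal square root of -z; Re √w = √((|w| + Re w)/2) vanishes only for w on the
closed negative axis. -/
theorem exists_neg_sq_eq {z : ℂ} (hz : ¬ ∃ r : ℝ, 0 ≤ r ∧ z = r) : ∃ k : ℂ, 0 < k.re ∧ -k ^ 2 = z := by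
  refine ⟨(-z) ^ (2⁻¹ : ℂ), ?_, ?_⟩
  · rw [Complex.cpow_inv_two_re]
    refine Real.sqrt_pos.2 (half_pos ?_)
    have h1 : |(-z).re| ≤ ‖-z‖ := Complex.abs_re_le_norm _
    have h2 := neg_abs_le (-z).re
    refine lt_of_le_of_ne (by linarith) fun h => hz ?_
    have h3 : |(-z).re| = ‖-z‖ := by
      refine le_antisymm h1 ?_
      linarith
    rw [Complex.abs_re_eq_norm] at h3
    have h4 : z.im = 0 := by simpa using h3
    refine ⟨z.re, ?_, Complex.ext rfl (by simpa using h4)⟩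
    have h5 : (-z).re = -z.re := rfl
    have := norm_nonneg (-z)
    linarith
  · have := Complex.cpow_nat_inv_pow (-z) (n := 2) two_ne_zero
    rw [Nat.cast_ofNat] at this
    rw [this, neg_neg]

/-- A rescaled resolvent bound. -/
theorem norm_le_of_mem_resolventSet {ξ : ℝ → ℝ} (hξ : IsCutoff ξ) {m : ℂ} (hm : -1 < m.re)
    {z : ℂ} (hz : z ∈ resolventSet (H ξ m)) :
    ∃ C : ℝ, 0 ≤ C ∧ ∀ n : ℕ, 0 < n → ∀ p ∈ (H ξ m).graph,
      n ^ 2 * ‖p.1‖ ≤ C * ‖(n ^ 2 * z) • p.1 - p.2‖ := by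
  obtain ⟨R, -, hR⟩ := hz
  have hb (p : HalfLineL2 × HalfLineL2) (hp : p ∈ (H ξ m).graph) : ‖p.1‖ ≤ ‖R‖ * ‖z • p.1 - p.2‖ := by
    obtain ⟨x, hx1, hx2⟩ := (LinearPMap.mem_graph_iff _).1 hp
    have := hR x
    rw [hx1, hx2] at this
    calc ‖p.1‖ = ‖R (z • p.1 - p.2)‖ := by rw [this]
      _ ≤ _ := R.le_opNorm _
  refine ⟨‖R‖, norm_nonneg _, fun n hn p hp => ?_⟩
  have hn0 : (0 : ℝ) < n := Nat.cast_pos.2 hn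
  have hn1 : (n : ℂ) ≠ 0 := Nat.cast_ne_zero.2 hn.ne'
  -- Dilation by the factor 1/n multiplies H_m by n⁻², so the bound at z becomes one at n²z with a
  -- gain of n².
  have h := hb _ (dilationPair_mem_graph_H hξ hm (-Real.log n) hp)
  have e1 : Real.exp (-Real.log n) = (n : ℝ)⁻¹ := by rw [Real.exp_neg, Real.exp_log hn0]
  have e2 : z • (dilationPair (-Real.log n) p).1 - (dilationPair (-Real.log n) p).2
      = ((n : ℂ)⁻¹ ^ 2) • dilation (-Real.log n) ((n ^ 2 * z) • p.1 - p.2) := by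
    rw [dilationPair, e1, map_sub, map_smul, smul_sub, smul_smul]
    congr 2
    · field_simp
    · push_cast
      rfl
  rw [e2, norm_smul, norm_dilation, norm_pow, norm_inv, RCLike.norm_natCast] at h
  rw [show ‖(dilationPair (-Real.log n) p).1‖ = ‖p.1‖ from norm_dilation _ _] at h
  calc n ^ 2 * ‖p.1‖ ≤ n ^ 2 * (‖R‖ * ((n : ℝ)⁻¹ ^ 2 * ‖((n : ℂ) ^ 2 * z) • p.1 - p.2‖)) := by gcongr
    _ = _ := by field_simp

theorem expr_test_mul_exp (α : ℂ) (η : 𝓓(halfLine, ℂ)) (c : ℂ) {x : ℝ} :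
    expr α (fun y => η y * Complex.exp (c * y)) x
      = Complex.exp (c * x) * (expr α η x - 2 * c * deriv η x - c ^ 2 * η x) := by
  have he (y : ℝ) : HasDerivAt (fun y : ℝ => Complex.exp (c * y)) (c * Complex.exp (c * y)) y := by
    have := (((hasDerivAt_id (y : ℂ)).const_mul c).cexp).comp_ofReal
    simpa [mul_comm] using this
  have h1 (y : ℝ) : HasDerivAt η (deriv η y) y :=
    (η.contDiff.differentiable (by simp) y).hasDerivAt
  have h2 (y : ℝ) : HasDerivAt (deriv η) (deriv (deriv η) y) y :=
    ((contDiff_deriv η).differentiable (by simp) y).hasDerivAt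
  refine (expr_eq_of_hasDerivAt α (Eventually.of_forall fun y => (h1 y).mul (he y))
    (((h2 x).mul (he x)).add ((h1 x).mul ((he x).const_mul c)))).trans ?_
  rw [expr, Pi.mul_apply]
  ring

/-- Multiplication of a test function by a plane wave. -/
def waveTest (η : 𝓓(halfLine, ℂ)) (c : ℂ) : 𝓓(halfLine, ℂ) :=
  ⟨fun y => η y * Complex.exp (c * y), by
    refine η.contDiff.mul (ContDiff.cexp (contDiff_const.mul Complex.ofRealCLM.contDiff)),
    η.hasCompactSupport.mul_right, by
      refine (closure_mono fun x hx => ?_).trans η.tsupport_subset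
      exact left_ne_zero_of_mul hx⟩

/-- A fixed test function η times e^{in√r x} is an approximate eigenfunction for n²r with error
O(n), since the terms of order n² cancel. Its norm is that of η, whereas the rescaled resolvent
bound would require n²‖η‖ = O(n). -/
theorem ofReal_mem_spectrum {ξ : ℝ → ℝ} (hξ : IsCutoff ξ) {m : ℂ} (hm : -1 < m.re)
    {r : ℝ} (hr : 0 ≤ r) : (r : ℂ) ∈ HomSchr.spectrum (H ξ m) := by
  intro hz
  obtain ⟨C, hC, hb⟩ := norm_le_of_mem_resolventSet hξ hm hz
  obtain ⟨η, hη⟩ : ∃ η : 𝓓(halfLine, ℂ), testLp η ≠ 0 := by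
    by_contra! h
    obtain ⟨g, hg⟩ := exists_test_integral_psi_eq_one (k := 1) (by simp) hm
    have h0 := h g
    have h1 : (g : ℝ → ℂ) =ᵐ[halfLineMeasure] 0 :=
      (coeFn_testLp g).symm.trans (h0 ▸ Lp.coeFn_zero _ _ _)
    refine one_ne_zero (hg.symm.trans ?_)
    refine (integral_congr_ae ?_).trans (integral_zero _ _)
    filter_upwards [h1] with x hx
    simp [hx]
  have hderiv : MemLp (deriv η) 2 halfLineMeasure :=
    (contDiff_deriv η).continuous.memLp_of_hasCompactSupport η.hasCompactSupport.deriv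
  set A := ‖(memLp_expr (m ^ 2) η).toLp‖ with hA
  set B := ‖hderiv.toLp‖ with hB
  set κ := Real.sqrt r with hκ
  have hκ2 : (κ : ℂ) ^ 2 = r := by exact_mod_cast Real.sq_sqrt hr
  have hκ0 : 0 ≤ κ := Real.sqrt_nonneg r
  have hest (n : ℕ) (hn : 0 < n) : n ^ 2 * ‖testLp η‖ ≤ C * (A + 2 * n * κ * B) := by
    set c : ℂ := Complex.I * (n * κ) with hc
    have hexp (x : ℝ) : ‖Complex.exp (c * x)‖ = 1 := by
      rw [Complex.norm_exp, hc]
      simp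
    have hc2 : c ^ 2 = -(n ^ 2 * r) := by
      rw [hc, mul_pow, Complex.I_sq, mul_pow, hκ2]
      ring
    have hcn : ‖c‖ = n * κ := by
      rw [hc, norm_mul, norm_mul, Complex.norm_I, one_mul, RCLike.norm_natCast, Complex.norm_real,
        Real.norm_of_nonneg hκ0]
    have hp : (testLp (waveTest η c), (memLp_expr (m ^ 2) (waveTest η c)).toLp) ∈ (H ξ m).graph :=
      closure_testGraph_le_graph_H hξ hm (Submodule.le_topologicalClosure _
        ⟨waveTest η c, coeFn_testLp _, (memLp_expr _ _).coeFn_toLp⟩)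
    have h1 := hb n hn _ hp
    have h2 : ‖testLp (waveTest η c)‖ = ‖testLp η‖ := by
      refine le_antisymm (Lp.norm_le_norm_of_ae_le ?_) (Lp.norm_le_norm_of_ae_le ?_) <;>
      · filter_upwards [coeFn_testLp (waveTest η c), coeFn_testLp η] with x h3 h4
        rw [h3, h4, show waveTest η c x = η x * Complex.exp (c * x) from rfl, norm_mul, hexp, mul_one]
    have h3 : ‖((n : ℂ) ^ 2 * r) • testLp (waveTest η c) - (memLp_expr (m ^ 2) (waveTest η c)).toLp‖
        ≤ ‖(memLp_expr (m ^ 2) η).toLp - (2 * c) • hderiv.toLp‖ := by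
      refine Lp.norm_le_norm_of_ae_le ?_
      filter_upwards [Lp.coeFn_sub (((n : ℂ) ^ 2 * r) • testLp (waveTest η c))
          (memLp_expr (m ^ 2) (waveTest η c)).toLp,
        Lp.coeFn_smul ((n : ℂ) ^ 2 * r) (testLp (waveTest η c)), coeFn_testLp (waveTest η c),
        (memLp_expr (m ^ 2) (waveTest η c)).coeFn_toLp,
        Lp.coeFn_sub (memLp_expr (m ^ 2) η).toLp ((2 * c) • hderiv.toLp),
        Lp.coeFn_smul (2 * c) hderiv.toLp, hderiv.coeFn_toLp, (memLp_expr (m ^ 2) η).coeFn_toLp]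
        with x e1 e2 e3 e4 e5 e6 e7 e8
      rw [e1, Pi.sub_apply, e2, Pi.smul_apply, e3, e4, e5, Pi.sub_apply, e6, Pi.smul_apply, e7, e8,
        show waveTest η c x = η x * Complex.exp (c * x) from rfl,
        show expr (m ^ 2) (waveTest η c) x = _ from expr_test_mul_exp (m ^ 2) η c, hc2, ← norm_neg]
      refine le_of_eq ?_
      rw [show -(((n : ℂ) ^ 2 * r) • (η x * Complex.exp (c * x)) - Complex.exp (c * x)
        * (expr (m ^ 2) η x - 2 * c * deriv η x - -((n : ℂ) ^ 2 * r) * η x))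
        = Complex.exp (c * x) * (expr (m ^ 2) η x - (2 * c) • deriv η x) by
          simp only [smul_eq_mul]; ring, norm_mul, hexp, one_mul]
    have h4 : ‖(memLp_expr (m ^ 2) η).toLp - (2 * c) • hderiv.toLp‖ ≤ A + 2 * n * κ * B := by
      refine (norm_sub_le _ _).trans ?_
      rw [norm_smul, norm_mul, hcn, RCLike.norm_ofNat, ← mul_assoc]
    rw [← h2]
    exact h1.trans (mul_le_mul_of_nonneg_left (h3.trans h4) hC)
  have ha : 0 < ‖testLp η‖ := norm_pos_iff.2 hη
  have hA0 : 0 ≤ A := norm_nonneg _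
  have hB0 : 0 ≤ B := norm_nonneg _
  obtain ⟨n, hn⟩ := exists_nat_gt (C * (A + 2 * κ * B) / ‖testLp η‖)
  have hn0 : (0 : ℝ) < n := lt_of_le_of_lt (by positivity) hn
  have hn1 : (1 : ℝ) ≤ n := by exact_mod_cast Nat.cast_pos.1 hn0
  have h1 := hest n (Nat.cast_pos.1 hn0)
  rw [div_lt_iff₀ ha] at hn
  have h2 : C * (A + 2 * n * κ * B) ≤ C * (n * (A + 2 * κ * B)) := by
    refine mul_le_mul_of_nonneg_left ?_ hC
    nlinarith
  have h3 : (n : ℝ) * (n * ‖testLp η‖) ≤ n * (C * (A + 2 * κ * B)) := by nlinarith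
  exact absurd (le_of_mul_le_mul_left h3 hn0) (not_le.2 hn)

theorem spectrum_H {ξ : ℝ → ℝ} (hξ : IsCutoff ξ) {m : ℂ} (hm : -1 < m.re) :
    HomSchr.spectrum (H ξ m) = {z : ℂ | ∃ r : ℝ, 0 ≤ r ∧ z = r} := by
  ext z
  constructor
  · intro h
    by_contra hz
    obtain ⟨k, hk, rfl⟩ := exists_neg_sq_eq hz
    exact h (neg_sq_mem_resolventSet hξ hm hk)
  · rintro ⟨r, hr, rfl⟩
    exact ofReal_mem_spectrum hξ hm hr

end

end HomSchr

/-! ### Assembly of the statements -/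

open HomSchr in
theorem mainTheorem3 (ξ : ℝ → ℝ) (hξ : IsCutoff ξ) :
    (∀ m : ℂ, 1 ≤ m.re → Lmin (m ^ 2) = H ξ m ∧ H ξ m = Lmax (m ^ 2)) ∧
    (∀ m : ℂ, -1 < m.re → m.re < 1 →
      Lmin (m ^ 2) < H ξ m ∧ H ξ m < Lmax (m ^ 2) ∧
      codim (Lmin (m ^ 2)).domain (H ξ m).domain = 1 ∧
      codim (H ξ m).domain (Lmax (m ^ 2)).domain = 1) ∧
    (∀ m : ℂ, -1 < m.re →
      Dense ((H ξ m).domain : Set HalfLineL2) ∧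
      (H ξ m).adjoint = H ξ (starRingEnd ℂ m)) ∧
    (∀ m : ℝ, -1 < m → IsSelfAdjoint (H ξ (m : ℂ))) ∧
    (∀ m : ℂ, -1 < m.re → IsHomogeneous (H ξ m) (-2)) ∧
    (∀ m : ℂ, -1 < m.re → HomSchr.spectrum (H ξ m) = {z : ℂ | ∃ r : ℝ, 0 ≤ r ∧ z = r}) ∧
    IsHolomorphicFamily {m : ℂ | -1 < m.re} (H ξ) := by
  refine ⟨fun m hm => ⟨Lmin_eq_H hξ hm, H_eq_Lmax hξ hm⟩,
    fun m hm hm1 => Lmin_lt_H_lt_Lmax hξ hm hm1,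
    fun m hm => ⟨dense_domain_H hξ hm, adjoint_H_eq hξ hm⟩, fun m hm => ?_,
    fun m hm => isHomogeneous_H hξ hm, fun m hm => spectrum_H hξ hm, isHolomorphicFamily_H hξ⟩
  -- Self-adjointness unfolds to equality with the adjoint, and a real index is its own conjugate.
  have h := adjoint_H_eq hξ (m := (m : ℂ)) (by simpa using hm)
  rw [Complex.star_def, Complex.conj_ofReal] at h
  exact h
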